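/- **Setting.** Let $0<t_1<t_2$ and $\xi_1,\xi_2,\eta_1,\eta_2\in\mathbb{R}$. Put $\Delta t=t_2-t_1$, $\alpha=(t_1/\Delta t)^{1/3}$, $\alpha'=(1+\alpha^3)^{1/3}=(t_2/\Delta t)^{1/3}$, $$\Delta\xi=\xi_2\Big(\frac{t_2}{\Delta t}\Big)^{1/3}-\xi_1\Big(\frac{t_1}{\Delta t}\Big)^{1/3},\qquad \Delta\eta=\eta_2\Big(\frac{t_2}{\Delta t}\Big)^{2/3}-\eta_1\Big(\frac{t_1}{\Delta t}\Big)^{2/3}.$$ Let $\mathrm{Ai}$ be the Airy function and set $$K_{\mathrm{Ai}}(x,y)=\int_0^\infty \mathrm{Ai}(x+s)\mathrm{Ai}(y+s)\,ds,\qquad \mathrm{Ai}_{\xi,\eta}(x,y)=\mathrm{Ai}(\xi+\eta^2+x+y)\,e^{(\xi+x+y)\eta+\frac23\eta^3}.$$ For a kernel $k$ on a measure space $(\Lambda,\rho)$, $\det(I+k)$ denotes the Fredholm determinant $$\det(I+k)=\sum_{n\ge0}\frac1{n!}\int_{\Lambda^n}\det\big(k(\lambda_p,\lambda_q)\big)_{1\le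 p,q\le n}\,d\rho^n(\lambda).$$ A $2\times2$ matrix of kernels on a direct sum $L^2(A_1)\oplus L^2(A_2)$, $A_1,A_2\subseteq\mathbb{R}$, is regarded as a kernel on the disjoint union of $A_1$ and $A_2$ with Lebesgue measure. $\gamma_r$ is the positively oriented circle of radius $r$ around $0$, and $1(\cdot)$ is an indicator function. **The two-time distribution.** For $\delta>\max(\eta_1,\alpha\Delta\eta)$ and $x,y\in\mathbb{R}$ let $$S_1(x,y)=-\alpha e^{(\eta_1-\delta)x+(\delta-\alpha\Delta\eta)y}\int_0^\infty e^{(\alpha\Delta\eta-\eta_1)s}K_{\mathrm{Ai}}(\xi_1+\eta_1^2-s,\xi_1+\eta_1^2-x)K_{\mathrm{Ai}}(\Delta\xi+\Delta\eta^2+\alpha s,\Delta\xi+\Delta\eta^2+\alpha y)\,ds,$$ $$T_1(x,y)=\alpha e^{(\eta_1-\delta)x+(\delta-\alpha\Delta\eta)y}\int_{-\infty}^0 e^{(\alpha\Delta\eta-\eta_1)s}K_{\mathrm{Ai}}(\xi_1+\eta_1^2-s,\xi_1+\eta_1^2-x)K_{\mathrm{Ai}}(\Delta\xi+\Delta\eta^2+\alpha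 s,\Delta\xi+\Delta\eta^2+\alpha y)\,ds,$$ $$S_2(x,y)=\alpha e^{(\delta-\alpha\Delta\eta)(y-x)}K_{\mathrm{Ai}}(\Delta\xi+\Delta\eta^2+\alpha x,\Delta\xi+\Delta\eta^2+\alpha y),$$ $$S_3(x,y)=e^{(\delta-\eta_1)(y-x)}K_{\mathrm{Ai}}(\xi_1+\eta_1^2-x,\xi_1+\eta_1^2-y),$$ $$S(x,y)=S_1(x,y)+1(x>0)S_2(x,y)-S_3(x,y)1(y<0),$$ $$T(x,y)=-T_1(x,y)-1(x>0)S_2(x,y)+S_3(x,y)1(y<0).$$ For $u\in\mathbb{C}\setminus\{0\}$ put $R_u=S+u^{-1}T$ and, on $X=L^2(\mathbb{R}_-)\oplus L^2(\mathbb{R}_+)$, $$K(u)=\begin{pmatrix}R_u&R_u\\uR_u&uR_u\end{pmatrix}.$$ The two-time distribution is $$F_{\text{two-time}}(\xi_1,\eta_1;\xi_2,\eta_2;\alpha)=\frac1{2\pi\mathrm{i}}\int_{\gamma_{r}}\frac1{u-1}\det(I+K(u))_X\,du,\qquad r>1.$$ **The kernel $Q(u)$.** For $v_1,v_2>0$ let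 $$M_1(v_1,v_2)=e^{\delta(v_1-v_2)}\int_0^\infty \mathrm{Ai}_{\xi_1,\eta_1}(v_1,\lambda)\mathrm{Ai}_{\xi_1,-\eta_1}(\lambda,v_2)\,d\lambda,$$ $$M_2(v_1,v_2)=\frac1{\alpha'}\int_0^\infty \mathrm{Ai}_{\xi_2,-\eta_2}\Big(\frac{v_1}{\alpha'},\lambda\Big)\mathrm{Ai}_{\xi_2,\eta_2}\Big(\lambda,\frac{v_2}{\alpha'}\Big)\,d\lambda,$$ $$M_3(v_1,v_2)=\int_0^\infty \mathrm{Ai}_{\Delta\xi,-\Delta\eta}(v_1,\lambda)\mathrm{Ai}_{\Delta\xi,\Delta\eta}(\lambda,v_2)\,d\lambda,$$ $$k_1(v_1,v_2)=\alpha\int_{\mathbb{R}_+^3}\mathrm{Ai}_{\Delta\xi,-\Delta\eta}(v_1,-\alpha\lambda_1)\mathrm{Ai}_{\xi_1,-\eta_1}(\lambda_1,\lambda_2)\mathrm{Ai}_{\xi_1,\eta_1}(\lambda_2,\lambda_3)\mathrm{Ai}_{\Delta\xi,\Delta\eta}(-\alpha\lambda_3,v_2)\,d^3\lambda,$$ $$k_2(v_1,v_2)=\alpha\int_{\mathbb{R}_+^2}\mathrm{Ai}_{\xi_2,-\eta_2}\Big(\frac{v_1}{\alpha'},\alpha\lambda_1\Big)\mathrm{Ai}_{\xi_1,\eta_1}(\alpha'\lambda_1,\lambda_2)\mathrm{Ai}_{\Delta\xi,\Delta\eta}(-\alpha\lambda_2,v_2)\,d^2\lambda,$$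 $$k_3(v_1,v_2)=\alpha e^{-\delta v_2}\int_{\mathbb{R}_+}\mathrm{Ai}_{\Delta\xi,-\Delta\eta}(v_1,-\alpha\lambda)\mathrm{Ai}_{\xi_1,-\eta_1}(\lambda,v_2)\,d\lambda,$$ $$k_4(v_1,v_2)=e^{-\delta v_2}\frac{\alpha}{\alpha'}\mathrm{Ai}_{\xi_2,-\eta_2}\Big(\frac{v_1}{\alpha'},\frac{\alpha v_2}{\alpha'}\Big),$$ $$k_5(v_1,v_2)=\alpha\int_{\mathbb{R}_+^2}\mathrm{Ai}_{\Delta\xi,-\Delta\eta}(v_1,-\alpha\lambda_1)\mathrm{Ai}_{\xi_1,-\eta_1}(\lambda_1,\alpha'\lambda_2)\mathrm{Ai}_{\xi_2,\eta_2}\Big(\alpha\lambda_2,\frac{v_2}{\alpha'}\Big)\,d^2\lambda,$$ $$k_6(v_1,v_2)=e^{\delta v_1}\int_{\mathbb{R}_+^3}\mathrm{Ai}_{\xi_1,\eta_1}(v_1,\lambda_1)\mathrm{Ai}_{\xi_1,-\eta_1}(\lambda_1,\lambda_2)\mathrm{Ai}_{\xi_1,\eta_1}(\lambda_2,\lambda_3)\mathrm{Ai}_{\Delta\xi,\Delta\eta}(-\alpha\lambda_3,v_2)\,d^3\lambda,$$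 $$k_7(v_1,v_2)=e^{\delta v_1}\int_{\mathbb{R}_+^2}\mathrm{Ai}_{\xi_1,\eta_1}(v_1,\lambda_1)\mathrm{Ai}_{\xi_1,-\eta_1}(\lambda_1,\alpha'\lambda_2)\mathrm{Ai}_{\xi_2,\eta_2}\Big(\alpha\lambda_2,\frac{v_2}{\alpha'}\Big)\,d^2\lambda,$$ and on $Y=L^2(\mathbb{R}_+)\oplus L^2(\mathbb{R}_+)$ define $Q(u)=\begin{pmatrix}Q_{11}(u)&Q_{12}(u)\\Q_{21}(u)&Q_{22}(u)\end{pmatrix}$ by $$Q_{11}(u)=(2-u-u^{-1})k_1+(u-1)(k_2+k_5)+(u-1)M_3-uM_2,$$ $$Q_{12}(u)=(u+u^{-1}-2)k_3+(1-u)k_4,$$ $$Q_{21}(u)=(1-u^{-1})k_6-k_7,\qquad Q_{22}(u)=(u^{-1}-1)M_1.$$ **Proposition 6.1.** For every $u\ne0$ the Fredholm expansions of $\det(I+K(u))_X$ and $\det(I+Q(u))_Y$ converge absolutely (each integral, and the series of the resulting terms), and for every $r>1$ both $\frac1{u-1}\det(I+K(u))_X$ and $\frac1{u-1}\det(I+Q(u))_Y$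 are integrable over $\gamma_r$. The two-time distribution is given by $$F_{\text{two-time}}(\xi_1,\eta_1;\xi_2,\eta_2;\alpha)=\frac1{2\pi\mathrm{i}}\int_{\gamma_r}\frac1{u-1}\det(I+Q(u))_Y\,du$$ for every $r>1$ and every $\delta>\max(\eta_1,\alpha\Delta\eta)$, where the radius and the value of $\delta$ used in the definition of $F_{\text{two-time}}$ may be any admissible ones, possibly different from those used on the right-hand side. -/

import Mathlib

open MeasureTheory
open scoped Nat

noncomputable section

namespace TwoTime

/-! ### Airy function and Airy kernels -/

/-- The Airy function `Ai(x) = (1 / 2πi) ∫_Γ exp(z³/3 - x z) dz`, where `Γ` is the upward oriented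
vertical line `t ↦ 1 + i t`; the integral converges absolutely and is real. -/
def airy (x : ℝ) : ℝ :=
  ((2 * Real.pi : ℂ)⁻¹ *
    ∫ t : ℝ, Complex.exp ((1 + t * Complex.I) ^ 3 / 3 - x * (1 + t * Complex.I))).re

/-- The Airy kernel `K_Ai(x, y) = ∫₀^∞ Ai(x + s) Ai(y + s) ds`. -/
def airyKernel (x y : ℝ) : ℝ :=
  ∫ s in Set.Ioi (0 : ℝ), airy (x + s) * airy (y + s)

/-- The shifted Airy kernel
`Ai_{ξ,η}(x, y) = Ai(ξ + η² + x + y) exp((ξ + x + y) η + 2 η³ / 3)`. -/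
def shiftedAiry (ξ η x y : ℝ) : ℝ :=
  airy (ξ + η ^ 2 + x + y) * Real.exp ((ξ + x + y) * η + 2 / 3 * η ^ 3)

/-! ### Parameters -/

/-- The two times, the two heights and the two positions. This is plain data; the requirement
`0 < t₁ < t₂` is imposed separately. -/
structure Params where
  /-- first time -/
  t₁ : ℝ
  /-- second time -/
  t₂ : ℝ
  /-- height parameter at the first time -/
  ξ₁ : ℝ
  /-- height parameter at the second time -/
  ξ₂ : ℝ
  /-- position parameter at the first time -/
  η₁ : ℝ
  /-- position parameter at the second time -/
  η₂ : ℝ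

namespace Params

variable (P : Params)

/-- `α = (t₁ / Δt)^{1/3}` with `Δt = t₂ - t₁`. -/
def α : ℝ := (P.t₁ / (P.t₂ - P.t₁)) ^ (1 / 3 : ℝ)

/-- `α' = (1 + α³)^{1/3}`, which is `(t₂ / Δt)^{1/3}`. -/
def α' : ℝ := (1 + P.α ^ 3) ^ (1 / 3 : ℝ)

/-- `Δη = η₂ (t₂ / Δt)^{2/3} - η₁ (t₁ / Δt)^{2/3}`. -/
def Δη : ℝ :=
  P.η₂ * (P.t₂ / (P.t₂ - P.t₁)) ^ (2 / 3 : ℝ) - P.η₁ * (P.t₁ / (P.t₂ - P.t₁)) ^ (2 / 3 : ℝ)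

/-- `Δξ = ξ₂ (t₂ / Δt)^{1/3} - ξ₁ (t₁ / Δt)^{1/3}`. -/
def Δξ : ℝ :=
  P.ξ₂ * (P.t₂ / (P.t₂ - P.t₁)) ^ (1 / 3 : ℝ) - P.ξ₁ * (P.t₁ / (P.t₂ - P.t₁)) ^ (1 / 3 : ℝ)

end Params

/-! ### Fredholm determinants -/

section Fredholm

variable {Λ : Type*} [MeasurableSpace Λ]

/-- The integrand `det (K(λ_p, λ_q))_{1 ≤ p, q ≤ n}` of the `n`-th term of the Fredholm expansion. -/
def fredholmIntegrand (K : Λ → Λ → ℂ) (n : ℕ) (l : Fin n → Λ) : ℂ :=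
  (Matrix.of fun p q : Fin n => K (l p) (l q)).det

/-- The `n`-th term `(1 / n!) ∫_{Λⁿ} det (K(λ_p, λ_q)) dρⁿ(λ)` of the Fredholm expansion. -/
def fredholmTerm (ρ : Measure Λ) (K : Λ → Λ → ℂ) (n : ℕ) : ℂ :=
  (n ! : ℂ)⁻¹ * ∫ l : Fin n → Λ, fredholmIntegrand K n l ∂(Measure.pi fun _ : Fin n => ρ)

/-- The Fredholm determinant `det (I + K)` on `L²(Λ, ρ)`, by its Fredholm expansion. -/
def fredholmDet (ρ : Measure Λ) (K : Λ → Λ → ℂ) : ℂ :=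
  ∑' n : ℕ, fredholmTerm ρ K n

/-- The Fredholm expansion of `det (I + K)` on `L²(Λ, ρ)` is well defined: all of its integrals
converge absolutely, and so does the series. -/
structure FredholmConverges (ρ : Measure Λ) (K : Λ → Λ → ℂ) : Prop where
  integrable : ∀ n : ℕ, Integrable (fredholmIntegrand K n) (Measure.pi fun _ : Fin n => ρ)
  summable : Summable fun n : ℕ => ‖fredholmTerm ρ K n‖

end Fredholm

/-- For `A₀, A₁ ⊆ ℝ`, the measure on `{0, 1} × ℝ` which is Lebesgue measure on `{0} × A₀` and on
`{1} × A₁`, and zero elsewhere, so that `L²` of it is `L²(A₀) ⊕ L²(A₁)`. -/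
def blockMeasure (A : Fin 2 → Set ℝ) : Measure (Fin 2 × ℝ) :=
  ((Measure.count : Measure (Fin 2)).prod (volume : Measure ℝ)).restrict {p | p.2 ∈ A p.1}

/-- A `2 × 2` matrix of kernels, as a single kernel on `{0, 1} × ℝ`. -/
def blockKernel (k : ℝ → ℝ → Matrix (Fin 2) (Fin 2) ℂ) (p q : Fin 2 × ℝ) : ℂ :=
  k p.2 q.2 p.1 q.1

/-- The measure whose `L²` space is `X = L²(ℝ₋) ⊕ L²(ℝ₊)`. -/
def measureX : Measure (Fin 2 × ℝ) := blockMeasure ![Set.Iio 0, Set.Ioi 0]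

/-- The measure whose `L²` space is `Y = L²(ℝ₊) ⊕ L²(ℝ₊)`. -/
def measureY : Measure (Fin 2 × ℝ) := blockMeasure ![Set.Ioi 0, Set.Ioi 0]

/-! ### The kernel `K(u)` and the two-time distribution -/

section KernelK

variable (P : Params) (δ : ℝ)

/-- The kernel `S₁(x, y)`, an integral over `s > 0`. -/
def S₁ (x y : ℝ) : ℝ :=
  -P.α * Real.exp ((P.η₁ - δ) * x + (δ - P.α * P.Δη) * y) *
    ∫ s in Set.Ioi (0 : ℝ), Real.exp ((P.α * P.Δη - P.η₁) * s) *
      airyKernel (P.ξ₁ + P.η₁ ^ 2 - s) (P.ξ₁ + P.η₁ ^ 2 - x) *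
      airyKernel (P.Δξ + P.Δη ^ 2 + P.α * s) (P.Δξ + P.Δη ^ 2 + P.α * y)

/-- The kernel `T₁(x, y)`, the same integrand over `s < 0` with opposite sign. -/
def T₁ (x y : ℝ) : ℝ :=
  P.α * Real.exp ((P.η₁ - δ) * x + (δ - P.α * P.Δη) * y) *
    ∫ s in Set.Iio (0 : ℝ), Real.exp ((P.α * P.Δη - P.η₁) * s) *
      airyKernel (P.ξ₁ + P.η₁ ^ 2 - s) (P.ξ₁ + P.η₁ ^ 2 - x) *
      airyKernel (P.Δξ + P.Δη ^ 2 + P.α * s) (P.Δξ + P.Δη ^ 2 + P.α * y)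

/-- The kernel `S₂(x, y)`. -/
def S₂ (x y : ℝ) : ℝ :=
  P.α * Real.exp ((δ - P.α * P.Δη) * (y - x)) *
    airyKernel (P.Δξ + P.Δη ^ 2 + P.α * x) (P.Δξ + P.Δη ^ 2 + P.α * y)

/-- The kernel `S₃(x, y)`. -/
def S₃ (x y : ℝ) : ℝ :=
  Real.exp ((δ - P.η₁) * (y - x)) *
    airyKernel (P.ξ₁ + P.η₁ ^ 2 - x) (P.ξ₁ + P.η₁ ^ 2 - y)

/-- `S(x, y) = S₁(x, y) + 1(x > 0) S₂(x, y) - S₃(x, y) 1(y < 0)`. -/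
def S (x y : ℝ) : ℝ :=
  S₁ P δ x y + (if 0 < x then S₂ P δ x y else 0) - (if y < 0 then S₃ P δ x y else 0)

/-- `T(x, y) = -T₁(x, y) - 1(x > 0) S₂(x, y) + S₃(x, y) 1(y < 0)`. -/
def T (x y : ℝ) : ℝ :=
  -T₁ P δ x y - (if 0 < x then S₂ P δ x y else 0) + (if y < 0 then S₃ P δ x y else 0)

/-- `R(u) = S + u⁻¹ T`. -/
def R (u : ℂ) (x y : ℝ) : ℂ := (S P δ x y : ℂ) + u⁻¹ * (T P δ x y : ℂ)

/-- The matrix kernel `K(u)` on `X`. -/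
def K (u : ℂ) (x y : ℝ) : Matrix (Fin 2) (Fin 2) ℂ :=
  !![R P δ u x y, R P δ u x y;
     u * R P δ u x y, u * R P δ u x y]

/-- `det (I + K(u))_X`. -/
def detK (u : ℂ) : ℂ := fredholmDet measureX (blockKernel (K P δ u))

/-- The two-time distribution `(1 / 2πi) ∮_{γ_r} (u - 1)⁻¹ det (I + K(u))_X du`, written with the
auxiliary parameters `δ > max (η₁, α Δη)` and `r > 1`. -/
def twoTimeF (r : ℝ) : ℂ :=
  (2 * Real.pi * Complex.I : ℂ)⁻¹ * ∮ u in C(0, r), (u - 1)⁻¹ * detK P δ u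

end KernelK

/-! ### The kernel `Q(u)` -/

section KernelQ

variable (P : Params) (δ : ℝ)

def M₁ (v₁ v₂ : ℝ) : ℝ :=
  Real.exp (δ * (v₁ - v₂)) *
    ∫ l in Set.Ioi (0 : ℝ), shiftedAiry P.ξ₁ P.η₁ v₁ l * shiftedAiry P.ξ₁ (-P.η₁) l v₂

def M₂ (v₁ v₂ : ℝ) : ℝ :=
  1 / P.α' *
    ∫ l in Set.Ioi (0 : ℝ),
      shiftedAiry P.ξ₂ (-P.η₂) (v₁ / P.α') l * shiftedAiry P.ξ₂ P.η₂ l (v₂ / P.α')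

def M₃ (v₁ v₂ : ℝ) : ℝ :=
  ∫ l in Set.Ioi (0 : ℝ), shiftedAiry P.Δξ (-P.Δη) v₁ l * shiftedAiry P.Δξ P.Δη l v₂

def k₁ (v₁ v₂ : ℝ) : ℝ :=
  P.α * ∫ l₁ in Set.Ioi (0 : ℝ), ∫ l₂ in Set.Ioi (0 : ℝ), ∫ l₃ in Set.Ioi (0 : ℝ),
    shiftedAiry P.Δξ (-P.Δη) v₁ (-P.α * l₁) * shiftedAiry P.ξ₁ (-P.η₁) l₁ l₂ *
      shiftedAiry P.ξ₁ P.η₁ l₂ l₃ * shiftedAiry P.Δξ P.Δη (-P.α * l₃) v₂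

def k₂ (v₁ v₂ : ℝ) : ℝ :=
  P.α * ∫ l₁ in Set.Ioi (0 : ℝ), ∫ l₂ in Set.Ioi (0 : ℝ),
    shiftedAiry P.ξ₂ (-P.η₂) (v₁ / P.α') (P.α * l₁) * shiftedAiry P.ξ₁ P.η₁ (P.α' * l₁) l₂ *
      shiftedAiry P.Δξ P.Δη (-P.α * l₂) v₂

def k₃ (v₁ v₂ : ℝ) : ℝ :=
  P.α * Real.exp (-δ * v₂) *
    ∫ l in Set.Ioi (0 : ℝ),
      shiftedAiry P.Δξ (-P.Δη) v₁ (-P.α * l) * shiftedAiry P.ξ₁ (-P.η₁) l v₂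

def k₄ (v₁ v₂ : ℝ) : ℝ :=
  Real.exp (-δ * v₂) * (P.α / P.α') *
    shiftedAiry P.ξ₂ (-P.η₂) (v₁ / P.α') (P.α * v₂ / P.α')

def k₅ (v₁ v₂ : ℝ) : ℝ :=
  P.α * ∫ l₁ in Set.Ioi (0 : ℝ), ∫ l₂ in Set.Ioi (0 : ℝ),
    shiftedAiry P.Δξ (-P.Δη) v₁ (-P.α * l₁) * shiftedAiry P.ξ₁ (-P.η₁) l₁ (P.α' * l₂) *
      shiftedAiry P.ξ₂ P.η₂ (P.α * l₂) (v₂ / P.α')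

def k₆ (v₁ v₂ : ℝ) : ℝ :=
  Real.exp (δ * v₁) *
    ∫ l₁ in Set.Ioi (0 : ℝ), ∫ l₂ in Set.Ioi (0 : ℝ), ∫ l₃ in Set.Ioi (0 : ℝ),
      shiftedAiry P.ξ₁ P.η₁ v₁ l₁ * shiftedAiry P.ξ₁ (-P.η₁) l₁ l₂ *
        shiftedAiry P.ξ₁ P.η₁ l₂ l₃ * shiftedAiry P.Δξ P.Δη (-P.α * l₃) v₂

/-- The factor `Ai_{ξ₁,η₁}(v₁, λ₁)` is the one given by the contour integral form
`(2πi)⁻³ e^{δ v₁} ∫ G_{ξ₁+v₁,η₁}(z) G_{ξ₂+v₂/α',η₂}(w) / (G_{ξ₁,η₁}(ζ) (α w - α' ζ) (z - ζ))`. -/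
def k₇ (v₁ v₂ : ℝ) : ℝ :=
  Real.exp (δ * v₁) *
    ∫ l₁ in Set.Ioi (0 : ℝ), ∫ l₂ in Set.Ioi (0 : ℝ),
      shiftedAiry P.ξ₁ P.η₁ v₁ l₁ * shiftedAiry P.ξ₁ (-P.η₁) l₁ (P.α' * l₂) *
        shiftedAiry P.ξ₂ P.η₂ (P.α * l₂) (v₂ / P.α')

def Q₁₁ (u : ℂ) (v₁ v₂ : ℝ) : ℂ :=
  (2 - u - u⁻¹) * (k₁ P v₁ v₂ : ℂ) + (u - 1) * ((k₂ P v₁ v₂ : ℂ) + (k₅ P v₁ v₂ : ℂ)) +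
    (u - 1) * (M₃ P v₁ v₂ : ℂ) - u * (M₂ P v₁ v₂ : ℂ)

def Q₁₂ (u : ℂ) (v₁ v₂ : ℝ) : ℂ :=
  (u + u⁻¹ - 2) * (k₃ P δ v₁ v₂ : ℂ) + (1 - u) * (k₄ P δ v₁ v₂ : ℂ)

def Q₂₁ (u : ℂ) (v₁ v₂ : ℝ) : ℂ :=
  (1 - u⁻¹) * (k₆ P δ v₁ v₂ : ℂ) - (k₇ P δ v₁ v₂ : ℂ)

def Q₂₂ (u : ℂ) (v₁ v₂ : ℝ) : ℂ :=
  (u⁻¹ - 1) * (M₁ P δ v₁ v₂ : ℂ)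

/-- The matrix kernel `Q(u)` on `Y`. -/
def Q (u : ℂ) (v₁ v₂ : ℝ) : Matrix (Fin 2) (Fin 2) ℂ :=
  !![Q₁₁ P u v₁ v₂, Q₁₂ P δ u v₁ v₂;
     Q₂₁ P δ u v₁ v₂, Q₂₂ P δ u v₁ v₂]

/-- `det (I + Q(u))_Y`. -/
def detQ (u : ℂ) : ℂ := fredholmDet measureY (blockKernel (Q P δ u))

end KernelQ

end TwoTime

end

/-!
# The two-time distribution through the kernel `Q(u)`

Up to null sets `X` is `L²(ℝ)`, and `I + K(u)` is `I + D R(u)` with `D` multiplication by `1` on the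
negative and by `u` on the positive half-line. The Airy kernels in `R(u)` factor: `S₃ = a b` and
`S₂ = c d`, where `a`, `c` map functions on `ℝ₊` to functions on `ℝ` and `b`, `d` go back, all four
being Airy functions times exponentials (`kA`, `kB`, `kC`, `kD`). With `1_{<0}`, `1_{>0}` the
projections on the half-lines this gives (`R_eq`)

  `R(u) = [-a b c + (1 - u⁻¹) (a b 1_{<0} c + 1_{>0} c)] d - (1 - u⁻¹) a · b 1_{<0}`,

so `K(u) = F G` with `G = (d, b 1_{<0})` from `X` to `Y` and `D` absorbed into `F`
(`kernelComp_factor_eq_K`), and the product in the other order is exactly `G F = Q(u)`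
(`kernelComp_factor_eq_Q`). The latter uses that `b c` and `d a`, integrals over the whole line, are
again shifted Airy functions, now of `(ξ₂, η₂)`: this is the convolution formula
`integral_airyPhi_mul_airyPhi`, which holds because the bilateral Laplace transform of a shifted Airy
function is the exponential of a cubic polynomial (`integral_cexp_mul_airyPhi`, by Fourier
inversion).

The Fredholm expansions of `F G` and `G F` agree term by term, by Fubini applied to each permutation
in the Leibniz formula (`DominatedPair.fredholmTerm_comm`). All interchanges are justified by
exponential bounds: shifting the contour gives `|Ai(x)| ≤ C exp(-c x)` on all of `ℝ` for each
`c > 0`, and as `δ > max(η₁, α Δη)` this bounds `F` and `G` by rank one kernels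
(`exists_kernelBounds`, `dominatedPair_factor`). Hadamard's inequality then gives the convergence of
the expansions, and holomorphy of the determinant on the punctured plane
(`differentiableOn_detK`), which makes the contour integral independent of the radius. Finally, `δ`
enters `K(u)` only through a conjugation (`detK_eq_detK_zero`).
-/

namespace TwoTime

/-! ### Fredholm expansions of dominated kernels -/

theorem measurable_comp₂ {X Y Z W : Type*} [MeasurableSpace X] [MeasurableSpace Y]
    [MeasurableSpace Z] [MeasurableSpace W] {k : X → Y → Z} (hk : Measurable (Function.uncurry k))
    {f : W → X} {g : W → Y} (hf : Measurable f) (hg : Measurable g) :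
    Measurable fun w => k (f w) (g w) := hk.comp (hf.prodMk hg)

open scoped ComplexOrder in
/-- Hadamard's determinant inequality for matrices with entries in the unit disc: apply the
inequality of arithmetic and geometric means to the eigenvalues of `M * Mᴴ`. -/
theorem norm_det_sq_le_of_norm_entry_le_one {n : ℕ} (M : Matrix (Fin n) (Fin n) ℂ)
    (hM : ∀ i j, ‖M i j‖ ≤ 1) : ‖M.det‖ ^ 2 ≤ (n : ℝ) ^ n := by
  rcases Nat.eq_zero_or_pos n with rfl | hn
  · simp
  have hn' : (0 : ℝ) < n := by exact_mod_cast hn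
  have hps := Matrix.posSemidef_self_mul_conjTranspose M
  have hH := hps.isHermitian
  have hdet : ‖M.det‖ ^ 2 = ∏ i, hH.eigenvalues i := by
    have h1 := hH.det_eq_prod_eigenvalues
    rw [Matrix.det_mul, Matrix.det_conjTranspose] at h1
    have h2 : ((‖M.det‖ ^ 2 : ℝ) : ℂ) = ((∏ i, hH.eigenvalues i : ℝ) : ℂ) := by
      push_cast
      rw [← Complex.mul_conj']
      simpa using h1
    exact_mod_cast h2
  have htr : ∑ i, hH.eigenvalues i ≤ (n : ℝ) * n := by
    have h1 := hH.trace_eq_sum_eigenvalues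
    have h2 : (M * M.conjTranspose).trace = ((∑ i, ∑ j, ‖M i j‖ ^ 2 : ℝ) : ℂ) := by
      simp [Matrix.trace, Matrix.mul_apply, Complex.mul_conj']
    have h3 : ∑ i, hH.eigenvalues i = ∑ i, ∑ j, ‖M i j‖ ^ 2 := by
      have : ((∑ i, hH.eigenvalues i : ℝ) : ℂ) = ((∑ i, ∑ j, ‖M i j‖ ^ 2 : ℝ) : ℂ) := by
        rw [← h2, h1]; push_cast; rfl
      exact_mod_cast this
    rw [h3]
    calc ∑ i, ∑ j, ‖M i j‖ ^ 2 ≤ ∑ _i : Fin n, ∑ _j : Fin n, (1 : ℝ) :=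
          Finset.sum_le_sum fun i _ => Finset.sum_le_sum fun j _ =>
            pow_le_one₀ (norm_nonneg _) (hM i j)
      _ = (n : ℝ) * n := by simp
  have hev : ∀ i, 0 ≤ hH.eigenvalues i := hps.eigenvalues_nonneg
  have hamgm := Real.geom_mean_le_arith_mean Finset.univ (fun _ : Fin n => (1 : ℝ))
    hH.eigenvalues (fun _ _ => zero_le_one) (by simpa using hn) (fun i _ => hev i)
  simp only [Real.rpow_one, one_mul, Finset.sum_const, Finset.card_univ, Fintype.card_fin,
    nsmul_eq_mul, mul_one] at hamgm
  have hle : (∏ i, hH.eigenvalues i) ^ ((n : ℝ)⁻¹) ≤ n :=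
    hamgm.trans ((div_le_iff₀ hn').2 htr)
  have hp0 : 0 ≤ ∏ i, hH.eigenvalues i := Finset.prod_nonneg fun i _ => hev i
  rw [hdet]
  calc ∏ i, hH.eigenvalues i = ((∏ i, hH.eigenvalues i) ^ ((n : ℝ)⁻¹)) ^ n := by
        rw [Real.rpow_inv_natCast_pow hp0 hn.ne']
    _ ≤ (n : ℝ) ^ n := pow_le_pow_left₀ (Real.rpow_nonneg hp0 _) hle n

theorem norm_det_le_of_norm_entry_le {n : ℕ} (M : Matrix (Fin n) (Fin n) ℂ) (r c : Fin n → ℝ)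
    (hr : ∀ i, 0 < r i) (hc : ∀ i, 0 < c i) (hM : ∀ i j, ‖M i j‖ ≤ r i * c j) :
    ‖M.det‖ ≤ √((n : ℝ) ^ n) * ∏ i, r i * c i := by
  set M' : Matrix (Fin n) (Fin n) ℂ := Matrix.of fun i j => M i j / ((r i : ℂ) * c j) with hM'
  have hent : M = Matrix.of fun i j => (c j : ℂ) * (Matrix.of fun i j => (r i : ℂ) * M' i j) i j := by
    ext i j
    have h1 : (r i : ℂ) ≠ 0 := by exact_mod_cast (hr i).ne'
    have h2 : (c j : ℂ) ≠ 0 := by exact_mod_cast (hc j).ne'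
    simp only [hM', Matrix.of_apply]
    field_simp
  have hdet : M.det = (∏ i, (c i : ℂ)) * ((∏ i, (r i : ℂ)) * M'.det) := by
    conv_lhs => rw [hent]
    rw [Matrix.det_mul_row, Matrix.det_mul_column]
  have hM1 : ‖M'.det‖ ≤ √((n : ℝ) ^ n) := by
    refine Real.le_sqrt_of_sq_le (norm_det_sq_le_of_norm_entry_le_one M' fun i j => ?_)
    simp only [hM', Matrix.of_apply, norm_div, norm_mul, Complex.norm_real, Real.norm_eq_abs,
      abs_of_pos (hr i), abs_of_pos (hc j)]
    exact (div_le_one (mul_pos (hr i) (hc j))).2 (hM i j)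
  rw [hdet, norm_mul, norm_mul, norm_prod, norm_prod, Finset.prod_mul_distrib]
  simp only [Complex.norm_real, Real.norm_eq_abs, abs_of_pos (hr _), abs_of_pos (hc _)]
  have h0 : 0 ≤ (∏ i, c i) * ∏ i, r i :=
    mul_nonneg (Finset.prod_nonneg fun i _ => (hc i).le) (Finset.prod_nonneg fun i _ => (hr i).le)
  calc (∏ i, c i) * ((∏ i, r i) * ‖M'.det‖) = ((∏ i, c i) * ∏ i, r i) * ‖M'.det‖ := by ring
    _ ≤ ((∏ i, c i) * ∏ i, r i) * √((n : ℝ) ^ n) := mul_le_mul_of_nonneg_left hM1 h0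
    _ = _ := by ring

/-- The majorant that Hadamard's inequality gives for the `n`-th term of a Fredholm expansion. -/
noncomputable def hadamardMajorant (C : ℝ) (n : ℕ) : ℝ := (n ! : ℝ)⁻¹ * (√((n : ℝ) ^ n) * C ^ n)

theorem summable_hadamardMajorant {C : ℝ} (hC : 0 ≤ C) : Summable (hadamardMajorant C) := by
  have hs : Summable fun n : ℕ =>
      (1 / 2 : ℝ) * ((2 * Real.exp 1 * C ^ 2) ^ n / n ! + (1 / 2 : ℝ) ^ n) :=
    ((Real.summable_pow_div_factorial _).add (summable_geometric_two)).mul_left _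
  refine Summable.of_nonneg_of_le (fun n => ?_) (fun n => ?_) hs
  · unfold hadamardMajorant; positivity
  have hf : (0 : ℝ) < n ! := by exact_mod_cast n.factorial_pos
  set t := hadamardMajorant C n with ht
  have hnn : (n : ℝ) ^ n ≤ Real.exp 1 ^ n * n ! := by
    have := Real.pow_div_factorial_le_exp (x := (n : ℝ)) n.cast_nonneg n
    rw [div_le_iff₀ hf] at this
    simpa [← Real.exp_nat_mul] using this
  have ht2 : t ^ 2 ≤ (Real.exp 1 * C ^ 2) ^ n / n ! := by
    have h1 : t ^ 2 = (n : ℝ) ^ n * (C ^ 2) ^ n / (n ! : ℝ) ^ 2 := by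
      rw [ht, hadamardMajorant, mul_pow, mul_pow, Real.sq_sqrt (by positivity)]
      field_simp
      ring
    rw [h1, div_le_div_iff₀ (by positivity) hf, mul_pow]
    calc (n : ℝ) ^ n * (C ^ 2) ^ n * n ! ≤ (Real.exp 1 ^ n * n !) * (C ^ 2) ^ n * n ! := by gcongr
      _ = _ := by ring
  -- `t ≤ (2ⁿ t² + 2⁻ⁿ) / 2` turns the square root of `1 / n!` into `1 / n!`.
  have h2 : (0 : ℝ) < 2 ^ n := by positivity
  have h3 : 2 * t ≤ 2 ^ n * t ^ 2 + (1 / 2 : ℝ) ^ n := by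
    have : (1 / 2 : ℝ) ^ n = (2 ^ n)⁻¹ := by rw [one_div, inv_pow]
    rw [this]
    have h4 : 0 ≤ (2 ^ n * t - 1) ^ 2 / 2 ^ n := by positivity
    have h5 : (2 ^ n * t - 1) ^ 2 / 2 ^ n = 2 ^ n * t ^ 2 + (2 ^ n)⁻¹ - 2 * t := by
      field_simp
      ring
    linarith
  have h6 : 2 ^ n * t ^ 2 ≤ (2 * Real.exp 1 * C ^ 2) ^ n / n ! := by
    calc 2 ^ n * t ^ 2 ≤ 2 ^ n * ((Real.exp 1 * C ^ 2) ^ n / n !) := by gcongr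
      _ = _ := by rw [mul_assoc, mul_pow 2 (Real.exp 1 * C ^ 2)]; ring
  linarith

section Fredholm

variable {Λ : Type*} [MeasurableSpace Λ] {ρ : Measure Λ} {K K' : Λ → Λ → ℂ}

theorem measurable_fredholmIntegrand (hK : Measurable (Function.uncurry K)) (n : ℕ) :
    Measurable (fredholmIntegrand K n) := by
  have : fredholmIntegrand K n = fun l => ∑ σ : Equiv.Perm (Fin n),
      ((Equiv.Perm.sign σ : ℤ) : ℂ) * ∏ i, K (l (σ i)) (l i) := by
    ext l
    simp [fredholmIntegrand, Matrix.det_apply']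
  rw [this]
  refine Finset.measurable_fun_sum _ fun σ _ => Measurable.const_mul ?_ _
  refine Finset.measurable_fun_prod _ fun i _ => ?_
  exact measurable_comp₂ hK (measurable_pi_apply (σ i)) (measurable_pi_apply i)

theorem ae_pi_forall_mem [SigmaFinite ρ] {A : Set Λ} (hA : ∀ᵐ x ∂ρ, x ∈ A) (n : ℕ) :
    ∀ᵐ l ∂(Measure.pi fun _ : Fin n => ρ), ∀ p, l p ∈ A :=
  ae_all_iff.2 fun p => (Measure.tendsto_eval_ae_ae (μ := fun _ : Fin n => ρ) (i := p)).eventually hA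

theorem fredholmIntegrand_ae_congr [SigmaFinite ρ] {A : Set Λ} (hA : ∀ᵐ x ∂ρ, x ∈ A)
    (h : ∀ x ∈ A, ∀ y ∈ A, K x y = K' x y) (n : ℕ) :
    fredholmIntegrand K n =ᵐ[Measure.pi fun _ : Fin n => ρ] fredholmIntegrand K' n := by
  filter_upwards [ae_pi_forall_mem hA n] with l hl
  simp only [fredholmIntegrand]
  congr 1
  ext p q
  exact h _ (hl p) _ (hl q)

theorem fredholmTerm_congr [SigmaFinite ρ] {A : Set Λ} (hA : ∀ᵐ x ∂ρ, x ∈ A)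
    (h : ∀ x ∈ A, ∀ y ∈ A, K x y = K' x y) (n : ℕ) :
    fredholmTerm ρ K n = fredholmTerm ρ K' n := by
  simp only [fredholmTerm]
  rw [integral_congr_ae (fredholmIntegrand_ae_congr hA h n)]

theorem FredholmConverges.congr [SigmaFinite ρ] {A : Set Λ} (hA : ∀ᵐ x ∂ρ, x ∈ A)
    (h : ∀ x ∈ A, ∀ y ∈ A, K x y = K' x y) (hK : FredholmConverges ρ K) :
    FredholmConverges ρ K' where
  integrable n := (hK.integrable n).congr (fredholmIntegrand_ae_congr hA h n)
  summable := by simpa only [fredholmTerm_congr hA h] using hK.summable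

/-- `K` is measurable and dominated on `A` by the rank one kernel `f(x) g(y)`, where `f g` is
integrable and `A` has full measure. -/
structure Dominated (ρ : Measure Λ) (A : Set Λ) (f g : Λ → ℝ) (K : Λ → Λ → ℂ) : Prop where
  measurable : Measurable (Function.uncurry K)
  ae_mem : ∀ᵐ x ∂ρ, x ∈ A
  left_pos : ∀ x, 0 < f x
  right_pos : ∀ x, 0 < g x
  integrable : Integrable (fun x => f x * g x) ρ
  bound : ∀ x ∈ A, ∀ y ∈ A, ‖K x y‖ ≤ f x * g y

namespace Dominated

variable {A : Set Λ} {f g : Λ → ℝ}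

theorem norm_fredholmIntegrand_le (h : Dominated ρ A f g K) {n : ℕ} {l : Fin n → Λ}
    (hl : ∀ p, l p ∈ A) :
    ‖fredholmIntegrand K n l‖ ≤ √((n : ℝ) ^ n) * ∏ p, f (l p) * g (l p) :=
  norm_det_le_of_norm_entry_le _ (fun p => f (l p)) (fun p => g (l p)) (fun _ => h.left_pos _)
    (fun _ => h.right_pos _) fun p q => h.bound _ (hl p) _ (hl q)

theorem integrable_majorant [SigmaFinite ρ] (h : Dominated ρ A f g K) (n : ℕ) :
    Integrable (fun l : Fin n → Λ => √((n : ℝ) ^ n) * ∏ p, f (l p) * g (l p))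
      (Measure.pi fun _ : Fin n => ρ) :=
  (Integrable.fintype_prod (f := fun _ : Fin n => fun x => f x * g x)
    fun _ => h.integrable).const_mul _

theorem integrable_fredholmIntegrand [SigmaFinite ρ] (h : Dominated ρ A f g K) (n : ℕ) :
    Integrable (fredholmIntegrand K n) (Measure.pi fun _ : Fin n => ρ) := by
  refine (h.integrable_majorant n).mono'
    (measurable_fredholmIntegrand h.measurable n).aestronglyMeasurable ?_
  filter_upwards [ae_pi_forall_mem h.ae_mem n] with l hl
  exact h.norm_fredholmIntegrand_le hl

theorem norm_fredholmTerm_le [SigmaFinite ρ] (h : Dominated ρ A f g K) (n : ℕ) :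
    ‖fredholmTerm ρ K n‖ ≤ hadamardMajorant (∫ x, f x * g x ∂ρ) n := by
  rw [fredholmTerm, hadamardMajorant, norm_mul, norm_inv, Complex.norm_natCast]
  gcongr
  have h1 := norm_integral_le_of_norm_le (h.integrable_majorant n)
    (f := fredholmIntegrand K n) (by
      filter_upwards [ae_pi_forall_mem h.ae_mem n] with l hl
      exact h.norm_fredholmIntegrand_le hl)
  rw [integral_const_mul] at h1
  have h2 := integral_fintype_prod_eq_prod (μ := fun _ : Fin n => ρ)
    (fun _ : Fin n => fun x => f x * g x)
  rw [h2] at h1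
  simpa using h1

/-- The Leibniz expansion of the determinant, integrated term by term. -/
theorem integral_fredholmIntegrand [SigmaFinite ρ] (h : Dominated ρ A f g K) (n : ℕ) :
    ∫ l : Fin n → Λ, fredholmIntegrand K n l ∂(Measure.pi fun _ : Fin n => ρ) =
      ∑ σ : Equiv.Perm (Fin n), ((Equiv.Perm.sign σ : ℤ) : ℂ) *
        ∫ l : Fin n → Λ, ∏ i, K (l i) (l (σ i)) ∂(Measure.pi fun _ : Fin n => ρ) := by
  have h1 : ∀ l : Fin n → Λ, fredholmIntegrand K n l = ∑ σ : Equiv.Perm (Fin n),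
      ((Equiv.Perm.sign σ : ℤ) : ℂ) * ∏ i, K (l i) (l (σ i)) := by
    intro l
    rw [fredholmIntegrand, ← Matrix.det_transpose, Matrix.det_apply']
    rfl
  simp_rw [h1]
  rw [integral_finsetSum]
  · simp_rw [integral_const_mul]
  intro σ _
  refine Integrable.const_mul ?_ _
  refine (Integrable.fintype_prod (μ := fun _ : Fin n => ρ)
    (f := fun _ : Fin n => fun x => f x * g x) fun _ => h.integrable).mono'
    (Measurable.aestronglyMeasurable ?_) ?_
  · exact Finset.measurable_fun_prod _ fun i _ => measurable_comp₂ h.measurable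
      (measurable_pi_apply i) (measurable_pi_apply (σ i))
  · filter_upwards [ae_pi_forall_mem h.ae_mem n] with l hl
    rw [norm_prod]
    calc ∏ i, ‖K (l i) (l (σ i))‖ ≤ ∏ i, f (l i) * g (l (σ i)) :=
          Finset.prod_le_prod (fun _ _ => norm_nonneg _) fun i _ => h.bound _ (hl _) _ (hl _)
      _ = ∏ i, f (l i) * g (l i) := by
          simp only [Finset.prod_mul_distrib]
          rw [Equiv.prod_comp σ (fun i => g (l i))]

theorem integral_nonneg (h : Dominated ρ A f g K) : 0 ≤ ∫ x, f x * g x ∂ρ :=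
  MeasureTheory.integral_nonneg fun x => (mul_pos (h.left_pos x) (h.right_pos x)).le

theorem fredholmConverges [SigmaFinite ρ] (h : Dominated ρ A f g K) : FredholmConverges ρ K where
  integrable := h.integrable_fredholmIntegrand
  summable := Summable.of_nonneg_of_le (fun _ => norm_nonneg _) h.norm_fredholmTerm_le
    (summable_hadamardMajorant h.integral_nonneg)

end Dominated

end Fredholm

/-! ### Holomorphic dependence on a parameter -/

/-- An integral of functions holomorphic in a parameter, dominated uniformly in the parameter, is
holomorphic; Cauchy's estimate supplies the domination of the derivatives. -/
theorem differentiableOn_integral_of_dominated {α : Type*} [MeasurableSpace α] {μ : Measure α}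
    {U : Set ℂ} (hU : IsOpen U) {F : ℂ → α → ℂ} {B : α → ℝ}
    (hmeas : ∀ u ∈ U, AEStronglyMeasurable (F u) μ) (hB : Integrable B μ)
    (hbound : ∀ᵐ a ∂μ, ∀ u ∈ U, ‖F u a‖ ≤ B a)
    (hdiff : ∀ᵐ a ∂μ, DifferentiableOn ℂ (fun u => F u a) U) :
    DifferentiableOn ℂ (fun u => ∫ a, F u a ∂μ) U := by
  intro u₀ hu₀
  obtain ⟨ε, hε, hball⟩ := Metric.isOpen_iff.1 hU u₀ hu₀
  have hsub : ∀ u ∈ Metric.ball u₀ (ε / 2), Metric.closedBall u (ε / 4) ⊆ U := by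
    intro u hu z hz
    apply hball
    rw [Metric.mem_ball] at hu ⊢
    rw [Metric.mem_closedBall] at hz
    linarith [dist_triangle z u u₀]
  have hmemU : ∀ u ∈ Metric.ball u₀ (ε / 2), u ∈ U := fun u hu =>
    hsub u hu (Metric.mem_closedBall_self (by positivity))
  refine (hasDerivAt_integral_of_dominated_loc_of_deriv_le
    (F' := fun u a => deriv (fun w => F w a) u) (bound := fun a => B a / (ε / 4))
    (Metric.ball_mem_nhds u₀ (half_pos hε)) ?_ ?_ ?_ ?_ (hB.div_const _)
    ?_).2.differentiableAt.differentiableWithinAt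
  · filter_upwards [hU.mem_nhds hu₀] with u hu using hmeas u hu
  · exact hB.mono' (hmeas u₀ hu₀) (hbound.mono fun a ha => ha u₀ hu₀)
  · -- the derivative at `u₀` is a limit of difference quotients along a sequence
    have hseq : Filter.Tendsto (fun n : ℕ => ((1 / 2 : ℂ) ^ n * ((ε / 4 : ℝ) : ℂ)))
        Filter.atTop (nhds 0) := by
      simpa using (tendsto_pow_atTop_nhds_zero_of_norm_lt_one
        (x := (1 / 2 : ℂ)) (by norm_num)).mul_const ((ε / 4 : ℝ) : ℂ)
    set t : ℕ → ℂ := fun n => (1 / 2 : ℂ) ^ n * ((ε / 4 : ℝ) : ℂ) with ht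
    have ht0 : ∀ n, t n ≠ 0 := fun n =>
      mul_ne_zero (pow_ne_zero _ (by norm_num)) (by exact_mod_cast (by positivity : ε / 4 ≠ 0))
    have htU : ∀ n, u₀ + t n ∈ U := by
      intro n
      apply hball
      rw [Metric.mem_ball, dist_self_add_left, ht]
      simp only [norm_mul, norm_pow, Complex.norm_real, Real.norm_eq_abs]
      have : ‖(1 / 2 : ℂ)‖ ^ n ≤ 1 := pow_le_one₀ (norm_nonneg _) (by norm_num)
      rw [abs_of_pos (by positivity : 0 < ε / 4)]
      nlinarith
    refine aestronglyMeasurable_of_tendsto_ae Filter.atTop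
      (f := fun n a => (t n)⁻¹ • (F (u₀ + t n) a - F u₀ a)) (fun n => ?_) ?_
    · exact ((hmeas _ (htU n)).sub (hmeas _ hu₀)).const_smul ((t n)⁻¹)
    · filter_upwards [hdiff] with a ha
      have hd := ((ha u₀ hu₀).differentiableAt (hU.mem_nhds hu₀)).hasDerivAt
      have htw : Filter.Tendsto t Filter.atTop (nhdsWithin 0 {0}ᶜ) :=
        tendsto_nhdsWithin_iff.2 ⟨hseq, Filter.Eventually.of_forall ht0⟩
      exact (hasDerivAt_iff_tendsto_slope_zero.1 hd).comp htw
  · filter_upwards [hbound, hdiff] with a ha hda u hu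
    refine Complex.norm_deriv_le_of_forall_mem_sphere_norm_le (by positivity) ?_ fun z hz =>
      ha z (hsub u hu (Metric.sphere_subset_closedBall hz))
    refine DifferentiableOn.diffContOnCl ?_
    rw [closure_ball _ (by positivity)]
    exact hda.mono (hsub u hu)
  · filter_upwards [hdiff] with a hda u hu
    exact ((hda u (hmemU u hu)).differentiableAt (hU.mem_nhds (hmemU u hu))).hasDerivAt

theorem differentiableOn_fredholmDet {Λ : Type*} [MeasurableSpace Λ] {ρ : Measure Λ}
    [SigmaFinite ρ] {U : Set ℂ} (hU : IsOpen U) {K : ℂ → Λ → Λ → ℂ} {A : Set Λ} {f g : Λ → ℝ}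
    (hdom : ∀ u ∈ U, Dominated ρ A f g (K u))
    (hdiff : ∀ x ∈ A, ∀ y ∈ A, DifferentiableOn ℂ (fun u => K u x y) U) :
    DifferentiableOn ℂ (fun u => fredholmDet ρ (K u)) U := by
  rcases U.eq_empty_or_nonempty with rfl | ⟨u₁, hu₁⟩
  · exact differentiableOn_empty
  refine Complex.differentiableOn_tsum_of_summable_norm
    (summable_hadamardMajorant (hdom u₁ hu₁).integral_nonneg) (fun n => ?_) hU
    fun n u hu => (hdom u hu).norm_fredholmTerm_le n
  refine DifferentiableOn.const_mul ?_ _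
  refine differentiableOn_integral_of_dominated hU
    (fun u hu => (measurable_fredholmIntegrand (hdom u hu).measurable n).aestronglyMeasurable)
    ((hdom u₁ hu₁).integrable_majorant n) ?_ ?_
  · filter_upwards [ae_pi_forall_mem (hdom u₁ hu₁).ae_mem n] with l hl u hu
    exact (hdom u hu).norm_fredholmIntegrand_le hl
  · filter_upwards [ae_pi_forall_mem (hdom u₁ hu₁).ae_mem n] with l hl
    simp only [fredholmIntegrand, Matrix.det_apply', Matrix.of_apply]
    exact DifferentiableOn.fun_sum fun σ _ => DifferentiableOn.const_mul
      (DifferentiableOn.fun_finsetProd fun i _ => hdiff _ (hl _) _ (hl _)) _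

/-! ### Interchanging the factors of a kernel -/

section Swap

variable {X Y : Type*} [MeasurableSpace X] [MeasurableSpace Y]

/-- The kernel `∫ F(x, s) G(s, y) dν(s)` of the product of two integral operators. -/
noncomputable def kernelComp (ν : Measure Y) (F : X → Y → ℂ) (G : Y → X → ℂ) (x y : X) : ℂ :=
  ∫ s, F x s * G s y ∂ν

/-- `F : X → Y → ℂ` and `G : Y → X → ℂ` are measurable and dominated by rank one kernels
`f₁ ⊗ f₂` and `g₁ ⊗ g₂` with `f₁ g₂` and `f₂ g₁` integrable. -/
structure DominatedPair (μ : Measure X) (ν : Measure Y) (A : Set X) (B : Set Y)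
    (f₁ g₂ : X → ℝ) (f₂ g₁ : Y → ℝ) (F : X → Y → ℂ) (G : Y → X → ℂ) : Prop where
  measurable_left : Measurable (Function.uncurry F)
  measurable_right : Measurable (Function.uncurry G)
  ae_mem_X : ∀ᵐ x ∂μ, x ∈ A
  ae_mem_Y : ∀ᵐ y ∂ν, y ∈ B
  f₁_pos : ∀ x, 0 < f₁ x
  g₂_pos : ∀ x, 0 < g₂ x
  f₂_pos : ∀ y, 0 < f₂ y
  g₁_pos : ∀ y, 0 < g₁ y
  integrable_X : Integrable (fun x => f₁ x * g₂ x) μ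
  integrable_Y : Integrable (fun y => f₂ y * g₁ y) ν
  bound_left : ∀ x ∈ A, ∀ y ∈ B, ‖F x y‖ ≤ f₁ x * f₂ y
  bound_right : ∀ y ∈ B, ∀ x ∈ A, ‖G y x‖ ≤ g₁ y * g₂ x

namespace DominatedPair

variable {μ : Measure X} {ν : Measure Y} {A : Set X} {B : Set Y} {f₁ g₂ : X → ℝ} {f₂ g₁ : Y → ℝ}
  {F : X → Y → ℂ} {G : Y → X → ℂ}

theorem symm (h : DominatedPair μ ν A B f₁ g₂ f₂ g₁ F G) :
    DominatedPair ν μ B A g₁ f₂ g₂ f₁ G F where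
  measurable_left := h.measurable_right
  measurable_right := h.measurable_left
  ae_mem_X := h.ae_mem_Y
  ae_mem_Y := h.ae_mem_X
  f₁_pos := h.g₁_pos
  g₂_pos := h.f₂_pos
  f₂_pos := h.g₂_pos
  g₁_pos := h.f₁_pos
  integrable_X := by simpa only [mul_comm] using h.integrable_Y
  integrable_Y := by simpa only [mul_comm] using h.integrable_X
  bound_left := h.bound_right
  bound_right := h.bound_left

theorem integrable_mul (h : DominatedPair μ ν A B f₁ g₂ f₂ g₁ F G) {x y : X} (hx : x ∈ A)
    (hy : y ∈ A) : Integrable (fun s => F x s * G s y) ν := by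
  refine (h.integrable_Y.const_mul (f₁ x * g₂ y)).mono' (Measurable.aestronglyMeasurable ?_) ?_
  · exact (measurable_comp₂ h.measurable_left measurable_const measurable_id).mul
      (measurable_comp₂ h.measurable_right measurable_id measurable_const)
  filter_upwards [h.ae_mem_Y] with s hs
  rw [norm_mul]
  calc ‖F x s‖ * ‖G s y‖ ≤ (f₁ x * f₂ s) * (g₁ s * g₂ y) :=
        mul_le_mul (h.bound_left x hx s hs) (h.bound_right s hs y hy) (norm_nonneg _)
          (mul_pos (h.f₁_pos x) (h.f₂_pos s)).le
    _ = _ := by ring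

theorem dominated [SigmaFinite ν] [NeZero ν] (h : DominatedPair μ ν A B f₁ g₂ f₂ g₁ F G) :
    Dominated μ A (fun x => f₁ x * ∫ y, f₂ y * g₁ y ∂ν) g₂ (kernelComp ν F G) where
  measurable := by
    have : Measurable fun p : (X × X) × Y => F p.1.1 p.2 * G p.2 p.1.2 :=
      (h.measurable_left.comp (measurable_fst.fst.prodMk measurable_snd)).mul
        (h.measurable_right.comp (measurable_snd.prodMk measurable_fst.snd))
    exact (this.stronglyMeasurable.integral_prod_right (f := fun (p : X × X) y => F p.1 y * G y p.2)).measurable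
  ae_mem := h.ae_mem_X
  left_pos x := by
    refine mul_pos (h.f₁_pos x) ?_
    rw [integral_pos_iff_support_of_nonneg
      (fun y => (mul_pos (h.f₂_pos y) (h.g₁_pos y)).le) h.integrable_Y]
    have : Function.support (fun y => f₂ y * g₁ y) = Set.univ :=
      Function.support_eq_univ fun y => (mul_pos (h.f₂_pos y) (h.g₁_pos y)).ne'
    rw [this]
    exact (Measure.measure_univ_pos).2 (NeZero.ne ν)
  right_pos := h.g₂_pos
  integrable := by
    simpa only [mul_right_comm] using h.integrable_X.mul_const (∫ y, f₂ y * g₁ y ∂ν)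
  bound x hx y hy := by
    have h1 : ‖kernelComp ν F G x y‖ ≤ ∫ s, f₁ x * g₂ y * (f₂ s * g₁ s) ∂ν := by
      refine norm_integral_le_of_norm_le (h.integrable_Y.const_mul _) ?_
      filter_upwards [h.ae_mem_Y] with s hs
      rw [norm_mul]
      calc ‖F x s‖ * ‖G s y‖ ≤ (f₁ x * f₂ s) * (g₁ s * g₂ y) :=
            mul_le_mul (h.bound_left x hx s hs) (h.bound_right s hs y hy) (norm_nonneg _)
              (mul_pos (h.f₁_pos x) (h.f₂_pos s)).le
        _ = _ := by ring
    rw [integral_const_mul] at h1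
    linarith

/-- For a single permutation `σ`, both expansions integrate the same product of `2n` factors over
`Xⁿ × Yⁿ`, in the two possible orders. -/
theorem integral_prod_kernelComp_perm [SigmaFinite μ] [SigmaFinite ν]
    (h : DominatedPair μ ν A B f₁ g₂ f₂ g₁ F G) (n : ℕ) (σ : Equiv.Perm (Fin n)) :
    ∫ l : Fin n → X, ∏ p, kernelComp ν F G (l p) (l (σ p)) ∂(Measure.pi fun _ => μ) =
      ∫ s : Fin n → Y, ∏ p, kernelComp μ G F (s p) (s (σ p)) ∂(Measure.pi fun _ => ν) := by
  set Φ : (Fin n → X) → (Fin n → Y) → ℂ :=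
    fun l s => ∏ p, F (l p) (s p) * G (s p) (l (σ p)) with hΦ
  have hmeas : Measurable (Function.uncurry Φ) := by
    refine Finset.measurable_fun_prod _ fun p _ => ?_
    exact (measurable_comp₂ h.measurable_left ((measurable_pi_apply p).comp measurable_fst)
      ((measurable_pi_apply p).comp measurable_snd)).mul
      (measurable_comp₂ h.measurable_right ((measurable_pi_apply p).comp measurable_snd)
      ((measurable_pi_apply (σ p)).comp measurable_fst))
  have hint : Integrable (Function.uncurry Φ)
      ((Measure.pi fun _ : Fin n => μ).prod (Measure.pi fun _ : Fin n => ν)) := by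
    have hX := Integrable.fintype_prod (μ := fun _ : Fin n => μ)
      (f := fun _ : Fin n => fun x => f₁ x * g₂ x) fun _ => h.integrable_X
    have hY := Integrable.fintype_prod (μ := fun _ : Fin n => ν)
      (f := fun _ : Fin n => fun y => f₂ y * g₁ y) fun _ => h.integrable_Y
    refine (hX.mul_prod hY).mono' hmeas.aestronglyMeasurable ?_
    have e1 := (Measure.quasiMeasurePreserving_fst
      (μ := Measure.pi fun _ : Fin n => μ) (ν := Measure.pi fun _ : Fin n => ν)).ae
      (ae_pi_forall_mem h.ae_mem_X n)
    have e2 := (Measure.quasiMeasurePreserving_snd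
      (μ := Measure.pi fun _ : Fin n => μ) (ν := Measure.pi fun _ : Fin n => ν)).ae
      (ae_pi_forall_mem h.ae_mem_Y n)
    filter_upwards [e1, e2] with z hz1 hz2
    simp only [Function.uncurry, hΦ, norm_prod, norm_mul]
    calc ∏ p, ‖F (z.1 p) (z.2 p)‖ * ‖G (z.2 p) (z.1 (σ p))‖
        ≤ ∏ p, (f₁ (z.1 p) * f₂ (z.2 p)) * (g₁ (z.2 p) * g₂ (z.1 (σ p))) :=
          Finset.prod_le_prod (fun p _ => by positivity) fun p _ =>
            mul_le_mul (h.bound_left _ (hz1 _) _ (hz2 _)) (h.bound_right _ (hz2 _) _ (hz1 _))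
              (norm_nonneg _) (mul_pos (h.f₁_pos _) (h.f₂_pos _)).le
      _ = (∏ p, f₁ (z.1 p) * g₂ (z.1 p)) * ∏ p, f₂ (z.2 p) * g₁ (z.2 p) := by
          simp only [Finset.prod_mul_distrib]
          rw [Equiv.prod_comp σ (fun p => g₂ (z.1 p))]
          ring
  calc ∫ l : Fin n → X, ∏ p, kernelComp ν F G (l p) (l (σ p)) ∂(Measure.pi fun _ => μ)
      = ∫ l : Fin n → X, ∫ s : Fin n → Y, Φ l s ∂(Measure.pi fun _ => ν)
          ∂(Measure.pi fun _ => μ) := by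
        congr 1
        ext l
        simp only [kernelComp, hΦ]
        exact (integral_fintype_prod_eq_prod (μ := fun _ : Fin n => ν)
          (fun p s => F (l p) s * G s (l (σ p)))).symm
    _ = ∫ s : Fin n → Y, ∫ l : Fin n → X, Φ l s ∂(Measure.pi fun _ => μ)
          ∂(Measure.pi fun _ => ν) := integral_integral_swap hint
    _ = ∫ s : Fin n → Y, ∏ p, kernelComp μ G F (s p) (s (σ p)) ∂(Measure.pi fun _ => ν) := by
        congr 1
        ext s
        have h1 : ∀ l : Fin n → X, Φ l s =
            ∏ p, (fun (q : Fin n) (x : X) => G (s (σ.symm q)) x * F x (s q)) p (l p) := by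
          intro l
          simp only [hΦ, Finset.prod_mul_distrib]
          rw [← Equiv.prod_comp σ (fun p => G (s (σ.symm p)) (l p))]
          simp [mul_comm]
        rw [integral_congr_ae (Filter.Eventually.of_forall h1)]
        refine (integral_fintype_prod_eq_prod (μ := fun _ : Fin n => μ)
          (fun (q : Fin n) (x : X) => G (s (σ.symm q)) x * F x (s q))).trans ?_
        rw [← Equiv.prod_comp σ]
        simp [kernelComp]

/-- The Fredholm expansions of `FG` and `GF` agree term by term. -/
theorem fredholmTerm_comm [SigmaFinite μ] [SigmaFinite ν] [NeZero μ] [NeZero ν]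
    (h : DominatedPair μ ν A B f₁ g₂ f₂ g₁ F G) (n : ℕ) :
    fredholmTerm μ (kernelComp ν F G) n = fredholmTerm ν (kernelComp μ G F) n := by
  simp only [fredholmTerm]
  rw [h.dominated.integral_fredholmIntegrand, h.symm.dominated.integral_fredholmIntegrand]
  simp_rw [h.integral_prod_kernelComp_perm n]

end DominatedPair

end Swap

/-! ### Contour integral representation of the Airy function -/

section Airy

theorem integrable_exp_neg_mul_abs {ε : ℝ} (hε : 0 < ε) :
    Integrable fun x : ℝ => Real.exp (-ε * |x|) := by
  rw [← integrableOn_univ, ← Set.Iic_union_Ioi (a := (0 : ℝ))]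
  refine IntegrableOn.union ?_ ?_
  · refine (integrableOn_exp_mul_Iic hε 0).congr_fun (fun x hx => ?_) measurableSet_Iic
    simp [abs_of_nonpos (Set.mem_Iic.1 hx)]
  · refine (integrableOn_exp_mul_Ioi (neg_lt_zero.2 hε) 0).congr_fun (fun x hx => ?_)
      measurableSet_Ioi
    simp [abs_of_pos (Set.mem_Ioi.1 hx)]

/-- A function with exponential decay at both ends is integrable. -/
theorem integrable_of_norm_le_exp {E : Type*} [NormedAddCommGroup E] {f : ℝ → E}
    (hf : AEStronglyMeasurable f) {κ₁ κ₂ C₁ C₂ : ℝ} (h₁ : 0 < κ₁) (h₂ : 0 < κ₂)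
    (hf₁ : ∀ x, ‖f x‖ ≤ C₁ * Real.exp (κ₁ * x)) (hf₂ : ∀ x, ‖f x‖ ≤ C₂ * Real.exp (-κ₂ * x)) :
    Integrable f := by
  have hC₁ : 0 ≤ C₁ := by simpa using (norm_nonneg _).trans (hf₁ 0)
  have hC₂ : 0 ≤ C₂ := by simpa using (norm_nonneg _).trans (hf₂ 0)
  refine (((integrable_exp_neg_mul_abs h₁).const_mul C₁).add
    ((integrable_exp_neg_mul_abs h₂).const_mul C₂)).mono' hf (Filter.Eventually.of_forall fun x => ?_)
  simp only [Pi.add_apply]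
  rcases le_total x 0 with hx | hx
  · have := hf₁ x
    rw [abs_of_nonpos hx, neg_mul_neg]
    have : 0 ≤ C₂ * Real.exp (-κ₂ * -x) := by positivity
    linarith [hf₁ x]
  · have := hf₂ x
    rw [abs_of_nonneg hx]
    have : 0 ≤ C₁ * Real.exp (-κ₁ * x) := by positivity
    linarith [hf₂ x]

/-- Integrals of an entire function over two vertical lines agree if the function has Gaussian decay
in the strip between them. -/
theorem integral_vertical_line_eq {f : ℂ → ℂ} (hf : Differentiable ℂ f) {c₁ c₂ B κ : ℝ}
    (hκ : 0 < κ) (hc : c₁ ≤ c₂)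
    (hb : ∀ c ∈ Set.Icc c₁ c₂, ∀ t : ℝ, ‖f (c + t * Complex.I)‖ ≤ B * Real.exp (-κ * t ^ 2)) :
    ∫ t : ℝ, f (c₁ + t * Complex.I) = ∫ t : ℝ, f (c₂ + t * Complex.I) := by
  have hint : ∀ c ∈ Set.Icc c₁ c₂, Integrable fun t : ℝ => f (c + t * Complex.I) := by
    intro c hc
    have hcont : Continuous fun t : ℝ => f (c + t * Complex.I) :=
      hf.continuous.comp (by fun_prop)
    exact ((integrable_exp_neg_mul_sq hκ).const_mul B).mono' hcont.aestronglyMeasurable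
      (Filter.Eventually.of_forall fun t => hb c hc t)
  have hgauss : Filter.Tendsto (fun T : ℝ => B * Real.exp (-κ * T ^ 2) * |c₂ - c₁|)
      Filter.atTop (nhds 0) := by
    have h1 : Filter.Tendsto (fun T : ℝ => -κ * T ^ 2) Filter.atTop Filter.atBot :=
      (Filter.tendsto_pow_atTop two_ne_zero).const_mul_atTop_of_neg (neg_lt_zero.2 hκ)
    simpa using ((Real.tendsto_exp_atBot.comp h1).const_mul B).mul_const |c₂ - c₁|
  have hhor : ∀ s : ℝ, s = 1 ∨ s = -1 → Filter.Tendsto (fun T : ℝ =>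
      ∫ x : ℝ in c₁..c₂, f (x + ((s * T : ℝ) : ℂ) * Complex.I)) Filter.atTop (nhds 0) := by
    intro s hs
    refine squeeze_zero_norm (fun T => ?_) hgauss
    refine intervalIntegral.norm_integral_le_of_norm_le_const fun x hx => ?_
    have hx' : x ∈ Set.Icc c₁ c₂ := by
      rw [Set.uIoc_of_le hc] at hx
      exact ⟨hx.1.le, hx.2⟩
    refine (hb x hx' (s * T)).trans (le_of_eq ?_)
    rcases hs with rfl | rfl <;> simp
  have hver : ∀ c ∈ Set.Icc c₁ c₂, Filter.Tendsto (fun T : ℝ =>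
      ∫ t : ℝ in (-T)..T, f (c + t * Complex.I)) Filter.atTop
      (nhds (∫ t : ℝ, f (c + t * Complex.I))) := fun c hc =>
    intervalIntegral_tendsto_integral (hint c hc) Filter.tendsto_neg_atTop_atBot Filter.tendsto_id
  have h1 := (((hhor (-1) (Or.inr rfl)).sub (hhor 1 (Or.inl rfl))).add
    ((hver c₂ ⟨hc, le_rfl⟩).const_mul Complex.I)).sub
    ((hver c₁ ⟨le_rfl, hc⟩).const_mul Complex.I)
  have h2 : ∀ T : ℝ, (∫ x : ℝ in c₁..c₂, f (x + ((-1 * T : ℝ) : ℂ) * Complex.I)) -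
      (∫ x : ℝ in c₁..c₂, f (x + ((1 * T : ℝ) : ℂ) * Complex.I)) +
      Complex.I * (∫ t : ℝ in (-T)..T, f (c₂ + t * Complex.I)) -
      Complex.I * (∫ t : ℝ in (-T)..T, f (c₁ + t * Complex.I)) = 0 := by
    intro T
    have := Complex.integral_boundary_rect_eq_zero_of_differentiableOn f
      (⟨c₁, -T⟩ : ℂ) (⟨c₂, T⟩ : ℂ) hf.differentiableOn
    simpa using this
  simp_rw [h2] at h1
  have h3 := tendsto_nhds_unique h1 tendsto_const_nhds
  have h4 : Complex.I * (∫ t : ℝ, f (c₂ + t * Complex.I)) =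
      Complex.I * ∫ t : ℝ, f (c₁ + t * Complex.I) := by
    simpa [sub_eq_zero] using h3
  exact (mul_left_cancel₀ Complex.I_ne_zero h4).symm

/-- The exponential `exp(z³/3 + η z² - r z)`, whose integral over a vertical line is, up to the
factor `2πi`, a shifted Airy function. -/
noncomputable def cubicExp (η r : ℝ) (z : ℂ) : ℂ := Complex.exp (z ^ 3 / 3 + η * z ^ 2 - r * z)

theorem continuous_cubicExp (η r : ℝ) : Continuous (cubicExp η r) := by
  unfold cubicExp; fun_prop

theorem norm_cubicExp (η r c t : ℝ) : ‖cubicExp η r (c + t * Complex.I)‖ =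
    Real.exp (c ^ 3 / 3 + η * c ^ 2 - r * c) * Real.exp (-(c + η) * t ^ 2) := by
  rw [cubicExp, Complex.norm_exp, ← Real.exp_add]
  congr 1
  have : ((c + t * Complex.I) ^ 3 / 3 + η * (c + t * Complex.I) ^ 2 - r * (c + t * Complex.I) : ℂ) =
      ((c ^ 3 / 3 + η * c ^ 2 - r * c + -(c + η) * t ^ 2 : ℝ) : ℂ) +
      ((c ^ 2 * t - t ^ 3 / 3 + 2 * η * c * t - r * t : ℝ) : ℂ) * Complex.I := by
    have hI : Complex.I ^ 2 = -1 := Complex.I_sq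
    have hI3 : Complex.I ^ 3 = -Complex.I := by rw [pow_succ, hI]; ring
    push_cast
    ring_nf
    rw [hI, hI3]
    ring
  rw [this]
  simp only [Complex.add_re, Complex.ofReal_re, Complex.re_ofReal_mul, Complex.I_re, mul_zero,
    add_zero]

theorem integrable_cubicExp {η c : ℝ} (hc : -η < c) (r : ℝ) :
    Integrable fun t : ℝ => cubicExp η r (c + t * Complex.I) := by
  have hcont : Continuous fun t : ℝ => cubicExp η r (c + t * Complex.I) :=
    (continuous_cubicExp η r).comp (by fun_prop)
  refine ((integrable_exp_neg_mul_sq (b := c + η) (by linarith)).const_mul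
    (Real.exp (c ^ 3 / 3 + η * c ^ 2 - r * c))).mono' hcont.aestronglyMeasurable
    (Filter.Eventually.of_forall fun t => (norm_cubicExp η r c t).le)

theorem integral_cubicExp_zero_eq {c₁ c₂ : ℝ} (h₁ : 0 < c₁) (h₂ : 0 < c₂) (r : ℝ) :
    ∫ t : ℝ, cubicExp 0 r (c₁ + t * Complex.I) = ∫ t : ℝ, cubicExp 0 r (c₂ + t * Complex.I) := by
  wlog h : c₁ ≤ c₂ generalizing c₁ c₂
  · exact (this h₂ h₁ (le_of_not_ge h)).symm
  refine integral_vertical_line_eq (B := Real.exp (c₂ ^ 3 / 3 + |r| * c₂)) (κ := c₁)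
    (by unfold cubicExp; fun_prop) h₁ h fun c hc t => ?_
  rw [norm_cubicExp]
  have hc0 : 0 < c := h₁.trans_le hc.1
  have h3 : -r * c ≤ |r| * c₂ :=
    (mul_le_mul_of_nonneg_right (neg_le_abs r) hc0.le).trans
      (mul_le_mul_of_nonneg_left hc.2 (abs_nonneg r))
  have h4 : c ^ 3 ≤ c₂ ^ 3 := pow_le_pow_left₀ hc0.le hc.2 3
  gcongr
  · linarith
  · linarith [hc.1]

theorem airy_eq_integral {c : ℝ} (hc : 0 < c) (x : ℝ) :
    (airy x : ℂ) = (2 * Real.pi : ℂ)⁻¹ * ∫ t : ℝ, cubicExp 0 x (c + t * Complex.I) := by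
  rw [← integral_cubicExp_zero_eq one_pos hc]
  set J : ℂ := (2 * Real.pi : ℂ)⁻¹ * ∫ t : ℝ, cubicExp 0 x ((1 : ℝ) + t * Complex.I) with hJ
  have h1 : airy x = J.re := by
    simp [airy, hJ, cubicExp]
  have h2 : (starRingEnd ℂ) J = J := by
    rw [hJ, map_mul, ← integral_conj]
    have h3 : (starRingEnd ℂ) 3 = 3 := Complex.conj_ofNat 3
    congr 1
    · simp [Complex.conj_ofNat]
    · rw [← integral_neg_eq_self]
      congr 1
      ext t
      rw [cubicExp, cubicExp, ← Complex.exp_conj]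
      simp [h3]
  rw [h1]
  exact Complex.conj_eq_iff_re.1 h2

/-- `Φ_η(r) = Ai(η² + r) exp(r η + 2 η³ / 3)`, so that `Ai_{ξ,η}(x, y) = Φ_η(ξ + x + y)`. -/
noncomputable def airyPhi (η r : ℝ) : ℝ := airy (η ^ 2 + r) * Real.exp (r * η + 2 / 3 * η ^ 3)

theorem shiftedAiry_eq_airyPhi (ξ η x y : ℝ) : shiftedAiry ξ η x y = airyPhi η (ξ + x + y) := by
  rw [shiftedAiry, airyPhi]
  congr 2
  ring

theorem airyPhi_eq_integral {η c : ℝ} (hc : -η < c) (r : ℝ) :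
    (airyPhi η r : ℂ) = (2 * Real.pi : ℂ)⁻¹ * ∫ t : ℝ, cubicExp η r (c + t * Complex.I) := by
  rw [airyPhi, Complex.ofReal_mul, airy_eq_integral (c := c + η) (by linarith), mul_assoc,
    ← integral_mul_const]
  congr 2
  ext t
  rw [cubicExp, cubicExp, Complex.ofReal_exp, ← Complex.exp_add]
  congr 1
  push_cast
  ring

/-- The bound `|Φ_η(r)| ≤ C exp(-c r)`, valid on the whole real line for each `c > -η`. -/
theorem exists_airyPhi_le {η c : ℝ} (hc : -η < c) :
    ∃ C, 0 < C ∧ ∀ r, |airyPhi η r| ≤ C * Real.exp (-c * r) := by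
  have hI : Integrable fun t : ℝ => Real.exp (-(c + η) * t ^ 2) :=
    integrable_exp_neg_mul_sq (by linarith)
  set A := Real.exp (c ^ 3 / 3 + η * c ^ 2) * ∫ t : ℝ, Real.exp (-(c + η) * t ^ 2) with hA
  have hA0 : 0 ≤ A := mul_nonneg (Real.exp_pos _).le (integral_nonneg fun t => (Real.exp_pos _).le)
  refine ⟨(2 * Real.pi)⁻¹ * A + 1, by positivity, fun r => ?_⟩
  have h1 : |airyPhi η r| = ‖(airyPhi η r : ℂ)‖ := by simp
  have h2 : ‖∫ t : ℝ, cubicExp η r (c + t * Complex.I)‖ ≤ A * Real.exp (-c * r) := by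
    have h3 : ∫ t : ℝ, Real.exp (c ^ 3 / 3 + η * c ^ 2 - r * c) * Real.exp (-(c + η) * t ^ 2) =
        A * Real.exp (-c * r) := by
      rw [integral_const_mul, hA, mul_right_comm, ← Real.exp_add]
      congr 2
      ring
    rw [← h3]
    exact norm_integral_le_of_norm_le (hI.const_mul _)
      (Filter.Eventually.of_forall fun t => (norm_cubicExp η r c t).le)
  rw [h1, airyPhi_eq_integral hc, norm_mul, norm_inv]
  have h4 : ‖(2 * Real.pi : ℂ)‖ = 2 * Real.pi := by
    simp [abs_of_pos Real.pi_pos]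
  rw [h4]
  calc (2 * Real.pi)⁻¹ * ‖∫ t : ℝ, cubicExp η r (c + t * Complex.I)‖
      ≤ (2 * Real.pi)⁻¹ * (A * Real.exp (-c * r)) := by gcongr
    _ ≤ ((2 * Real.pi)⁻¹ * A + 1) * Real.exp (-c * r) := by
        have := Real.exp_pos (-c * r)
        nlinarith

theorem continuous_airy : Continuous airy := by
  have h1 : airy = fun x => Real.exp (-x) *
      ((2 * Real.pi : ℂ)⁻¹ * ∫ t : ℝ, cubicExp 0 0 ((1 : ℝ) + t * Complex.I) *
        Complex.exp (-(x * t * Complex.I))).re := by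
    ext x
    rw [airy, ← Complex.re_ofReal_mul]
    congr 1
    rw [mul_left_comm]
    congr 1
    rw [← integral_const_mul]
    congr 1
    ext t
    rw [cubicExp, Complex.ofReal_exp, ← Complex.exp_add, ← Complex.exp_add]
    congr 1
    push_cast
    ring
  rw [h1]
  refine (Real.continuous_exp.comp continuous_neg).mul (Complex.continuous_re.comp
    (continuous_const.mul ?_))
  refine continuous_of_dominated (bound := fun t => ‖cubicExp 0 0 ((1 : ℝ) + t * Complex.I)‖)
    (fun x => ?_) (fun x => Filter.Eventually.of_forall fun t => ?_)
    (integrable_cubicExp (by norm_num) 0).norm (Filter.Eventually.of_forall fun t => by fun_prop)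
  · have := continuous_cubicExp 0 0
    exact Continuous.aestronglyMeasurable (by fun_prop)
  · rw [norm_mul]
    have : -(x * t * Complex.I) = ((-(x * t) : ℝ) : ℂ) * Complex.I := by push_cast; ring
    rw [this, Complex.norm_exp_ofReal_mul_I, mul_one]

theorem continuous_airyPhi (η : ℝ) : Continuous (airyPhi η) := by
  have := continuous_airy
  unfold airyPhi
  fun_prop

/-! ### The Laplace transform and the convolution formula -/

theorem integrable_exp_mul_airyPhi {η c : ℝ} (hc : -η < c) :
    Integrable fun r : ℝ => Real.exp (c * r) * airyPhi η r := by
  obtain ⟨C₁, -, h₁⟩ := exists_airyPhi_le (η := η) (c := (c - η) / 2) (by linarith)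
  obtain ⟨C₂, -, h₂⟩ := exists_airyPhi_le (η := η) (c := c + 1) (by linarith)
  have hcont := continuous_airyPhi η
  refine integrable_of_norm_le_exp (κ₁ := (c + η) / 2) (κ₂ := 1) (C₁ := C₁) (C₂ := C₂)
    (Continuous.aestronglyMeasurable (by fun_prop)) (by linarith) one_pos (fun r => ?_) fun r => ?_
  · rw [norm_mul, Real.norm_eq_abs, Real.norm_eq_abs, Real.abs_exp]
    calc Real.exp (c * r) * |airyPhi η r|
        ≤ Real.exp (c * r) * (C₁ * Real.exp (-((c - η) / 2) * r)) := by gcongr; exact h₁ r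
      _ = C₁ * Real.exp ((c + η) / 2 * r) := by
          rw [mul_left_comm, ← Real.exp_add]; congr 2; ring
  · rw [norm_mul, Real.norm_eq_abs, Real.norm_eq_abs, Real.abs_exp]
    calc Real.exp (c * r) * |airyPhi η r|
        ≤ Real.exp (c * r) * (C₂ * Real.exp (-(c + 1) * r)) := by gcongr; exact h₂ r
      _ = C₂ * Real.exp (-1 * r) := by
          rw [mul_left_comm, ← Real.exp_add]; congr 2; ring

/-- The bilateral Laplace transform of `Φ_η`, by Fourier inversion of its contour integral
representation. -/
theorem integral_cexp_mul_airyPhi {η c : ℝ} (hc : -η < c) (t : ℝ) :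
    ∫ r : ℝ, Complex.exp ((c + t * Complex.I) * r) * airyPhi η r =
      cubicExp η 0 (c + t * Complex.I) := by
  set f : ℝ → ℂ := fun t => cubicExp η 0 (c + t * Complex.I) with hf
  have hfc : Continuous f := (continuous_cubicExp η 0).comp (by fun_prop)
  have hfi : Integrable f := integrable_cubicExp hc 0
  have hpi : (2 * Real.pi : ℂ) ≠ 0 := by
    simp [Real.pi_ne_zero]
  have hF : ∀ w : ℝ, FourierTransform.fourier f w =
      (2 * Real.pi : ℂ) * ((Real.exp (c * (2 * Real.pi * w)) * airyPhi η (2 * Real.pi * w) : ℝ) : ℂ) := by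
    intro w
    rw [Real.fourier_real_eq_integral_exp_smul, Complex.ofReal_mul,
      airyPhi_eq_integral hc, mul_left_comm, mul_inv_cancel_left₀ hpi, ← integral_const_mul]
    congr 1
    ext s
    simp only [hf]
    rw [smul_eq_mul, cubicExp, cubicExp, Complex.ofReal_exp, ← Complex.exp_add,
      ← Complex.exp_add]
    congr 1
    push_cast
    ring
  have hFi : Integrable (FourierTransform.fourier f) := by
    have h1 := (integrable_exp_mul_airyPhi hc).comp_mul_left' (R := 2 * Real.pi)
      (mul_ne_zero two_ne_zero Real.pi_ne_zero)
    refine (h1.ofReal.const_mul (2 * Real.pi : ℂ)).congr (Filter.Eventually.of_forall fun w => ?_)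
    exact (hF w).symm
  have hinv := congrFun (hfc.fourierInv_fourier_eq hfi hFi) t
  rw [Real.fourierInv_eq'] at hinv
  change _ = f t
  rw [← hinv]
  have h2 := Measure.integral_comp_mul_left
    (fun r : ℝ => Complex.exp ((c + t * Complex.I) * r) * airyPhi η r) (2 * Real.pi)
  rw [abs_of_pos (by positivity)] at h2
  have h3 : ∀ w : ℝ, Complex.exp (((2 * Real.pi * inner ℝ w t : ℝ) : ℂ) * Complex.I) •
      FourierTransform.fourier f w = (2 * Real.pi : ℂ) *
        (Complex.exp ((c + t * Complex.I) * ((2 * Real.pi * w : ℝ) : ℂ)) *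
          airyPhi η (2 * Real.pi * w)) := by
    intro w
    rw [hF, smul_eq_mul, mul_left_comm]
    congr 1
    rw [Complex.ofReal_mul (Real.exp _), ← mul_assoc, Complex.ofReal_exp, ← Complex.exp_add]
    congr 2
    simp only [RCLike.inner_apply, conj_trivial]
    push_cast
    ring
  simp_rw [h3]
  rw [integral_const_mul, h2, Complex.real_smul]
  push_cast
  rw [← mul_assoc, mul_inv_cancel₀ hpi, one_mul]

theorem integral_cexp_mul_airyPhi_affine {η c α q : ℝ} (hα : 0 < α) (hc : -η < c / α) (t : ℝ) :
    ∫ x : ℝ, Complex.exp ((c + t * Complex.I) * x) * airyPhi η (α * x + q) =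
      (α : ℂ)⁻¹ * (Complex.exp (-((c + t * Complex.I) * q / α)) *
        cubicExp η 0 ((c / α : ℝ) + (t / α : ℝ) * Complex.I)) := by
  have hα' : (α : ℂ) ≠ 0 := by exact_mod_cast hα.ne'
  rw [← integral_cexp_mul_airyPhi hc, ← integral_const_mul]
  have h1 := Measure.integral_comp_mul_left (fun y : ℝ =>
    Complex.exp (-((c + t * Complex.I) * q / α)) *
    (Complex.exp (((c / α : ℝ) + (t / α : ℝ) * Complex.I) * ((y + q : ℝ) : ℂ)) *
      airyPhi η (y + q))) α
  have h2 := integral_add_right_eq_self (μ := volume) (fun y : ℝ =>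
    Complex.exp (-((c + t * Complex.I) * q / α)) *
    (Complex.exp (((c / α : ℝ) + (t / α : ℝ) * Complex.I) * (y : ℂ)) *
      airyPhi η y)) q
  rw [h2, abs_of_pos (inv_pos.2 hα), Complex.real_smul, Complex.ofReal_inv] at h1
  rw [← h1]
  congr 1
  ext x
  rw [← mul_assoc, ← Complex.exp_add]
  congr 2
  push_cast
  field_simp
  ring

/-- The convolution of two functions `Φ` is again of this form: on the Laplace side, cubic
exponents add up. -/
theorem integral_airyPhi_mul_airyPhi {η θ η' α α' : ℝ} (hα : 0 < α) (hα' : 0 < α')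
    (hcube : α' ^ 3 = 1 + α ^ 3) (hη' : η' * α' ^ 2 = θ + η * α ^ 2) (p q : ℝ) :
    ∫ x : ℝ, airyPhi η (p - x) * airyPhi θ (α * x + q) =
      1 / α' * airyPhi η' ((α * p + q) / α') := by
  -- a line to the right of all singular abscissae
  set c : ℝ := |η| + |θ| * α + |η'| * (α / α') + 1 with hcdef
  have e1 := abs_nonneg η
  have e2 : 0 ≤ |θ| * α := by positivity
  have e3 : 0 ≤ |η'| * (α / α') := by positivity
  have hc1 : -η < c := by have := neg_abs_le η; have := neg_le_abs η; linarith
  have hc2 : -θ < c / α := by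
    rw [lt_div_iff₀ hα]
    have := mul_le_mul_of_nonneg_right (neg_le_abs θ) hα.le
    linarith
  have hc3 : -η' < α' / α * c := by
    have h1 : -η' * (α / α') < c := by
      have := mul_le_mul_of_nonneg_right (neg_le_abs η') (by positivity : 0 ≤ α / α')
      linarith
    have h2 : -η' = α' / α * (-η' * (α / α')) := by field_simp
    rw [h2]
    exact mul_lt_mul_of_pos_left h1 (by positivity)
  have hα0 : (α : ℂ) ≠ 0 := by exact_mod_cast hα.ne'
  have hα'0 : (α' : ℂ) ≠ 0 := by exact_mod_cast hα'.ne'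
  have hcubeC : (α' : ℂ) ^ 3 = 1 + (α : ℂ) ^ 3 := by exact_mod_cast hcube
  have hηC : (η' : ℂ) * (α' : ℂ) ^ 2 = θ + η * (α : ℂ) ^ 2 := by exact_mod_cast hη'
  have hcontθ := continuous_airyPhi θ
  set f : ℝ → ℝ → ℂ := fun x t =>
    cubicExp η (p - x) (c + t * Complex.I) * airyPhi θ (α * x + q) with hf
  have hfint : Integrable (Function.uncurry f) (volume.prod volume) := by
    have hA : Integrable fun x : ℝ => Real.exp (c * x) * airyPhi θ (α * x + q) := by
      have h1 := ((integrable_exp_mul_airyPhi hc2).comp_add_right q).comp_mul_left' hα.ne'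
      refine (h1.const_mul (Real.exp (-(c / α * q)))).congr (Filter.Eventually.of_forall fun x => ?_)
      simp only
      rw [← mul_assoc, ← Real.exp_add]
      congr 2
      field_simp
      ring
    have hB := (integrable_cubicExp hc1 p).norm
    refine (hA.norm.mul_prod hB).mono' (Continuous.aestronglyMeasurable ?_)
      (Filter.Eventually.of_forall fun z => ?_)
    · simp only [Function.uncurry_def, hf, cubicExp]
      fun_prop
    · simp only [Function.uncurry, hf, norm_mul, norm_cubicExp, Complex.norm_real]
      rw [Real.norm_of_nonneg (Real.exp_pos _).le]
      have : Real.exp (c ^ 3 / 3 + η * c ^ 2 - (p - z.1) * c) =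
          Real.exp (c * z.1) * Real.exp (c ^ 3 / 3 + η * c ^ 2 - p * c) := by
        rw [← Real.exp_add]; congr 1; ring
      rw [this]
      exact le_of_eq (by ring)
  have hmain : ((∫ x : ℝ, airyPhi η (p - x) * airyPhi θ (α * x + q) : ℝ) : ℂ) =
      ((1 / α' * airyPhi η' ((α * p + q) / α') : ℝ) : ℂ) := by
    calc ((∫ x : ℝ, airyPhi η (p - x) * airyPhi θ (α * x + q) : ℝ) : ℂ)
        = ∫ x : ℝ, (2 * Real.pi : ℂ)⁻¹ * ∫ t : ℝ, f x t := by
          rw [← integral_complex_ofReal]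
          congr 1
          ext x
          rw [Complex.ofReal_mul, airyPhi_eq_integral hc1, mul_assoc, hf, ← integral_mul_const]
      _ = (2 * Real.pi : ℂ)⁻¹ * ∫ t : ℝ, ∫ x : ℝ, f x t := by
          rw [integral_const_mul, integral_integral_swap hfint]
      _ = (2 * Real.pi : ℂ)⁻¹ * ∫ t : ℝ, (α : ℂ)⁻¹ *
            cubicExp η' ((α * p + q) / α') ((α' / α * c : ℝ) + (α' / α * t : ℝ) * Complex.I) := by
          congr 2
          ext t
          have h1 : ∀ x : ℝ, f x t = cubicExp η p (c + t * Complex.I) *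
              (Complex.exp ((c + t * Complex.I) * x) * airyPhi θ (α * x + q)) := by
            intro x
            simp only [hf, cubicExp]
            rw [← mul_assoc, ← Complex.exp_add]
            congr 2
            push_cast
            ring
          simp_rw [h1]
          rw [integral_const_mul, integral_cexp_mul_airyPhi_affine hα hc2, mul_left_comm]
          congr 1
          simp only [cubicExp]
          rw [← Complex.exp_add, ← Complex.exp_add]
          congr 1
          push_cast
          generalize ht : (t : ℂ) * Complex.I = w
          have hz1 : (c : ℂ) / α + t / α * Complex.I = (c + w) / α := by rw [← ht]; ring
          have hz2 : (α' : ℂ) / α * c + α' / α * t * Complex.I = α' * ((c + w) / α) := by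
            rw [← ht]; ring
          rw [hz1, hz2]
          set z : ℂ := (c + w) with hz
          have h3 : (α' * (z / α)) ^ 3 / 3 = z ^ 3 / 3 + (z / α) ^ 3 / 3 := by
            rw [mul_pow, hcubeC]
            field_simp
            ring
          have h4 : (η' : ℂ) * (α' * (z / α)) ^ 2 = η * z ^ 2 + θ * (z / α) ^ 2 := by
            rw [mul_pow, ← mul_assoc, hηC]
            field_simp
            ring
          rw [h3, h4]
          field_simp
          ring
      _ = ((1 / α' * airyPhi η' ((α * p + q) / α') : ℝ) : ℂ) := by
          rw [integral_const_mul, Measure.integral_comp_mul_left (fun s : ℝ =>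
            cubicExp η' ((α * p + q) / α') ((α' / α * c : ℝ) + (s : ℝ) * Complex.I)) (α' / α),
            Complex.ofReal_mul (1 / α'), airyPhi_eq_integral hc3,
            abs_of_pos (by positivity), Complex.real_smul]
          push_cast
          field_simp
          congr 1
          ext y
          congr 1
          ring
  exact_mod_cast hmain

end Airy

/-! ### Exponential bounds for the factor kernels -/

section Kernels

variable (P : Params) (δ : ℝ)

/-- The factor `a(x, s)` in `S₃(x, y) = ∫₀^∞ a(x, s) b(s, y) ds`. -/
noncomputable def kA (x s : ℝ) : ℝ := Real.exp (-δ * (x + s)) * shiftedAiry P.ξ₁ (-P.η₁) (-x) s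

/-- The factor `b(s, y)` in `S₃(x, y) = ∫₀^∞ a(x, s) b(s, y) ds`. -/
noncomputable def kB (s y : ℝ) : ℝ := Real.exp (δ * (s + y)) * shiftedAiry P.ξ₁ P.η₁ s (-y)

/-- The factor `c(x, v)` in `S₂(x, y) = ∫₀^∞ c(x, v) d(v, y) dv`. -/
noncomputable def kC (x v : ℝ) : ℝ := Real.exp (-δ * x) * shiftedAiry P.Δξ P.Δη (P.α * x) v

/-- The factor `d(v, y)` in `S₂(x, y) = ∫₀^∞ c(x, v) d(v, y) dv`. -/
noncomputable def kD (v y : ℝ) : ℝ :=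
  P.α * Real.exp (δ * y) * shiftedAiry P.Δξ (-P.Δη) v (P.α * y)

/-- The kernel `∫ b(v, x) c(x, w) dμ(x)`; it is used with `μ` Lebesgue measure on the whole line
and on the negative half-line. -/
noncomputable def kBC (μ : Measure ℝ) (v w : ℝ) : ℝ := ∫ x, kB P δ v x * kC P δ x w ∂μ

/-- The kernel of the composition of `a`, `b`, `c`, where the variable between `b` and `c` is
integrated against `μ`. -/
noncomputable def kABC (μ : Measure ℝ) (x w : ℝ) : ℝ :=
  ∫ v in Set.Ioi (0 : ℝ), kA P δ x v * kBC P δ μ v w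

variable {P δ}

theorem continuous_kA : Continuous (Function.uncurry (kA P δ)) := by
  have := continuous_airyPhi (-P.η₁)
  simp only [Function.uncurry_def, kA, shiftedAiry_eq_airyPhi]
  fun_prop

theorem continuous_kB : Continuous (Function.uncurry (kB P δ)) := by
  have := continuous_airyPhi P.η₁
  simp only [Function.uncurry_def, kB, shiftedAiry_eq_airyPhi]
  fun_prop

theorem continuous_kC : Continuous (Function.uncurry (kC P δ)) := by
  have := continuous_airyPhi P.Δη
  simp only [Function.uncurry_def, kC, shiftedAiry_eq_airyPhi]
  fun_prop

theorem continuous_kD : Continuous (Function.uncurry (kD P δ)) := by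
  have := continuous_airyPhi (-P.Δη)
  simp only [Function.uncurry_def, kD, shiftedAiry_eq_airyPhi]
  fun_prop

theorem measurable_kBC (μ : Measure ℝ) [SFinite μ] :
    Measurable (Function.uncurry (kBC P δ μ)) := by
  have h : Measurable fun p : (ℝ × ℝ) × ℝ => kB P δ p.1.1 p.2 * kC P δ p.2 p.1.2 :=
    (measurable_comp₂ continuous_kB.measurable measurable_fst.fst measurable_snd).mul
      (measurable_comp₂ continuous_kC.measurable measurable_snd measurable_fst.snd)
  exact (h.stronglyMeasurable.integral_prod_right
    (f := fun (p : ℝ × ℝ) x => kB P δ p.1 x * kC P δ x p.2)).measurable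

theorem measurable_kABC (μ : Measure ℝ) [SFinite μ] :
    Measurable (Function.uncurry (kABC P δ μ)) := by
  have h : Measurable fun p : (ℝ × ℝ) × ℝ => kA P δ p.1.1 p.2 * kBC P δ μ p.2 p.1.2 :=
    (measurable_comp₂ continuous_kA.measurable measurable_fst.fst measurable_snd).mul
      (measurable_comp₂ (measurable_kBC μ) measurable_snd measurable_fst.snd)
  exact (h.stronglyMeasurable.integral_prod_right
    (f := fun (p : ℝ × ℝ) v => kA P δ p.1 v * kBC P δ μ v p.2)).measurable

theorem exists_shiftedAiry_le (ξ : ℝ) {η c : ℝ} (hc : -η < c) :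
    ∃ C, 0 < C ∧ ∀ x y, |shiftedAiry ξ η x y| ≤ C * Real.exp (-c * (x + y)) := by
  obtain ⟨C, hC, h⟩ := exists_airyPhi_le hc
  refine ⟨C * Real.exp (-c * ξ), by positivity, fun x y => ?_⟩
  rw [shiftedAiry_eq_airyPhi, mul_assoc, ← Real.exp_add]
  refine (h _).trans (le_of_eq ?_)
  congr 2
  ring

theorem exists_kA_le {c : ℝ} (hc : P.η₁ < c) :
    ∃ C, 0 < C ∧ ∀ x s, |kA P δ x s| ≤ C * Real.exp ((c - δ) * x - (δ + c) * s) := by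
  obtain ⟨C, hC, h⟩ := exists_shiftedAiry_le P.ξ₁ (η := -P.η₁) (c := c) (by simpa using hc)
  refine ⟨C, hC, fun x s => ?_⟩
  rw [kA, abs_mul, Real.abs_exp]
  calc Real.exp (-δ * (x + s)) * |shiftedAiry P.ξ₁ (-P.η₁) (-x) s|
      ≤ Real.exp (-δ * (x + s)) * (C * Real.exp (-c * (-x + s))) := by gcongr; exact h _ _
    _ = _ := by rw [mul_left_comm, ← Real.exp_add]; congr 2; ring

theorem exists_kB_le {c : ℝ} (hc : -P.η₁ < c) :
    ∃ C, 0 < C ∧ ∀ s y, |kB P δ s y| ≤ C * Real.exp ((δ + c) * y + (δ - c) * s) := by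
  obtain ⟨C, hC, h⟩ := exists_shiftedAiry_le P.ξ₁ hc
  refine ⟨C, hC, fun s y => ?_⟩
  rw [kB, abs_mul, Real.abs_exp]
  calc Real.exp (δ * (s + y)) * |shiftedAiry P.ξ₁ P.η₁ s (-y)|
      ≤ Real.exp (δ * (s + y)) * (C * Real.exp (-c * (s + -y))) := by gcongr; exact h _ _
    _ = _ := by rw [mul_left_comm, ← Real.exp_add]; congr 2; ring

theorem exists_kC_le {c : ℝ} (hc : -P.Δη < c) :
    ∃ C, 0 < C ∧ ∀ x v, |kC P δ x v| ≤ C * Real.exp (-(δ + c * P.α) * x - c * v) := by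
  obtain ⟨C, hC, h⟩ := exists_shiftedAiry_le P.Δξ hc
  refine ⟨C, hC, fun x v => ?_⟩
  rw [kC, abs_mul, Real.abs_exp]
  calc Real.exp (-δ * x) * |shiftedAiry P.Δξ P.Δη (P.α * x) v|
      ≤ Real.exp (-δ * x) * (C * Real.exp (-c * (P.α * x + v))) := by gcongr; exact h _ _
    _ = _ := by rw [mul_left_comm, ← Real.exp_add]; congr 2; ring

theorem exists_kD_le (hα : 0 < P.α) {c : ℝ} (hc : P.Δη < c) :
    ∃ C, 0 < C ∧ ∀ v y, |kD P δ v y| ≤ C * Real.exp ((δ - c * P.α) * y - c * v) := by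
  obtain ⟨C, hC, h⟩ := exists_shiftedAiry_le P.Δξ (η := -P.Δη) (c := c) (by simpa using hc)
  refine ⟨P.α * C, by positivity, fun v y => ?_⟩
  rw [kD, abs_mul, abs_mul, Real.abs_exp, abs_of_pos hα]
  calc P.α * Real.exp (δ * y) * |shiftedAiry P.Δξ (-P.Δη) v (P.α * y)|
      ≤ P.α * Real.exp (δ * y) * (C * Real.exp (-c * (v + P.α * y))) := by gcongr; exact h _ _
    _ = P.α * C * (Real.exp (δ * y) * Real.exp (-c * (v + P.α * y))) := by ring
    _ = _ := by rw [← Real.exp_add]; congr 2; ring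

/-- Two one-sided exponential bounds combine into a bound by `exp(-ε |x|)`. -/
theorem le_exp_neg_mul_abs {a C₁ C₂ ε x p q r : ℝ} (hC₁ : 0 ≤ C₁) (hC₂ : 0 ≤ C₂)
    (h₁ : a ≤ C₁ * Real.exp (ε * x + p)) (h₂ : a ≤ C₂ * Real.exp (-ε * x + q)) (hp : p ≤ r)
    (hq : q ≤ r) : a ≤ (C₁ + C₂) * (Real.exp (-ε * |x|) * Real.exp r) := by
  rw [← Real.exp_add]
  rcases le_total x 0 with hx | hx
  · rw [abs_of_nonpos hx]
    calc a ≤ C₁ * Real.exp (ε * x + p) := h₁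
      _ ≤ C₁ * Real.exp (-ε * -x + r) := by gcongr C₁ * Real.exp ?_; linarith
      _ ≤ _ := by gcongr; linarith
  · rw [abs_of_nonneg hx]
    calc a ≤ C₂ * Real.exp (-ε * x + q) := h₂
      _ ≤ C₂ * Real.exp (-ε * x + r) := by gcongr
      _ ≤ _ := by gcongr; linarith

/-- Joint exponential bounds for the factor kernels. On the half-line variable `a` and `d` may grow
at rate `M`, and `b` on the negative axis, `c` on the positive axis and the product `b c` decay
at the faster rate `M + 1`; on the line all of them decay at rate at least `ε`. -/
structure KernelBounds (P : Params) (δ ε M C : ℝ) : Prop where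
  ε_pos : 0 < ε
  ε_le : ε ≤ M
  C_pos : 0 < C
  kA_le : ∀ x s, 0 ≤ s → |kA P δ x s| ≤ C * (Real.exp (-ε * |x|) * Real.exp (M * s))
  kD_le : ∀ v y, 0 ≤ v → |kD P δ v y| ≤ C * (Real.exp (-ε * |y|) * Real.exp (M * v))
  kB_le : ∀ s y, 0 ≤ s → y ≤ 0 →
    |kB P δ s y| ≤ C * (Real.exp (-ε * |y|) * Real.exp (-(M + 1) * s))
  kC_le : ∀ x v, 0 ≤ v → 0 ≤ x →
    |kC P δ x v| ≤ C * (Real.exp (-ε * |x|) * Real.exp (-(M + 1) * v))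
  kB_mul_kC_le : ∀ v x w, 0 ≤ v → 0 ≤ w → |kB P δ v x * kC P δ x w| ≤
    C * (Real.exp (-1 * |x|) * Real.exp (-(M + 1) * v + -(M + 1) * w))

theorem exists_kB_le_of_nonpos (m : ℝ) : ∃ C, 0 < C ∧ ∀ s y, 0 ≤ s → y ≤ 0 →
    |kB P δ s y| ≤ C * (Real.exp (-m * |y|) * Real.exp (-m * s)) := by
  obtain ⟨C, hC, h⟩ := exists_kB_le (P := P) (δ := δ) (c := |P.η₁| + |m| + |δ| + 1)
    (by linarith [neg_le_abs P.η₁, abs_nonneg m, abs_nonneg δ])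
  refine ⟨C, hC, fun s y hs hy => (h s y).trans ?_⟩
  rw [← Real.exp_add, abs_of_nonpos hy]
  have h1 := abs_nonneg P.η₁
  have h2 := le_abs_self m
  have h3 := le_abs_self δ
  have h4 := neg_le_abs δ
  gcongr C * Real.exp ?_
  have h5 : (δ + (|P.η₁| + |m| + |δ| + 1)) * y ≤ m * y :=
    mul_le_mul_of_nonpos_right (by linarith) hy
  have h6 : (δ - (|P.η₁| + |m| + |δ| + 1)) * s ≤ -m * s :=
    mul_le_mul_of_nonneg_right (by linarith) hs
  linarith

theorem exists_kC_le_of_nonneg (hα : 0 < P.α) (m : ℝ) : ∃ C, 0 < C ∧ ∀ x v, 0 ≤ v → 0 ≤ x →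
    |kC P δ x v| ≤ C * (Real.exp (-m * |x|) * Real.exp (-m * v)) := by
  set c := |P.Δη| + |m| + (|m| + |δ|) / P.α + 1 with hc
  have h0 : 0 ≤ (|m| + |δ|) / P.α := by positivity
  obtain ⟨C, hC, h⟩ := exists_kC_le (P := P) (δ := δ) (c := c)
    (by linarith [neg_le_abs P.Δη, abs_nonneg m])
  refine ⟨C, hC, fun x v hv hx => (h x v).trans ?_⟩
  rw [← Real.exp_add, abs_of_nonneg hx]
  have h1 := abs_nonneg P.Δη
  have h2 := le_abs_self m
  have h4 := neg_le_abs δ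
  have h5 : |m| + |δ| ≤ c * P.α := by
    rw [← div_le_iff₀ hα]
    linarith [abs_nonneg m]
  have h6 : m ≤ c := by linarith
  gcongr C * Real.exp ?_
  have h7 : m * x ≤ (δ + c * P.α) * x := mul_le_mul_of_nonneg_right (by linarith) hx
  have h8 : m * v ≤ c * v := mul_le_mul_of_nonneg_right h6 hv
  linarith

theorem exists_kB_mul_kC_le (hα : 0 < P.α) (m : ℝ) : ∃ C, 0 < C ∧ ∀ v x w, 0 ≤ v → 0 ≤ w →
    |kB P δ v x * kC P δ x w| ≤ C * (Real.exp (-1 * |x|) * Real.exp (-m * v + -m * w)) := by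
  have hm := le_abs_self m
  have hm0 := abs_nonneg m
  have hδ := le_abs_self δ
  have hδ0 := abs_nonneg δ
  have hη := neg_le_abs P.η₁
  have hη0 := abs_nonneg P.η₁
  have hΔ := neg_le_abs P.Δη
  have hΔ0 := abs_nonneg P.Δη
  -- general exponents `c` for `b` and `c'` for `c`
  have key : ∀ c c' : ℝ, |P.η₁| + |m| + |δ| + 1 ≤ c → |P.Δη| + |m| + 1 ≤ c' →
      ∃ C, 0 < C ∧ ∀ v x w, 0 ≤ v → 0 ≤ w → |kB P δ v x * kC P δ x w| ≤
        C * Real.exp ((c - P.α * c') * x + (-m * v + -m * w)) := by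
    intro c c' hc hc'
    obtain ⟨C₁, hC₁, h₁⟩ := exists_kB_le (P := P) (δ := δ) (c := c) (by linarith)
    obtain ⟨C₂, hC₂, h₂⟩ := exists_kC_le (P := P) (δ := δ) (c := c') (by linarith)
    refine ⟨C₁ * C₂, by positivity, fun v x w hv hw => ?_⟩
    rw [abs_mul]
    calc |kB P δ v x| * |kC P δ x w|
        ≤ (C₁ * Real.exp ((δ + c) * x + (δ - c) * v)) *
          (C₂ * Real.exp (-(δ + c' * P.α) * x - c' * w)) := by
          gcongr
          · exact h₁ v x
          · exact h₂ x w
      _ = C₁ * C₂ * Real.exp (((δ + c) * x + (δ - c) * v) +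
          (-(δ + c' * P.α) * x - c' * w)) := by
            rw [Real.exp_add _ (-(δ + c' * P.α) * x - c' * w)]; ring
      _ ≤ _ := by
          gcongr C₁ * C₂ * Real.exp ?_
          have e1 : m * v ≤ (c - δ) * v := mul_le_mul_of_nonneg_right (by linarith) hv
          have e2 : m * w ≤ c' * w := mul_le_mul_of_nonneg_right (by linarith) hw
          linarith
  set c₀ := |P.η₁| + |m| + |δ| + 1 with hc₀
  set c₀' := |P.Δη| + |m| + 1 with hc₀'
  have hc₀α : 0 ≤ P.α * c₀' := by positivity
  obtain ⟨C₁, hC₁, h₁⟩ := key (c₀ + P.α * c₀') c₀' (by linarith) le_rfl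
  have hdiv : 0 ≤ (c₀ + 1) / P.α := by positivity
  obtain ⟨C₂, hC₂, h₂⟩ := key c₀ (c₀' + (c₀ + 1) / P.α) le_rfl (by linarith)
  refine ⟨C₁ + C₂, by positivity, fun v x w hv hw => ?_⟩
  -- on each half-line one of the two exponents of `x` has the right sign and modulus at least `1`
  have e1 : 1 ≤ c₀ := by linarith
  have e2 : P.α * ((c₀ + 1) / P.α) = c₀ + 1 := by field_simp
  rw [← Real.exp_add]
  rcases le_total x 0 with hx | hx
  · rw [abs_of_nonpos hx]
    calc |kB P δ v x * kC P δ x w| ≤ _ := h₁ v x w hv hw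
      _ ≤ C₁ * Real.exp (-1 * -x + (-m * v + -m * w)) := by
          gcongr C₁ * Real.exp (?_ + _)
          nlinarith
      _ ≤ _ := by gcongr; linarith
  · rw [abs_of_nonneg hx]
    calc |kB P δ v x * kC P δ x w| ≤ _ := h₂ v x w hv hw
      _ ≤ C₂ * Real.exp (-1 * x + (-m * v + -m * w)) := by
          gcongr C₂ * Real.exp (?_ + _)
          nlinarith
      _ ≤ _ := by gcongr; linarith

theorem exists_kernelBounds (hα : 0 < P.α) (hδ : max P.η₁ (P.α * P.Δη) < δ) :
    ∃ ε M C, KernelBounds P δ ε M C := by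
  have hδ₁ : P.η₁ < δ := (le_max_left _ _).trans_lt hδ
  have hδ₂ : P.α * P.Δη < δ := (le_max_right _ _).trans_lt hδ
  obtain ⟨ε, hε, hε₁, hε₂⟩ : ∃ ε > 0, P.η₁ < δ - ε ∧ P.α * P.Δη < δ - ε := by
    refine ⟨min (δ - P.η₁) (δ - P.α * P.Δη) / 2, ?_, ?_, ?_⟩
    · have : 0 < min (δ - P.η₁) (δ - P.α * P.Δη) := lt_min (by linarith) (by linarith)
      linarith
    · have := min_le_left (δ - P.η₁) (δ - P.α * P.Δη)
      linarith
    · have := min_le_right (δ - P.η₁) (δ - P.α * P.Δη)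
      linarith
  set M := 2 * |δ| + ε + (|δ| + ε) / P.α with hM
  have hδa := le_abs_self δ
  have hδb := neg_le_abs δ
  have hδc := abs_nonneg δ
  have hq : 0 ≤ (|δ| + ε) / P.α := by positivity
  obtain ⟨A₁, hA₁, hA₁'⟩ := exists_kA_le (P := P) (δ := δ) (c := δ + ε) (by linarith)
  obtain ⟨A₂, hA₂, hA₂'⟩ := exists_kA_le (P := P) (δ := δ) (c := δ - ε) hε₁
  obtain ⟨D₁, hD₁, hD₁'⟩ := exists_kD_le (δ := δ) hα (c := (δ - ε) / P.α)
    (by rw [lt_div_iff₀ hα]; linarith)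
  obtain ⟨D₂, hD₂, hD₂'⟩ := exists_kD_le (δ := δ) hα (c := (δ + ε) / P.α)
    (by rw [lt_div_iff₀ hα]; linarith)
  obtain ⟨B₁, hB₁, hB₁'⟩ := exists_kB_le_of_nonpos (P := P) (δ := δ) (M + 1)
  obtain ⟨C₁, hC₁, hC₁'⟩ := exists_kC_le_of_nonneg (δ := δ) hα (M + 1)
  obtain ⟨C₂, hC₂, hC₂'⟩ := exists_kB_mul_kC_le (δ := δ) hα (M + 1)
  set C := A₁ + A₂ + D₁ + D₂ + B₁ + C₁ + C₂ with hC
  have hεM : ∀ x : ℝ, Real.exp (-(M + 1) * |x|) ≤ Real.exp (-ε * |x|) := fun x => by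
    have := abs_nonneg x
    gcongr
    linarith
  refine ⟨ε, M, C, hε, by linarith, by positivity, fun x s hs => ?_, fun v y hv => ?_,
    fun s y hs hy => ?_, fun x v hv hx => ?_, fun v x w hv hw => ?_⟩
  · have h := le_exp_neg_mul_abs (a := |kA P δ x s|) (ε := ε) (x := x)
      (p := -(2 * δ + ε) * s) (q := -(2 * δ - ε) * s) (r := M * s) hA₁.le hA₂.le
      ((hA₁' x s).trans (le_of_eq (by congr 2; ring)))
      ((hA₂' x s).trans (le_of_eq (by congr 2; ring)))
      (mul_le_mul_of_nonneg_right (by linarith) hs) (mul_le_mul_of_nonneg_right (by linarith) hs)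
    refine h.trans ?_
    gcongr
    linarith
  · have e1 : (δ - ε) / P.α * P.α = δ - ε := by field_simp
    have e2 : (δ + ε) / P.α * P.α = δ + ε := by field_simp
    have e3 : -((δ - ε) / P.α) ≤ (|δ| + ε) / P.α := by
      rw [← neg_div]; gcongr; linarith
    have e4 : -((δ + ε) / P.α) ≤ (|δ| + ε) / P.α := by
      rw [← neg_div]; gcongr; linarith
    have h := le_exp_neg_mul_abs (a := |kD P δ v y|) (ε := ε) (x := y)
      (p := -((δ - ε) / P.α) * v) (q := -((δ + ε) / P.α) * v) (r := M * v) hD₁.le hD₂.le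
      ((hD₁' v y).trans (le_of_eq (by congr 2; rw [e1]; ring)))
      ((hD₂' v y).trans (le_of_eq (by congr 2; rw [e2]; ring)))
      (mul_le_mul_of_nonneg_right (by linarith) hv) (mul_le_mul_of_nonneg_right (by linarith) hv)
    refine h.trans ?_
    gcongr
    linarith
  · refine (hB₁' s y hs hy).trans ?_
    gcongr ?_ * (?_ * _)
    · linarith
    · exact hεM y
  · refine (hC₁' x v hv hx).trans ?_
    gcongr ?_ * (?_ * _)
    · linarith
    · exact hεM x
  · refine (hC₂' v x w hv hw).trans ?_
    gcongr
    linarith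

end Kernels

/-! ### Bounds and integrability for the composed kernels -/

section Composed

theorem integrable_of_norm_le_exp_neg_abs {f : ℝ → ℝ} (hf : Measurable f) {κ K : ℝ} (hκ : 0 < κ)
    (h : ∀ x, |f x| ≤ K * Real.exp (-κ * |x|)) : Integrable f :=
  ((integrable_exp_neg_mul_abs hκ).const_mul K).mono' hf.aestronglyMeasurable
    (Filter.Eventually.of_forall h)

theorem integrableOn_exp_neg_Ioi : IntegrableOn (fun v : ℝ => Real.exp (-v)) (Set.Ioi 0) := by
  simpa using integrableOn_exp_mul_Ioi (a := -1) (by norm_num) 0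

/-- The value `∫ exp(-|x|) dx`. -/
noncomputable def expAbsIntegral : ℝ := ∫ x : ℝ, Real.exp (-1 * |x|)

theorem expAbsIntegral_nonneg : 0 ≤ expAbsIntegral := integral_nonneg fun _ => (Real.exp_pos _).le

namespace KernelBounds

variable {P : Params} {δ ε M C : ℝ} {μ : Measure ℝ}

theorem kBC_le (h : KernelBounds P δ ε M C) (hμ : μ ≤ volume) {v w : ℝ} (hv : 0 ≤ v)
    (hw : 0 ≤ w) : |kBC P δ μ v w| ≤
      C * expAbsIntegral * Real.exp (-(M + 1) * v + -(M + 1) * w) := by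
  set K := C * Real.exp (-(M + 1) * v + -(M + 1) * w) with hK
  have hK0 : 0 ≤ K := mul_nonneg h.C_pos.le (Real.exp_pos _).le
  have hI := (integrable_exp_neg_mul_abs one_pos).const_mul K
  have hle : ∀ x, ‖kB P δ v x * kC P δ x w‖ ≤ K * Real.exp (-1 * |x|) := fun x =>
    (h.kB_mul_kC_le v x w hv hw).trans (le_of_eq (by rw [hK]; ring))
  calc |kBC P δ μ v w| ≤ ∫ x, K * Real.exp (-1 * |x|) ∂μ :=
        norm_integral_le_of_norm_le (hI.mono_measure hμ) (Filter.Eventually.of_forall hle)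
    _ ≤ ∫ x, K * Real.exp (-1 * |x|) := integral_mono_measure hμ
        (Filter.Eventually.of_forall fun x => mul_nonneg hK0 (Real.exp_pos _).le) hI
    _ = _ := by rw [integral_const_mul, expAbsIntegral, hK]; ring

theorem kA_mul_kBC_le (h : KernelBounds P δ ε M C) (hμ : μ ≤ volume) {v w : ℝ} (x : ℝ)
    (hv : 0 ≤ v) (hw : 0 ≤ w) : |kA P δ x v * kBC P δ μ v w| ≤
      C * (C * expAbsIntegral) * (Real.exp (-ε * |x|) * Real.exp (-(M + 1) * w)) *
        Real.exp (-v) := by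
  have hC := h.C_pos
  rw [abs_mul]
  calc |kA P δ x v| * |kBC P δ μ v w|
      ≤ (C * (Real.exp (-ε * |x|) * Real.exp (M * v))) *
        (C * expAbsIntegral * Real.exp (-(M + 1) * v + -(M + 1) * w)) :=
        mul_le_mul (h.kA_le x v hv) (h.kBC_le hμ hv hw) (abs_nonneg _) (by positivity)
    _ = _ := by
        have : Real.exp (-v) = Real.exp (M * v) * Real.exp (-(M + 1) * v) := by
          rw [← Real.exp_add]; congr 1; ring
        rw [Real.exp_add, this]
        ring

theorem kABC_le (h : KernelBounds P δ ε M C) (hμ : μ ≤ volume) (x : ℝ) {w : ℝ} (hw : 0 ≤ w) :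
    |kABC P δ μ x w| ≤
      C * (C * expAbsIntegral) * (Real.exp (-ε * |x|) * Real.exp (-(M + 1) * w)) := by
  have hle : ∀ v ∈ Set.Ioi (0 : ℝ), ‖kA P δ x v * kBC P δ μ v w‖ ≤ _ := fun v hv =>
    h.kA_mul_kBC_le hμ x (Set.mem_Ioi.1 hv).le hw
  refine (norm_integral_le_of_norm_le (integrableOn_exp_neg_Ioi.const_mul _)
    ((ae_restrict_mem measurableSet_Ioi).mono hle)).trans (le_of_eq ?_)
  rw [integral_const_mul, integral_exp_neg_Ioi_zero, mul_one]

theorem exp_neg_mul_abs_le_one (h : KernelBounds P δ ε M C) (x : ℝ) :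
    Real.exp (-ε * |x|) ≤ 1 :=
  Real.exp_le_one_iff.2 (by have := mul_nonneg h.ε_pos.le (abs_nonneg x); linarith)

end KernelBounds

end Composed

/-! ### Factorization of the kernel `R(u)` -/

section FactorR

variable {P : Params} {δ ε M C : ℝ} {μ : Measure ℝ}

theorem S₃_eq_integral (x y : ℝ) :
    S₃ P δ x y = ∫ v in Set.Ioi (0 : ℝ), kA P δ x v * kB P δ v y := by
  rw [S₃, airyKernel, ← integral_const_mul]
  congr 1
  ext v
  rw [kA, kB, shiftedAiry, shiftedAiry]
  have h1 : P.ξ₁ + P.η₁ ^ 2 - x + v = P.ξ₁ + (-P.η₁) ^ 2 + -x + v := by ring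
  have h2 : P.ξ₁ + P.η₁ ^ 2 - y + v = P.ξ₁ + P.η₁ ^ 2 + v + -y := by ring
  have h3 : Real.exp ((δ - P.η₁) * (y - x)) = Real.exp (-δ * (x + v)) *
      Real.exp ((P.ξ₁ + -x + v) * -P.η₁ + 2 / 3 * (-P.η₁) ^ 3) * (Real.exp (δ * (v + y)) *
      Real.exp ((P.ξ₁ + v + -y) * P.η₁ + 2 / 3 * P.η₁ ^ 3)) := by
    rw [← Real.exp_add, ← Real.exp_add, ← Real.exp_add]
    congr 1
    ring
  rw [h1, h2, h3]
  ring

theorem S₂_eq_integral (x y : ℝ) :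
    S₂ P δ x y = ∫ v in Set.Ioi (0 : ℝ), kC P δ x v * kD P δ v y := by
  rw [S₂, airyKernel, ← integral_const_mul]
  congr 1
  ext v
  rw [kC, kD, shiftedAiry, shiftedAiry]
  have h1 : P.Δξ + P.Δη ^ 2 + P.α * y + v = P.Δξ + (-P.Δη) ^ 2 + v + P.α * y := by ring
  have h3 : Real.exp ((δ - P.α * P.Δη) * (y - x)) = Real.exp (-δ * x) *
      Real.exp ((P.Δξ + P.α * x + v) * P.Δη + 2 / 3 * P.Δη ^ 3) * (Real.exp (δ * y) *
      Real.exp ((P.Δξ + v + P.α * y) * -P.Δη + 2 / 3 * (-P.Δη) ^ 3)) := by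
    rw [← Real.exp_add, ← Real.exp_add, ← Real.exp_add]
    congr 1
    ring
  rw [h1, h3]
  ring

theorem S₃_mul_S₂ (x s y : ℝ) : S₃ P δ x s * S₂ P δ s y =
    P.α * Real.exp ((P.η₁ - δ) * x + (δ - P.α * P.Δη) * y) *
      (Real.exp ((P.α * P.Δη - P.η₁) * s) *
      airyKernel (P.ξ₁ + P.η₁ ^ 2 - s) (P.ξ₁ + P.η₁ ^ 2 - x) *
      airyKernel (P.Δξ + P.Δη ^ 2 + P.α * s) (P.Δξ + P.Δη ^ 2 + P.α * y)) := by
  have h1 : airyKernel (P.ξ₁ + P.η₁ ^ 2 - x) (P.ξ₁ + P.η₁ ^ 2 - s) =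
      airyKernel (P.ξ₁ + P.η₁ ^ 2 - s) (P.ξ₁ + P.η₁ ^ 2 - x) := by
    simp only [airyKernel, mul_comm]
  have h2 : Real.exp ((δ - P.η₁) * (s - x)) * Real.exp ((δ - P.α * P.Δη) * (y - s)) =
      Real.exp ((P.η₁ - δ) * x + (δ - P.α * P.Δη) * y) *
        Real.exp ((P.α * P.Δη - P.η₁) * s) := by
    rw [← Real.exp_add, ← Real.exp_add]
    congr 1
    ring
  rw [S₃, S₂, h1]
  linear_combination (P.α * airyKernel (P.ξ₁ + P.η₁ ^ 2 - s) (P.ξ₁ + P.η₁ ^ 2 - x) *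
    airyKernel (P.Δξ + P.Δη ^ 2 + P.α * s) (P.Δξ + P.Δη ^ 2 + P.α * y)) * h2

theorem S₁_eq_integral (x y : ℝ) :
    S₁ P δ x y = -∫ s in Set.Ioi (0 : ℝ), S₃ P δ x s * S₂ P δ s y := by
  simp_rw [S₃_mul_S₂]
  rw [integral_const_mul, S₁]
  ring

theorem T₁_eq_integral (x y : ℝ) :
    T₁ P δ x y = ∫ s in Set.Iio (0 : ℝ), S₃ P δ x s * S₂ P δ s y := by
  simp_rw [S₃_mul_S₂]
  rw [integral_const_mul, T₁]

namespace KernelBounds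

/-- Absolute integrability of the triple integral of `a b c d` over the three
intermediate variables. -/
theorem integrable_abcd (h : KernelBounds P δ ε M C) [SFinite μ] (hμ : μ ≤ volume) (x y : ℝ) :
    Integrable (Function.uncurry fun (p : ℝ × ℝ) (s : ℝ) =>
      kA P δ x p.1 * kB P δ p.1 s * (kC P δ s p.2 * kD P δ p.2 y))
      (((volume.restrict (Set.Ioi 0)).prod (volume.restrict (Set.Ioi 0))).prod μ) := by
  have hC := h.C_pos
  have hI := ((integrableOn_exp_neg_Ioi.mul_prod integrableOn_exp_neg_Ioi).mul_prod
    ((integrable_exp_neg_mul_abs one_pos).mono_measure hμ)).const_mul (C * C * C)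
  refine hI.mono' ?_ ?_
  · have h1 := continuous_kA (P := P) (δ := δ)
    have h2 := continuous_kB (P := P) (δ := δ)
    have h3 := continuous_kC (P := P) (δ := δ)
    have h4 := continuous_kD (P := P) (δ := δ)
    refine Measurable.aestronglyMeasurable ?_
    exact ((measurable_comp₂ h1.measurable measurable_const measurable_fst.fst).mul
      (measurable_comp₂ h2.measurable measurable_fst.fst measurable_snd)).mul
      ((measurable_comp₂ h3.measurable measurable_snd measurable_fst.snd).mul
      (measurable_comp₂ h4.measurable measurable_fst.snd measurable_const))
  · have hmem : ∀ᵐ v ∂(volume.restrict (Set.Ioi (0 : ℝ))), v ∈ Set.Ioi (0 : ℝ) :=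
      ae_restrict_mem measurableSet_Ioi
    have e1 := Measure.quasiMeasurePreserving_fst.ae (Measure.quasiMeasurePreserving_fst.ae hmem
      (μa := (volume.restrict (Set.Ioi (0 : ℝ))).prod (volume.restrict (Set.Ioi (0 : ℝ)))))
      (μa := ((volume.restrict (Set.Ioi (0 : ℝ))).prod (volume.restrict (Set.Ioi (0 : ℝ)))).prod μ)
    have e2 := Measure.quasiMeasurePreserving_fst.ae (Measure.quasiMeasurePreserving_snd.ae hmem
      (μa := (volume.restrict (Set.Ioi (0 : ℝ))).prod (volume.restrict (Set.Ioi (0 : ℝ)))))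
      (μa := ((volume.restrict (Set.Ioi (0 : ℝ))).prod (volume.restrict (Set.Ioi (0 : ℝ)))).prod μ)
    filter_upwards [e1, e2] with z hz1 hz2
    obtain ⟨⟨v, w⟩, s⟩ := z
    have hv : 0 < v := hz1
    have hw : 0 < w := hz2
    simp only [Function.uncurry]
    have e3 : kA P δ x v * kB P δ v s * (kC P δ s w * kD P δ w y) =
        kA P δ x v * (kB P δ v s * kC P δ s w) * kD P δ w y := by ring
    rw [e3, norm_mul, norm_mul]
    have hA : |kA P δ x v| ≤ C * Real.exp (M * v) := (h.kA_le x v hv.le).trans (by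
      gcongr
      exact mul_le_of_le_one_left (Real.exp_pos _).le (h.exp_neg_mul_abs_le_one x))
    have hD : |kD P δ w y| ≤ C * Real.exp (M * w) := (h.kD_le w y hw.le).trans (by
      gcongr
      exact mul_le_of_le_one_left (Real.exp_pos _).le (h.exp_neg_mul_abs_le_one y))
    have hBC := h.kB_mul_kC_le v s w hv.le hw.le
    simp only [Real.norm_eq_abs]
    calc |kA P δ x v| * |kB P δ v s * kC P δ s w| * |kD P δ w y|
        ≤ (C * Real.exp (M * v)) * (C * (Real.exp (-1 * |s|) *
          Real.exp (-(M + 1) * v + -(M + 1) * w))) * (C * Real.exp (M * w)) := by gcongr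
      _ = C * C * C * (Real.exp (-v) * Real.exp (-w) * Real.exp (-1 * |s|)) := by
          have e4 : Real.exp (-v) = Real.exp (M * v) * Real.exp (-(M + 1) * v) := by
            rw [← Real.exp_add]; congr 1; ring
          have e5 : Real.exp (-w) = Real.exp (M * w) * Real.exp (-(M + 1) * w) := by
            rw [← Real.exp_add]; congr 1; ring
          rw [Real.exp_add, e4, e5]
          ring

theorem S₃_mul_S₂_eq_integral (x s y : ℝ) : S₃ P δ x s * S₂ P δ s y =
    ∫ p : ℝ × ℝ, kA P δ x p.1 * kB P δ p.1 s * (kC P δ s p.2 * kD P δ p.2 y)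
      ∂((volume.restrict (Set.Ioi 0)).prod (volume.restrict (Set.Ioi 0))) := by
  rw [S₃_eq_integral, S₂_eq_integral]
  exact (integral_prod_mul (fun v => kA P δ x v * kB P δ v s)
    (fun w => kC P δ s w * kD P δ w y)).symm

theorem integrable_S₃_mul_S₂ (h : KernelBounds P δ ε M C) (x y : ℝ) :
    Integrable fun s => S₃ P δ x s * S₂ P δ s y := by
  simp_rw [S₃_mul_S₂_eq_integral]
  exact (h.integrable_abcd le_rfl x y).integral_prod_right

theorem integral_S₃_mul_S₂ (h : KernelBounds P δ ε M C) [SFinite μ] (hμ : μ ≤ volume) (x y : ℝ) :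
    ∫ s, S₃ P δ x s * S₂ P δ s y ∂μ =
      ∫ w in Set.Ioi (0 : ℝ), kABC P δ μ x w * kD P δ w y := by
  have hT := h.integrable_abcd hμ x y
  simp_rw [S₃_mul_S₂_eq_integral]
  have hT' : Integrable (fun p : ℝ × ℝ => ∫ s, kA P δ x p.1 * kB P δ p.1 s *
      (kC P δ s p.2 * kD P δ p.2 y) ∂μ)
      ((volume.restrict (Set.Ioi 0)).prod (volume.restrict (Set.Ioi 0))) := hT.integral_prod_left
  rw [← integral_integral_swap hT, integral_prod_symm _ hT']
  congr 1
  ext w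
  rw [kABC, ← integral_mul_const]
  congr 1
  ext v
  rw [kBC, ← integral_const_mul, ← integral_mul_const]
  congr 1
  ext s
  ring

end KernelBounds

end FactorR

/-! ### The entries of `Q(u)` as composed kernels -/

section EntriesQ

/-- The relations between the parameters that make the convolution of the Airy functions of
`(ξ₁, η₁)` and `(Δξ, Δη)` the Airy function of `(ξ₂, η₂)`. -/
structure Params.Relations (P : Params) : Prop where
  α_pos : 0 < P.α
  α'_pos : 0 < P.α'
  cube : P.α' ^ 3 = 1 + P.α ^ 3
  ξ_eq : P.ξ₂ * P.α' = P.Δξ + P.ξ₁ * P.α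
  η_eq : P.η₂ * P.α' ^ 2 = P.Δη + P.η₁ * P.α ^ 2

theorem Params.relations {P : Params} (ht₁ : 0 < P.t₁) (ht₂ : P.t₁ < P.t₂) : P.Relations := by
  have hΔ : 0 < P.t₂ - P.t₁ := sub_pos.2 ht₂
  have h1 : 0 < P.t₁ / (P.t₂ - P.t₁) := div_pos ht₁ hΔ
  have h2 : 0 < P.t₂ / (P.t₂ - P.t₁) := div_pos (ht₁.trans ht₂) hΔ
  have hα : 0 < P.α := Real.rpow_pos_of_pos h1 _
  have hα3 : P.α ^ 3 = P.t₁ / (P.t₂ - P.t₁) := by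
    rw [Params.α, ← Real.rpow_natCast, ← Real.rpow_mul h1.le]
    norm_num
  have hsum : 1 + P.α ^ 3 = P.t₂ / (P.t₂ - P.t₁) := by
    rw [hα3]
    field_simp
    ring
  have hα'def : P.α' = (P.t₂ / (P.t₂ - P.t₁)) ^ (1 / 3 : ℝ) := by rw [Params.α', hsum]
  have hα' : 0 < P.α' := by rw [hα'def]; exact Real.rpow_pos_of_pos h2 _
  have hsq : ∀ x : ℝ, 0 < x → x ^ (2 / 3 : ℝ) = (x ^ (1 / 3 : ℝ)) ^ 2 := fun x hx => by
    rw [← Real.rpow_natCast, ← Real.rpow_mul hx.le]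
    norm_num
  refine ⟨hα, hα', ?_, ?_, ?_⟩
  · rw [hsum, hα'def, ← Real.rpow_natCast, ← Real.rpow_mul h2.le]
    norm_num
  · rw [Params.Δξ, ← hα'def, ← Params.α]
    ring
  · rw [Params.Δη, hsq _ h1, hsq _ h2, ← hα'def, ← Params.α]
    ring

variable {P : Params} {δ ε M C : ℝ}

/-- Lebesgue measure on the negative half-line. -/
noncomputable def volNeg : Measure ℝ := volume.restrict (Set.Iio 0)

instance : SFinite volNeg := by unfold volNeg; infer_instance

theorem volNeg_le : volNeg ≤ volume := Measure.restrict_le_self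

theorem integral_volNeg (f : ℝ → ℝ) : ∫ x, f x ∂volNeg = ∫ x in Set.Ioi (0 : ℝ), f (-x) := by
  rw [volNeg, ← integral_Iic_eq_integral_Iio, integral_comp_neg_Ioi, neg_zero]

theorem integral_Ioi_comp_mul_left (g : ℝ → ℝ) {b : ℝ} (hb : 0 < b) :
    ∫ x in Set.Ioi (0 : ℝ), g (b * x) = b⁻¹ * ∫ x in Set.Ioi (0 : ℝ), g x := by
  simpa using integral_comp_mul_left_Ioi g 0 hb

theorem kBC_volume (hP : P.Relations) (v w : ℝ) : kBC P δ volume v w =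
    Real.exp (δ * v) / P.α' * shiftedAiry P.ξ₂ P.η₂ (P.α * v / P.α') (w / P.α') := by
  have hα' := hP.α'_pos
  have h1 : ∀ x, kB P δ v x * kC P δ x w = Real.exp (δ * v) *
      (airyPhi P.η₁ (P.ξ₁ + v - x) * airyPhi P.Δη (P.α * x + (P.Δξ + w))) := by
    intro x
    have e1 : Real.exp (δ * v) = Real.exp (δ * (v + x)) * Real.exp (-δ * x) := by
      rw [← Real.exp_add]; congr 1; ring
    have e2 : P.ξ₁ + v + -x = P.ξ₁ + v - x := by ring
    have e3 : P.Δξ + P.α * x + w = P.α * x + (P.Δξ + w) := by ring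
    rw [kB, kC, shiftedAiry_eq_airyPhi, shiftedAiry_eq_airyPhi, e1, e2, e3]
    ring
  rw [kBC]
  simp_rw [h1]
  rw [integral_const_mul, integral_airyPhi_mul_airyPhi hP.α_pos hα' hP.cube hP.η_eq,
    shiftedAiry_eq_airyPhi]
  have e4 : (P.α * (P.ξ₁ + v) + (P.Δξ + w)) / P.α' = P.ξ₂ + P.α * v / P.α' + w / P.α' := by
    field_simp
    linarith [hP.ξ_eq]
  rw [e4]
  ring

theorem integral_kD_mul_kA (hP : P.Relations) (v w : ℝ) :
    ∫ x, kD P δ v x * kA P δ x w = k₄ P δ v w := by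
  have hα' := hP.α'_pos
  have h1 : ∀ x, kD P δ v x * kA P δ x w = P.α * Real.exp (-δ * w) *
      (airyPhi (-P.η₁) (P.ξ₁ + w - x) * airyPhi (-P.Δη) (P.α * x + (P.Δξ + v))) := by
    intro x
    have e1 : Real.exp (-δ * w) = Real.exp (δ * x) * Real.exp (-δ * (x + w)) := by
      rw [← Real.exp_add]; congr 1; ring
    have e2 : P.ξ₁ + -x + w = P.ξ₁ + w - x := by ring
    have e3 : P.Δξ + v + P.α * x = P.α * x + (P.Δξ + v) := by ring
    rw [kD, kA, shiftedAiry_eq_airyPhi, shiftedAiry_eq_airyPhi, e1, e2, e3]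
    ring
  simp_rw [h1]
  rw [integral_const_mul, integral_airyPhi_mul_airyPhi (η' := -P.η₂) hP.α_pos hα' hP.cube
    (by linarith [hP.η_eq]), k₄, shiftedAiry_eq_airyPhi]
  have e4 : (P.α * (P.ξ₁ + w) + (P.Δξ + v)) / P.α' = P.ξ₂ + v / P.α' + P.α * w / P.α' := by
    field_simp
    linarith [hP.ξ_eq]
  rw [e4]
  ring

theorem integral_volNeg_kD_mul_kA (v w : ℝ) :
    ∫ x, kD P δ v x * kA P δ x w ∂volNeg = k₃ P δ v w := by
  rw [integral_volNeg, k₃, ← integral_const_mul]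
  congr 1
  ext l
  have e1 : Real.exp (-δ * w) = Real.exp (δ * -l) * Real.exp (-δ * (-l + w)) := by
    rw [← Real.exp_add]; congr 1; ring
  rw [kD, kA, e1, neg_neg, mul_neg P.α l, neg_mul P.α l]
  ring

theorem integral_volNeg_kB_mul_kA (v w : ℝ) :
    ∫ x, kB P δ v x * kA P δ x w ∂volNeg = M₁ P δ v w := by
  rw [integral_volNeg, M₁, ← integral_const_mul]
  congr 1
  ext l
  have e1 : Real.exp (δ * (v - w)) = Real.exp (δ * (v + -l)) * Real.exp (-δ * (-l + w)) := by
    rw [← Real.exp_add]; congr 1; ring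
  rw [kB, kA, e1, neg_neg]
  ring

theorem integral_kD_mul_kC (hP : P.Relations) (v w : ℝ) :
    ∫ x in Set.Ioi (0 : ℝ), kD P δ v x * kC P δ x w = M₃ P v w := by
  have hα := hP.α_pos
  set g : ℝ → ℝ := fun l => shiftedAiry P.Δξ (-P.Δη) v l * shiftedAiry P.Δξ P.Δη l w with hg
  have h1 : ∀ x, kD P δ v x * kC P δ x w = P.α * g (P.α * x) := by
    intro x
    have e1 : Real.exp (δ * x) * Real.exp (-δ * x) = 1 := by
      rw [← Real.exp_add]; simp
    rw [kD, kC, hg]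
    linear_combination (P.α * shiftedAiry P.Δξ (-P.Δη) v (P.α * x) *
      shiftedAiry P.Δξ P.Δη (P.α * x) w) * e1
  simp_rw [h1]
  rw [integral_const_mul, integral_Ioi_comp_mul_left g hα, ← mul_assoc, mul_inv_cancel₀ hα.ne',
    one_mul, M₃]

theorem kBC_volNeg (v w : ℝ) : kBC P δ volNeg v w = Real.exp (δ * v) *
    ∫ l in Set.Ioi (0 : ℝ),
      shiftedAiry P.ξ₁ P.η₁ v l * shiftedAiry P.Δξ P.Δη (-P.α * l) w := by
  rw [kBC, integral_volNeg, ← integral_const_mul]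
  congr 1
  ext l
  have e1 : Real.exp (δ * v) = Real.exp (δ * (v + -l)) * Real.exp (-δ * -l) := by
    rw [← Real.exp_add]; congr 1; ring
  rw [kB, kC, e1, neg_neg, mul_neg P.α l, neg_mul P.α l]
  ring

theorem kABC_volume_neg (hP : P.Relations) (l w : ℝ) : kABC P δ volume (-l) w =
    Real.exp (δ * l) * ∫ l₂ in Set.Ioi (0 : ℝ), shiftedAiry P.ξ₁ (-P.η₁) l (P.α' * l₂) *
      shiftedAiry P.ξ₂ P.η₂ (P.α * l₂) (w / P.α') := by
  have hα' := hP.α'_pos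
  set g : ℝ → ℝ := fun s => shiftedAiry P.ξ₁ (-P.η₁) l s *
    shiftedAiry P.ξ₂ P.η₂ (P.α * s / P.α') (w / P.α') with hg
  have h1 : ∀ l₂, shiftedAiry P.ξ₁ (-P.η₁) l (P.α' * l₂) *
      shiftedAiry P.ξ₂ P.η₂ (P.α * l₂) (w / P.α') = g (P.α' * l₂) := by
    intro l₂
    have : P.α * (P.α' * l₂) / P.α' = P.α * l₂ := by field_simp
    simp only [hg, this]
  simp_rw [h1]
  rw [integral_Ioi_comp_mul_left g hα', kABC, ← integral_const_mul, ← integral_const_mul]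
  congr 1
  ext s
  have e1 : Real.exp (δ * l) = Real.exp (-δ * (-l + s)) * Real.exp (δ * s) := by
    rw [← Real.exp_add]; congr 1; ring
  rw [kA, kBC_volume hP, e1, neg_neg, hg]
  ring

theorem kABC_volNeg_neg (l w : ℝ) : kABC P δ volNeg (-l) w =
    Real.exp (δ * l) * ∫ l₂ in Set.Ioi (0 : ℝ), ∫ l₃ in Set.Ioi (0 : ℝ),
      shiftedAiry P.ξ₁ (-P.η₁) l l₂ * shiftedAiry P.ξ₁ P.η₁ l₂ l₃ *
        shiftedAiry P.Δξ P.Δη (-P.α * l₃) w := by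
  rw [kABC, ← integral_const_mul]
  congr 1
  ext s
  have e1 : Real.exp (δ * l) = Real.exp (-δ * (-l + s)) * Real.exp (δ * s) := by
    rw [← Real.exp_add]; congr 1; ring
  simp_rw [mul_assoc (shiftedAiry P.ξ₁ (-P.η₁) l s)]
  rw [integral_const_mul, kA, kBC_volNeg, e1, neg_neg]
  ring

theorem integral_volNeg_kD_mul_kABC_volume (hP : P.Relations) (v w : ℝ) :
    ∫ x, kD P δ v x * kABC P δ volume x w ∂volNeg = k₅ P v w := by
  rw [integral_volNeg, k₅, ← integral_const_mul]
  congr 1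
  ext l
  have e1 : Real.exp (δ * -l) * Real.exp (δ * l) = 1 := by rw [← Real.exp_add]; simp
  simp_rw [mul_assoc (shiftedAiry P.Δξ (-P.Δη) v (-P.α * l))]
  rw [integral_const_mul, kABC_volume_neg hP, kD, mul_neg P.α l, neg_mul P.α l]
  linear_combination (P.α * shiftedAiry P.Δξ (-P.Δη) v (-(P.α * l)) *
    ∫ l₂ in Set.Ioi (0 : ℝ), shiftedAiry P.ξ₁ (-P.η₁) l (P.α' * l₂) *
      shiftedAiry P.ξ₂ P.η₂ (P.α * l₂) (w / P.α')) * e1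

theorem integral_volNeg_kD_mul_kABC_volNeg (v w : ℝ) :
    ∫ x, kD P δ v x * kABC P δ volNeg x w ∂volNeg = k₁ P v w := by
  rw [integral_volNeg, k₁, ← integral_const_mul]
  congr 1
  ext l
  have e1 : Real.exp (δ * -l) * Real.exp (δ * l) = 1 := by rw [← Real.exp_add]; simp
  simp_rw [mul_assoc (shiftedAiry P.Δξ (-P.Δη) v (-P.α * l)), integral_const_mul]
  rw [kABC_volNeg_neg, kD, mul_neg P.α l, neg_mul P.α l]
  simp_rw [mul_assoc (shiftedAiry P.ξ₁ (-P.η₁) l _), integral_const_mul]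
  linear_combination (P.α * shiftedAiry P.Δξ (-P.Δη) v (-(P.α * l)) *
    ∫ l₂ in Set.Ioi (0 : ℝ), shiftedAiry P.ξ₁ (-P.η₁) l l₂ * ∫ l₃ in Set.Ioi (0 : ℝ),
      shiftedAiry P.ξ₁ P.η₁ l₂ l₃ * shiftedAiry P.Δξ P.Δη (-P.α * l₃) w) * e1

theorem integral_volNeg_kB_mul_kABC_volume (hP : P.Relations) (v w : ℝ) :
    ∫ x, kB P δ v x * kABC P δ volume x w ∂volNeg = k₇ P δ v w := by
  rw [integral_volNeg, k₇, ← integral_const_mul]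
  congr 1
  ext l
  have e1 : Real.exp (δ * v) = Real.exp (δ * (v + -l)) * Real.exp (δ * l) := by
    rw [← Real.exp_add]; congr 1; ring
  simp_rw [mul_assoc (shiftedAiry P.ξ₁ P.η₁ v l)]
  rw [integral_const_mul, kABC_volume_neg hP, kB, e1, neg_neg]
  ring

theorem integral_volNeg_kB_mul_kABC_volNeg (v w : ℝ) :
    ∫ x, kB P δ v x * kABC P δ volNeg x w ∂volNeg = k₆ P δ v w := by
  rw [integral_volNeg, k₆, ← integral_const_mul]
  congr 1
  ext l
  have e1 : Real.exp (δ * v) = Real.exp (δ * (v + -l)) * Real.exp (δ * l) := by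
    rw [← Real.exp_add]; congr 1; ring
  simp_rw [mul_assoc (shiftedAiry P.ξ₁ P.η₁ v l), integral_const_mul]
  rw [kABC_volNeg_neg, kB, e1, neg_neg]
  simp_rw [mul_assoc (shiftedAiry P.ξ₁ (-P.η₁) l _), integral_const_mul]
  ring

theorem integral_k₄_mul_kBC_volume (hP : P.Relations) (v w : ℝ) :
    ∫ s in Set.Ioi (0 : ℝ), k₄ P δ v s * kBC P δ volume s w = M₂ P v w := by
  have hα := hP.α_pos
  have hα' := hP.α'_pos
  set g : ℝ → ℝ := fun l => shiftedAiry P.ξ₂ (-P.η₂) (v / P.α') l *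
    shiftedAiry P.ξ₂ P.η₂ l (w / P.α') with hg
  have h1 : ∀ s, k₄ P δ v s * kBC P δ volume s w = P.α / P.α' / P.α' * g (P.α / P.α' * s) := by
    intro s
    have e1 : Real.exp (-δ * s) * Real.exp (δ * s) = 1 := by rw [← Real.exp_add]; simp
    have e2 : P.α / P.α' * s = P.α * s / P.α' := by ring
    rw [kBC_volume hP, k₄, e2, hg]
    linear_combination (P.α / P.α' / P.α' *
      shiftedAiry P.ξ₂ (-P.η₂) (v / P.α') (P.α * s / P.α') *
        shiftedAiry P.ξ₂ P.η₂ (P.α * s / P.α') (w / P.α')) * e1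
  simp_rw [h1]
  rw [integral_const_mul, integral_Ioi_comp_mul_left g (by positivity), ← mul_assoc, M₂]
  congr 1
  field_simp

theorem integral_k₄_mul_kBC_volNeg (hP : P.Relations) (v w : ℝ) :
    ∫ s in Set.Ioi (0 : ℝ), k₄ P δ v s * kBC P δ volNeg s w = k₂ P v w := by
  have hα := hP.α_pos
  have hα' := hP.α'_pos
  set g : ℝ → ℝ := fun s => shiftedAiry P.ξ₂ (-P.η₂) (v / P.α') (P.α * s / P.α') *
    ∫ l in Set.Ioi (0 : ℝ), shiftedAiry P.ξ₁ P.η₁ s l * shiftedAiry P.Δξ P.Δη (-P.α * l) w with hg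
  have h1 : ∀ s, k₄ P δ v s * kBC P δ volNeg s w = P.α / P.α' * g s := by
    intro s
    have e1 : Real.exp (-δ * s) * Real.exp (δ * s) = 1 := by rw [← Real.exp_add]; simp
    rw [kBC_volNeg, k₄, hg]
    linear_combination (P.α / P.α' * shiftedAiry P.ξ₂ (-P.η₂) (v / P.α') (P.α * s / P.α') *
      ∫ l in Set.Ioi (0 : ℝ), shiftedAiry P.ξ₁ P.η₁ s l *
        shiftedAiry P.Δξ P.Δη (-P.α * l) w) * e1
  have h2 : k₂ P v w = P.α * ∫ l in Set.Ioi (0 : ℝ), g (P.α' * l) := by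
    rw [k₂]
    congr 2
    ext l
    have e2 : P.α * (P.α' * l) / P.α' = P.α * l := by field_simp
    simp_rw [mul_assoc (shiftedAiry P.ξ₂ (-P.η₂) (v / P.α') (P.α * l))]
    rw [integral_const_mul, hg]
    simp only [e2]
  simp_rw [h1]
  rw [h2, integral_const_mul, integral_Ioi_comp_mul_left _ hα']
  field_simp

namespace KernelBounds

variable {μ : Measure ℝ}

theorem abs_kD_mul_kA_le (h : KernelBounds P δ ε M C) (x : ℝ) {v s : ℝ} (hv : 0 ≤ v)
    (hs : 0 ≤ s) : |kD P δ v x * kA P δ x s| ≤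
      C * C * Real.exp (M * v) * Real.exp (M * s) * Real.exp (-(2 * ε) * |x|) := by
  have hC := h.C_pos
  rw [abs_mul]
  calc |kD P δ v x| * |kA P δ x s|
      ≤ (C * (Real.exp (-ε * |x|) * Real.exp (M * v))) *
        (C * (Real.exp (-ε * |x|) * Real.exp (M * s))) :=
        mul_le_mul (h.kD_le v x hv) (h.kA_le x s hs) (abs_nonneg _) (by positivity)
    _ = _ := by
        have : Real.exp (-(2 * ε) * |x|) = Real.exp (-ε * |x|) * Real.exp (-ε * |x|) := by
          rw [← Real.exp_add]; congr 1; ring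
        rw [this]
        ring

/-- Associativity of the composition of `d`, `a` and `kBC P δ μ`. -/
theorem integral_kD_mul_kABC (h : KernelBounds P δ ε M C) (hP : P.Relations) [SFinite μ]
    (hμ : μ ≤ volume) {v w : ℝ} (hv : 0 ≤ v) (hw : 0 ≤ w) :
    ∫ x, kD P δ v x * kABC P δ μ x w =
      ∫ s in Set.Ioi (0 : ℝ), k₄ P δ v s * kBC P δ μ s w := by
  have hC := h.C_pos
  have hE := expAbsIntegral_nonneg
  have hint : Integrable (Function.uncurry fun x s =>
      kD P δ v x * kA P δ x s * kBC P δ μ s w)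
      (volume.prod (volume.restrict (Set.Ioi (0 : ℝ)))) := by
    have hI := ((integrable_exp_neg_mul_abs (ε := 2 * ε) (by linarith [h.ε_pos])).mul_prod
      integrableOn_exp_neg_Ioi).const_mul
      (C * C * Real.exp (M * v) * (C * expAbsIntegral) * Real.exp (-(M + 1) * w))
    refine hI.mono' (Measurable.aestronglyMeasurable ?_) ?_
    · exact ((measurable_comp₂ continuous_kD.measurable measurable_const measurable_fst).mul
        (measurable_comp₂ continuous_kA.measurable measurable_fst measurable_snd)).mul
        (measurable_comp₂ (measurable_kBC μ) measurable_snd measurable_const)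
    · have hmem : ∀ᵐ s ∂(volume.restrict (Set.Ioi (0 : ℝ))), s ∈ Set.Ioi (0 : ℝ) :=
        ae_restrict_mem measurableSet_Ioi
      have e1 := Measure.quasiMeasurePreserving_snd.ae hmem
        (μa := (volume : Measure ℝ).prod (volume.restrict (Set.Ioi (0 : ℝ))))
      filter_upwards [e1] with z hz
      obtain ⟨x, s⟩ := z
      have hs : 0 ≤ s := le_of_lt hz
      simp only [Function.uncurry]
      rw [norm_mul, Real.norm_eq_abs, Real.norm_eq_abs]
      calc |kD P δ v x * kA P δ x s| * |kBC P δ μ s w|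
          ≤ (C * C * Real.exp (M * v) * Real.exp (M * s) * Real.exp (-(2 * ε) * |x|)) *
            (C * expAbsIntegral * Real.exp (-(M + 1) * s + -(M + 1) * w)) :=
            mul_le_mul (h.abs_kD_mul_kA_le x hv hs) (h.kBC_le hμ hs hw) (abs_nonneg _)
              (by positivity)
        _ = _ := by
            have e4 : Real.exp (-s) = Real.exp (M * s) * Real.exp (-(M + 1) * s) := by
              rw [← Real.exp_add]; congr 1; ring
            rw [Real.exp_add, e4]
            ring
  calc ∫ x, kD P δ v x * kABC P δ μ x w
      = ∫ x, ∫ s in Set.Ioi (0 : ℝ), kD P δ v x * kA P δ x s * kBC P δ μ s w := by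
        congr 1
        ext x
        rw [kABC, ← integral_const_mul]
        simp only [mul_assoc]
    _ = ∫ s in Set.Ioi (0 : ℝ), ∫ x, kD P δ v x * kA P δ x s * kBC P δ μ s w :=
        integral_integral_swap hint
    _ = _ := by
        simp_rw [integral_mul_const, integral_kD_mul_kA hP]

end KernelBounds

end EntriesQ

/-! ### Integration over a direct sum of two sets -/

section Block

variable {A₀ A₁ : Set ℝ}

theorem measurableSet_block (h₀ : MeasurableSet A₀) (h₁ : MeasurableSet A₁) :
    MeasurableSet {p : Fin 2 × ℝ | p.2 ∈ (![A₀, A₁] : Fin 2 → Set ℝ) p.1} := by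
  have : {p : Fin 2 × ℝ | p.2 ∈ (![A₀, A₁] : Fin 2 → Set ℝ) p.1} =
      ({0} : Set (Fin 2)) ×ˢ A₀ ∪ ({1} : Set (Fin 2)) ×ˢ A₁ := by
    ext ⟨i, x⟩
    fin_cases i <;> simp
  rw [this]
  exact ((measurableSet_singleton _).prod h₀).union ((measurableSet_singleton _).prod h₁)

theorem ae_mem_blockMeasure (h₀ : MeasurableSet A₀) (h₁ : MeasurableSet A₁) :
    ∀ᵐ p ∂(blockMeasure ![A₀, A₁]), p ∈ {p : Fin 2 × ℝ | p.2 ∈ (![A₀, A₁] : Fin 2 → Set ℝ) p.1} :=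
  ae_restrict_mem (measurableSet_block h₀ h₁)

theorem blockMeasure_eq_add (h₀ : MeasurableSet A₀) (h₁ : MeasurableSet A₁) :
    blockMeasure ![A₀, A₁] = (volume.restrict A₀).map (Prod.mk (0 : Fin 2)) +
      (volume.restrict A₁).map (Prod.mk (1 : Fin 2)) := by
  ext s hs
  rw [blockMeasure, Measure.restrict_apply hs,
    Measure.prod_apply (hs.inter (measurableSet_block h₀ h₁)), lintegral_count, tsum_fintype,
    Fin.sum_univ_two, Measure.add_apply, Measure.map_apply measurable_prodMk_left hs,
    Measure.map_apply measurable_prodMk_left hs,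
    Measure.restrict_apply (measurable_prodMk_left hs),
    Measure.restrict_apply (measurable_prodMk_left hs)]
  rfl

theorem integrable_blockMeasure {E : Type*} [NormedAddCommGroup E] {f : Fin 2 × ℝ → E}
    (h₀ : MeasurableSet A₀) (h₁ : MeasurableSet A₁) : Integrable f (blockMeasure ![A₀, A₁]) ↔
      IntegrableOn (fun x => f (0, x)) A₀ ∧ IntegrableOn (fun x => f (1, x)) A₁ := by
  rw [blockMeasure_eq_add h₀ h₁, integrable_add_measure,
    (measurableEmbedding_prodMk_left 0).integrable_map_iff,
    (measurableEmbedding_prodMk_left 1).integrable_map_iff]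
  rfl

theorem integral_blockMeasure {f : Fin 2 × ℝ → ℂ} (h₀ : MeasurableSet A₀) (h₁ : MeasurableSet A₁)
    (hf : Integrable f (blockMeasure ![A₀, A₁])) : ∫ p, f p ∂(blockMeasure ![A₀, A₁]) =
      (∫ x in A₀, f (0, x)) + ∫ x in A₁, f (1, x) := by
  rw [blockMeasure_eq_add h₀ h₁] at hf ⊢
  rw [integrable_add_measure] at hf
  rw [integral_add_measure hf.1 hf.2, (measurableEmbedding_prodMk_left 0).integral_map,
    (measurableEmbedding_prodMk_left 1).integral_map]

instance (A : Fin 2 → Set ℝ) : SigmaFinite (blockMeasure A) := by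
  unfold blockMeasure; infer_instance

instance : SigmaFinite measureX := by unfold measureX; infer_instance

instance : SigmaFinite measureY := by unfold measureY; infer_instance

theorem neZero_blockMeasure (h₀ : MeasurableSet A₀) (h₁ : MeasurableSet A₁)
    (h : volume A₁ ≠ 0) : NeZero (blockMeasure ![A₀, A₁]) := by
  refine ⟨fun h0 => h ?_⟩
  have := congrArg (fun m : Measure (Fin 2 × ℝ) => m Set.univ) h0
  simp only [blockMeasure_eq_add h₀ h₁, Measure.add_apply,
    Measure.map_apply measurable_prodMk_left MeasurableSet.univ, Set.preimage_univ,
    Measure.restrict_apply MeasurableSet.univ, Set.univ_inter, Measure.coe_zero, Pi.zero_apply,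
    add_eq_zero] at this
  exact this.2

instance : NeZero measureX :=
  neZero_blockMeasure measurableSet_Iio measurableSet_Ioi (by simp)

instance : NeZero measureY :=
  neZero_blockMeasure measurableSet_Ioi measurableSet_Ioi (by simp)

end Block

/-! ### The two factors -/

section Factors

/-- A measurable kernel in a variable `x` on the line and a variable `v` on the half-line, of size
at most `K exp(-ε |x|) exp(κ v)`. -/
structure ExpBound (ε κ K : ℝ) (L : ℝ → ℝ → ℝ) : Prop where
  measurable : Measurable (Function.uncurry L)
  bound : ∀ x v, 0 ≤ v → |L x v| ≤ K * (Real.exp (-ε * |x|) * Real.exp (κ * v))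

namespace ExpBound

variable {ε κ κ' K K' : ℝ} {L L' : ℝ → ℝ → ℝ}

theorem mono (h : ExpBound ε κ K L) (hK : K ≤ K') : ExpBound ε κ K' L :=
  ⟨h.measurable, fun x v hv => (h.bound x v hv).trans (by gcongr)⟩

theorem abs_mul_le (h : ExpBound ε κ K L) (h' : ExpBound ε κ' K' L') (x y : ℝ) {v w : ℝ}
    (hv : 0 ≤ v) (hw : 0 ≤ w) : |L x v * L' y w| ≤ K * K' *
      (Real.exp (-ε * |x|) * Real.exp (-ε * |y|) * (Real.exp (κ * v) * Real.exp (κ' * w))) := by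
  rw [abs_mul]
  calc |L x v| * |L' y w| ≤ (K * (Real.exp (-ε * |x|) * Real.exp (κ * v))) *
        (K' * (Real.exp (-ε * |y|) * Real.exp (κ' * w))) :=
        mul_le_mul (h.bound x v hv) (h'.bound y w hw) (abs_nonneg _)
          ((abs_nonneg _).trans (h.bound x v hv))
    _ = _ := by ring

theorem integrableOn_mul (h : ExpBound ε κ K L) (h' : ExpBound ε κ' K' L') (hκ : κ + κ' = -1)
    (x y : ℝ) : IntegrableOn (fun v => L x v * L' y v) (Set.Ioi 0) := by
  refine (integrableOn_exp_neg_Ioi.const_mul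
    (K * K' * (Real.exp (-ε * |x|) * Real.exp (-ε * |y|)))).mono'
    (Measurable.aestronglyMeasurable ?_) ((ae_restrict_mem measurableSet_Ioi).mono fun v hv => ?_)
  · exact (measurable_comp₂ h.measurable measurable_const measurable_id).mul
      (measurable_comp₂ h'.measurable measurable_const measurable_id)
  · have hv' : 0 ≤ v := le_of_lt hv
    refine (h.abs_mul_le h' x y hv' hv').trans (le_of_eq ?_)
    have : Real.exp (-v) = Real.exp (κ * v) * Real.exp (κ' * v) := by
      rw [← Real.exp_add, ← add_mul, hκ]; congr 1; ring
    rw [this]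
    ring

theorem integrable_mul (h : ExpBound ε κ K L) (h' : ExpBound ε κ' K' L') (hε : 0 < ε)
    {v w : ℝ} (hv : 0 ≤ v) (hw : 0 ≤ w) : Integrable (fun x => L x v * L' x w) := by
  refine integrable_of_norm_le_exp_neg_abs (κ := 2 * ε)
    (K := K * K' * (Real.exp (κ * v) * Real.exp (κ' * w))) ?_ (by linarith) fun x => ?_
  · exact (measurable_comp₂ h.measurable measurable_id measurable_const).mul
      (measurable_comp₂ h'.measurable measurable_id measurable_const)
  · refine (h.abs_mul_le h' x x hv hw).trans (le_of_eq ?_)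
    have : Real.exp (-(2 * ε) * |x|) = Real.exp (-ε * |x|) * Real.exp (-ε * |x|) := by
      rw [← Real.exp_add]; congr 1; ring
    rw [this]
    ring

end ExpBound

variable (P : Params) (δ : ℝ)

/-- The kernel `c` cut off to the positive half-line. -/
noncomputable def kCpos (x v : ℝ) : ℝ := if 0 < x then kC P δ x v else 0

/-- The kernel `b` cut off to the negative half-line. -/
noncomputable def kBneg (v x : ℝ) : ℝ := if x < 0 then kB P δ v x else 0

/-- The left factor of `K(u)`, a kernel from `Y` to `X`. The first component is
`-a b c + (1 - u⁻¹) (a b 1_{<0} c + 1_{>0} c)`, the second is `-(1 - u⁻¹) a`, and rows over the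
positive half-line are multiplied by `u`. -/
noncomputable def factorF (u : ℂ) (p q : Fin 2 × ℝ) : ℂ :=
  (![1, u] : Fin 2 → ℂ) p.1 *
    if q.1 = 0 then
      -(kABC P δ volume p.2 q.2 : ℂ) + (1 - u⁻¹) * (kABC P δ volNeg p.2 q.2 : ℂ) +
        (1 - u⁻¹) * (kCpos P δ p.2 q.2 : ℂ)
    else -(1 - u⁻¹) * (kA P δ p.2 q.2 : ℂ)

/-- The right factor of `K(u)`, a kernel from `X` to `Y`, with components `d` and `b 1_{<0}`. -/
noncomputable def factorG (q p : Fin 2 × ℝ) : ℂ :=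
  if q.1 = 0 then (kD P δ q.2 p.2 : ℂ) else (kBneg P δ q.2 p.2 : ℂ)

variable {P δ} {ε M C : ℝ}

namespace KernelBounds

/-- A common constant in the bounds for all blocks of the two factors. -/
noncomputable def constant (_h : KernelBounds P δ ε M C) : ℝ := C * (C * expAbsIntegral) + C

variable (h : KernelBounds P δ ε M C)

theorem C_le_constant : C ≤ h.constant := by
  have := h.C_pos
  have := expAbsIntegral_nonneg
  have : 0 ≤ C * (C * expAbsIntegral) := by positivity
  unfold constant
  linarith

theorem constant_pos : 0 < h.constant := h.C_pos.trans_le h.C_le_constant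

theorem expBound_kABC {μ : Measure ℝ} [SFinite μ] (hμ : μ ≤ volume) :
    ExpBound ε (-(M + 1)) h.constant (kABC P δ μ) :=
  ExpBound.mono ⟨measurable_kABC μ, fun x _ hv => h.kABC_le hμ x hv⟩
    (by unfold constant; linarith [h.C_pos])

theorem expBound_kA : ExpBound ε M h.constant (kA P δ) :=
  ExpBound.mono ⟨continuous_kA.measurable, h.kA_le⟩ h.C_le_constant

theorem expBound_kD : ExpBound ε M h.constant (fun x v => kD P δ v x) :=
  ExpBound.mono ⟨measurable_comp₂ continuous_kD.measurable measurable_snd measurable_fst,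
    fun x v hv => h.kD_le v x hv⟩ h.C_le_constant

theorem expBound_kCpos : ExpBound ε (-(M + 1)) h.constant (kCpos P δ) := by
  refine ExpBound.mono ⟨?_, fun x v hv => ?_⟩ h.C_le_constant
  · exact Measurable.ite (measurableSet_lt measurable_const measurable_fst)
      continuous_kC.measurable measurable_const
  · have := h.C_pos
    unfold kCpos
    split_ifs with hx
    · exact h.kC_le x v hv hx.le
    · rw [abs_zero]; positivity

theorem expBound_kBneg : ExpBound ε (-(M + 1)) h.constant (fun x v => kBneg P δ v x) := by
  refine ExpBound.mono ⟨?_, fun x v hv => ?_⟩ h.C_le_constant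
  · exact Measurable.ite (measurableSet_lt measurable_fst measurable_const)
      (measurable_comp₂ continuous_kB.measurable measurable_snd measurable_fst) measurable_const
  · have := h.C_pos
    simp only [kBneg]
    split_ifs with hx
    · exact h.kB_le v x hv hx.le
    · rw [abs_zero]; positivity

end KernelBounds

/-- The support of `measureX`. -/
def supportX : Set (Fin 2 × ℝ) := {p | p.2 ∈ (![Set.Iio 0, Set.Ioi 0] : Fin 2 → Set ℝ) p.1}

/-- The support of `measureY`. -/
def supportY : Set (Fin 2 × ℝ) := {p | p.2 ∈ (![Set.Ioi 0, Set.Ioi 0] : Fin 2 → Set ℝ) p.1}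

theorem pos_of_mem_supportY {q : Fin 2 × ℝ} (hq : q ∈ supportY) : 0 < q.2 := by
  obtain ⟨j, v⟩ := q
  fin_cases j <;> exact hq

theorem measurable_factorF (u : ℂ) (h : KernelBounds P δ ε M C) :
    Measurable (Function.uncurry (factorF P δ u)) := by
  have hm : ∀ {L : ℝ → ℝ → ℝ}, Measurable (Function.uncurry L) →
      Measurable fun z : (Fin 2 × ℝ) × (Fin 2 × ℝ) => (L z.1.2 z.2.2 : ℂ) := fun hL =>
    Complex.measurable_ofReal.comp (measurable_comp₂ hL measurable_fst.snd measurable_snd.snd)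
  refine ((measurable_of_countable (![1, u] : Fin 2 → ℂ)).comp measurable_fst.fst).mul
    (Measurable.ite (measurableSet_eq_fun measurable_snd.fst measurable_const) ?_ ?_)
  · exact ((hm (measurable_kABC volume)).neg.add ((hm (measurable_kABC volNeg)).const_mul _)).add
      ((hm h.expBound_kCpos.measurable).const_mul _)
  · exact (hm continuous_kA.measurable).const_mul _

theorem measurable_factorG (h : KernelBounds P δ ε M C) :
    Measurable (Function.uncurry (factorG P δ)) := by
  have hm : ∀ {L : ℝ → ℝ → ℝ}, Measurable (Function.uncurry L) →
      Measurable fun z : (Fin 2 × ℝ) × (Fin 2 × ℝ) => (L z.2.2 z.1.2 : ℂ) := fun hL =>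
    Complex.measurable_ofReal.comp (measurable_comp₂ hL measurable_snd.snd measurable_fst.snd)
  exact Measurable.ite (measurableSet_eq_fun measurable_fst.fst measurable_const)
    (hm h.expBound_kD.measurable) (hm h.expBound_kBneg.measurable)

/-- The decay rates of the components on `Y`: `factorF` has rates `(-(M + 1), M)` and `factorG` the
opposite ones, so that products decay at rate `1`. -/
noncomputable def weightY (M : ℝ) (j : Fin 2) (q : Fin 2 × ℝ) : ℝ :=
  if q.1 = j then Real.exp (-(M + 1) * q.2) else Real.exp (M * q.2)

theorem weightY_pos (M : ℝ) (j : Fin 2) (q : Fin 2 × ℝ) : 0 < weightY M j q := by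
  unfold weightY; split_ifs <;> exact Real.exp_pos _

/-- The factors `F` and `G` form a dominated pair, uniformly for `u` in the annulus
`ρ⁻¹ ≤ |u| ≤ ρ`. -/
theorem dominatedPair_factor (h : KernelBounds P δ ε M C) {ρ : ℝ} (hρ : 1 ≤ ρ) {u : ℂ}
    (hu : ‖u‖ ≤ ρ) (hu' : ‖u⁻¹‖ ≤ ρ) :
    DominatedPair measureX measureY supportX supportY
      (fun p => ρ * (3 * (1 + ρ) * h.constant) * Real.exp (-ε * |p.2|))
      (fun p => h.constant * Real.exp (-ε * |p.2|)) (weightY M 0) (weightY M 1)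
      (factorF P δ u) (factorG P δ) := by
  have hK := h.constant_pos
  have hρ0 : 0 < ρ := by linarith
  have hq : ‖1 - u⁻¹‖ ≤ 1 + ρ := (norm_sub_le _ _).trans (by rw [norm_one]; linarith)
  have hw : ∀ i, ‖(![1, u] : Fin 2 → ℂ) i‖ ≤ ρ := by
    intro i
    fin_cases i
    · simpa using hρ
    · simpa using hu
  refine ⟨measurable_factorF u h, measurable_factorG h,
    ae_mem_blockMeasure measurableSet_Iio measurableSet_Ioi,
    ae_mem_blockMeasure measurableSet_Ioi measurableSet_Ioi, fun p => by positivity,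
    fun p => by positivity, weightY_pos M 0, weightY_pos M 1, ?_, ?_, fun p _ q hq' => ?_,
    fun q hq' p _ => ?_⟩
  · have hI := (integrable_exp_neg_mul_abs (ε := 2 * ε) (by linarith [h.ε_pos])).const_mul
      (ρ * (3 * (1 + ρ) * h.constant) * h.constant)
    have hI' : Integrable fun x : ℝ => ρ * (3 * (1 + ρ) * h.constant) * Real.exp (-ε * |x|) *
        (h.constant * Real.exp (-ε * |x|)) := by
      refine hI.congr (Filter.Eventually.of_forall fun x => ?_)
      have : Real.exp (-(2 * ε) * |x|) = Real.exp (-ε * |x|) * Real.exp (-ε * |x|) := by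
        rw [← Real.exp_add]; congr 1; ring
      simp only [this]
      ring
    exact (integrable_blockMeasure measurableSet_Iio measurableSet_Ioi).2
      ⟨hI'.integrableOn, hI'.integrableOn⟩
  · refine (integrable_blockMeasure measurableSet_Ioi measurableSet_Ioi).2 ⟨?_, ?_⟩
    · refine integrableOn_exp_neg_Ioi.congr_fun (fun v _ => ?_) measurableSet_Ioi
      simp only [weightY, if_true, zero_ne_one, if_false]
      rw [← Real.exp_add]; congr 1; ring
    · refine integrableOn_exp_neg_Ioi.congr_fun (fun v _ => ?_) measurableSet_Ioi
      simp only [weightY, if_true, one_ne_zero, if_false]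
      rw [← Real.exp_add]; congr 1; ring
  · obtain ⟨j, v⟩ := q
    obtain ⟨i, x⟩ := p
    have hv : 0 ≤ v := (pos_of_mem_supportY hq').le
    simp only [factorF, weightY, norm_mul]
    rw [mul_assoc ρ, mul_assoc ρ]
    refine mul_le_mul (hw i) ?_ (norm_nonneg _) hρ0.le
    split_ifs with hj
    · have b1 := (h.expBound_kABC le_rfl).bound x v hv
      have b2 := (h.expBound_kABC volNeg_le).bound x v hv
      have b3 := h.expBound_kCpos.bound x v hv
      set e := h.constant * (Real.exp (-ε * |x|) * Real.exp (-(M + 1) * v)) with he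
      have he0 : 0 ≤ e := by positivity
      calc ‖-(kABC P δ volume x v : ℂ) + (1 - u⁻¹) * (kABC P δ volNeg x v : ℂ) +
            (1 - u⁻¹) * (kCpos P δ x v : ℂ)‖
          ≤ |kABC P δ volume x v| + ‖1 - u⁻¹‖ * |kABC P δ volNeg x v| +
            ‖1 - u⁻¹‖ * |kCpos P δ x v| := by
            refine (norm_add₃_le).trans (le_of_eq ?_)
            simp
        _ ≤ e + (1 + ρ) * e + (1 + ρ) * e := by gcongr
        _ ≤ 3 * (1 + ρ) * e := by nlinarith
        _ = _ := by rw [he]; ring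
    · have b1 := h.expBound_kA.bound x v hv
      set e := h.constant * (Real.exp (-ε * |x|) * Real.exp (M * v)) with he
      have he0 : 0 ≤ e := by positivity
      calc ‖-(1 - u⁻¹) * (kA P δ x v : ℂ)‖ = ‖1 - u⁻¹‖ * |kA P δ x v| := by
            rw [norm_mul, norm_neg, Complex.norm_real, Real.norm_eq_abs]
        _ ≤ (1 + ρ) * e := by gcongr
        _ ≤ 3 * (1 + ρ) * e := by nlinarith
        _ = _ := by rw [he]; ring
  · obtain ⟨j, v⟩ := q
    obtain ⟨i, x⟩ := p
    have hv : 0 ≤ v := (pos_of_mem_supportY hq').le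
    simp only [factorG, weightY]
    fin_cases j
    · simp only [Fin.zero_eta, if_true, zero_ne_one, if_false, Complex.norm_real]
      exact (h.expBound_kD.bound x v hv).trans (le_of_eq (by ring))
    · simp only [Fin.mk_one, if_true, one_ne_zero, if_false, Complex.norm_real]
      exact (h.expBound_kBneg.bound x v hv).trans (le_of_eq (by ring))

end Factors

/-! ### Identification of `K(u)` and `Q(u)` with the two products of the factors -/

section Identification

variable {P : Params} {δ ε M C : ℝ}

theorem integral_ofReal_lincomb {μ : Measure ℝ} {f₁ f₂ f₃ : ℝ → ℝ} (h₁ : Integrable f₁ μ)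
    (h₂ : Integrable f₂ μ) (h₃ : Integrable f₃ μ) (c₁ c₂ c₃ : ℂ) :
    ∫ x, (c₁ * (f₁ x : ℂ) + c₂ * (f₂ x : ℂ) + c₃ * (f₃ x : ℂ)) ∂μ =
      c₁ * ((∫ x, f₁ x ∂μ : ℝ) : ℂ) + c₂ * ((∫ x, f₂ x ∂μ : ℝ) : ℂ) +
        c₃ * ((∫ x, f₃ x ∂μ : ℝ) : ℂ) := by
  have i₁ := h₁.ofReal (𝕜 := ℂ) |>.const_mul c₁
  have i₂ := h₂.ofReal (𝕜 := ℂ) |>.const_mul c₂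
  have i₃ := h₃.ofReal (𝕜 := ℂ) |>.const_mul c₃
  simp only [RCLike.ofReal_eq_complex_ofReal] at i₁ i₂ i₃
  have i₁₂ : Integrable (fun x => c₁ * (f₁ x : ℂ) + c₂ * (f₂ x : ℂ)) μ := i₁.add i₂
  rw [integral_add i₁₂ i₃, integral_add i₁ i₂, integral_const_mul, integral_const_mul,
    integral_const_mul, integral_complex_ofReal, integral_complex_ofReal, integral_complex_ofReal]

theorem integral_Ioi_eq_sub {f : ℝ → ℝ} (hf : Integrable f) :
    ∫ x in Set.Ioi (0 : ℝ), f x = (∫ x, f x) - ∫ x, f x ∂volNeg := by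
  have h1 := integral_add_compl (measurableSet_Iic (a := (0 : ℝ))) hf
  rw [Set.compl_Iic, integral_Iic_eq_integral_Iio] at h1
  rw [volNeg]
  linarith

/-- `R(u) = -a b c d + (1 - u⁻¹) (a b 1_{<0} c d + 1_{>0} c d - a b 1_{<0})`. -/
theorem R_eq (h : KernelBounds P δ ε M C) (u : ℂ) (x y : ℝ) : R P δ u x y =
    -((∫ w in Set.Ioi (0 : ℝ), kABC P δ volume x w * kD P δ w y : ℝ) : ℂ) +
      (1 - u⁻¹) * ((∫ w in Set.Ioi (0 : ℝ), kABC P δ volNeg x w * kD P δ w y : ℝ) : ℂ) +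
      (1 - u⁻¹) * ((∫ w in Set.Ioi (0 : ℝ), kCpos P δ x w * kD P δ w y : ℝ) : ℂ) -
      (1 - u⁻¹) * ((∫ w in Set.Ioi (0 : ℝ), kA P δ x w * kBneg P δ w y : ℝ) : ℂ) := by
  have e1 : ∫ w in Set.Ioi (0 : ℝ), kCpos P δ x w * kD P δ w y =
      if 0 < x then S₂ P δ x y else 0 := by
    simp only [kCpos]
    split_ifs
    · rw [S₂_eq_integral]
    · simp
  have e2 : ∫ w in Set.Ioi (0 : ℝ), kA P δ x w * kBneg P δ w y =
      if y < 0 then S₃ P δ x y else 0 := by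
    simp only [kBneg]
    split_ifs
    · rw [S₃_eq_integral]
    · simp
  have e3 := integral_Ioi_eq_sub (h.integrable_S₃_mul_S₂ x y)
  have e4 : T₁ P δ x y = ∫ s, S₃ P δ x s * S₂ P δ s y ∂volNeg := T₁_eq_integral x y
  have e5 : S₁ P δ x y = T₁ P δ x y - ∫ s, S₃ P δ x s * S₂ P δ s y := by
    rw [S₁_eq_integral, e3, e4]; ring
  rw [e1, e2, ← h.integral_S₃_mul_S₂ le_rfl, ← h.integral_S₃_mul_S₂ volNeg_le, ← e4, R, S, T, e5]
  push_cast
  ring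

theorem dominatedPair_factor_self (h : KernelBounds P δ ε M C) (u : ℂ) :
    DominatedPair measureX measureY supportX supportY
      (fun p => (1 + ‖u‖ + ‖u⁻¹‖) * (3 * (1 + (1 + ‖u‖ + ‖u⁻¹‖)) * h.constant) *
        Real.exp (-ε * |p.2|))
      (fun p => h.constant * Real.exp (-ε * |p.2|)) (weightY M 0) (weightY M 1)
      (factorF P δ u) (factorG P δ) :=
  dominatedPair_factor h (by linarith [norm_nonneg u, norm_nonneg u⁻¹])
    (by linarith [norm_nonneg u⁻¹]) (by linarith [norm_nonneg u])

/-- `K(u) = F G`. -/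
theorem kernelComp_factor_eq_K (h : KernelBounds P δ ε M C) {u : ℂ} {p q : Fin 2 × ℝ}
    (hp : p ∈ supportX) (hq : q ∈ supportX) :
    kernelComp measureY (factorF P δ u) (factorG P δ) p q = blockKernel (K P δ u) p q := by
  have hpair := dominatedPair_factor_self h u
  have hint := hpair.integrable_mul hp hq
  obtain ⟨i, x⟩ := p
  obtain ⟨j, y⟩ := q
  have hblock : blockKernel (K P δ u) (i, x) (j, y) =
      (![1, u] : Fin 2 → ℂ) i * R P δ u x y := by
    fin_cases i <;> fin_cases j <;> simp [blockKernel, K]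
  rw [hblock, R_eq h, kernelComp, measureY,
    integral_blockMeasure measurableSet_Ioi measurableSet_Ioi hint]
  have e1 : ∫ v in Set.Ioi (0 : ℝ), factorF P δ u (i, x) (0, v) * factorG P δ (0, v) (j, y) =
      (![1, u] : Fin 2 → ℂ) i *
        (-((∫ w in Set.Ioi (0 : ℝ), kABC P δ volume x w * kD P δ w y : ℝ) : ℂ) +
        (1 - u⁻¹) * ((∫ w in Set.Ioi (0 : ℝ), kABC P δ volNeg x w * kD P δ w y : ℝ) : ℂ) +
        (1 - u⁻¹) * ((∫ w in Set.Ioi (0 : ℝ), kCpos P δ x w * kD P δ w y : ℝ) : ℂ)) := by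
    have hM : -(M + 1) + M = -1 := by ring
    have := integral_ofReal_lincomb
      ((h.expBound_kABC le_rfl).integrableOn_mul h.expBound_kD hM x y)
      ((h.expBound_kABC volNeg_le).integrableOn_mul h.expBound_kD hM x y)
      (h.expBound_kCpos.integrableOn_mul h.expBound_kD hM x y) (-1) (1 - u⁻¹) (1 - u⁻¹)
    rw [neg_one_mul] at this
    rw [← this, ← integral_const_mul]
    congr 1
    ext v
    simp only [factorF, factorG, if_true]
    push_cast
    ring
  have e2 : ∫ v in Set.Ioi (0 : ℝ), factorF P δ u (i, x) (1, v) * factorG P δ (1, v) (j, y) =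
      (![1, u] : Fin 2 → ℂ) i *
        (-(1 - u⁻¹) * ((∫ w in Set.Ioi (0 : ℝ), kA P δ x w * kBneg P δ w y : ℝ) : ℂ)) := by
    rw [← integral_complex_ofReal, ← integral_const_mul, ← integral_const_mul]
    congr 1
    ext v
    simp only [factorF, factorG, one_ne_zero, if_false]
    push_cast
    ring
  rw [e1, e2]
  ring

/-- `Q(u) = G F`. -/
theorem kernelComp_factor_eq_Q (h : KernelBounds P δ ε M C) (hP : P.Relations) {u : ℂ}
    (hu : u ≠ 0) {p q : Fin 2 × ℝ} (hp : p ∈ supportY) (hq : q ∈ supportY) :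
    kernelComp measureX (factorG P δ) (factorF P δ u) p q = blockKernel (Q P δ u) p q := by
  have hpair := dominatedPair_factor_self h u
  have hint := hpair.symm.integrable_mul hp hq
  have hv := (pos_of_mem_supportY hp).le
  have hw := (pos_of_mem_supportY hq).le
  obtain ⟨i, v⟩ := p
  obtain ⟨j, w⟩ := q
  simp only at hv hw
  rw [kernelComp, measureX, integral_blockMeasure measurableSet_Iio measurableSet_Ioi hint]
  -- the cut-offs act trivially on one half-line and annihilate the other one
  have cneg : ∀ x ∈ Set.Iio (0 : ℝ), kCpos P δ x w = 0 := fun x hx =>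
    if_neg (not_lt.2 (le_of_lt hx))
  have bneg : ∀ x ∈ Set.Iio (0 : ℝ), kBneg P δ v x = kB P δ v x := fun x hx => if_pos hx
  have bpos : ∀ x ∈ Set.Ioi (0 : ℝ), kBneg P δ v x = 0 := fun x hx =>
    if_neg (not_lt.2 (le_of_lt hx))
  have uq : u * (1 - u⁻¹) = u - 1 := by rw [mul_sub, mul_inv_cancel₀ hu, mul_one]
  have hε := h.ε_pos
  fin_cases i
  · have i1 := h.expBound_kD.integrable_mul (h.expBound_kABC le_rfl) hε hv hw
    have i2 := h.expBound_kD.integrable_mul (h.expBound_kABC volNeg_le) hε hv hw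
    have i3 := h.expBound_kD.integrable_mul h.expBound_kCpos hε hv hw
    have i4 := h.expBound_kD.integrable_mul h.expBound_kA hε hv hw
    fin_cases j
    · have e0 : ∀ x, factorG P δ (0, v) (0, x) * factorF P δ u (0, x) (0, w) =
          -1 * ((kD P δ v x * kABC P δ volume x w : ℝ) : ℂ) +
          (1 - u⁻¹) * ((kD P δ v x * kABC P δ volNeg x w : ℝ) : ℂ) +
          (1 - u⁻¹) * ((kD P δ v x * kCpos P δ x w : ℝ) : ℂ) := fun x => by
        simp only [factorF, factorG, if_true, Matrix.cons_val_zero]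
        push_cast
        ring
      have e1 : ∀ x, factorG P δ (0, v) (1, x) * factorF P δ u (1, x) (0, w) =
          -u * ((kD P δ v x * kABC P δ volume x w : ℝ) : ℂ) +
          (u - 1) * ((kD P δ v x * kABC P δ volNeg x w : ℝ) : ℂ) +
          (u - 1) * ((kD P δ v x * kCpos P δ x w : ℝ) : ℂ) := fun x => by
        simp only [factorF, factorG, if_true, Matrix.cons_val_one]
        rw [← uq]
        push_cast
        ring
      have z3 : ∫ x in Set.Iio (0 : ℝ), kD P δ v x * kCpos P δ x w = 0 := by
        rw [setIntegral_congr_fun measurableSet_Iio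
          (g := fun _ => (0 : ℝ)) fun x hx => by simp only [cneg x hx, mul_zero]]
        simp
      have z4 : ∫ x in Set.Ioi (0 : ℝ), kD P δ v x * kCpos P δ x w = M₃ P v w := by
        rw [← integral_kD_mul_kC (δ := δ) hP]
        exact setIntegral_congr_fun measurableSet_Ioi fun x hx => by
          simp only [kCpos, if_pos (Set.mem_Ioi.1 hx)]
      have z1 : ∫ x in Set.Iio (0 : ℝ), kD P δ v x * kABC P δ volume x w = k₅ P v w :=
        integral_volNeg_kD_mul_kABC_volume hP v w
      have z2 : ∫ x in Set.Iio (0 : ℝ), kD P δ v x * kABC P δ volNeg x w = k₁ P v w :=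
        integral_volNeg_kD_mul_kABC_volNeg v w
      simp only [Fin.zero_eta]
      simp_rw [e0, e1]
      rw [integral_ofReal_lincomb i1.integrableOn i2.integrableOn i3.integrableOn,
        integral_ofReal_lincomb i1.integrableOn i2.integrableOn i3.integrableOn,
        integral_Ioi_eq_sub i1, integral_Ioi_eq_sub i2, z1, z2, z3, z4,
        h.integral_kD_mul_kABC hP le_rfl hv hw, h.integral_kD_mul_kABC hP volNeg_le hv hw,
        integral_k₄_mul_kBC_volume hP, integral_k₄_mul_kBC_volNeg hP,
        integral_volNeg_kD_mul_kABC_volume hP, integral_volNeg_kD_mul_kABC_volNeg]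
      simp only [blockKernel, Q, Q₁₁, Matrix.of_apply, Matrix.cons_val_zero]
      push_cast
      ring
    · have e0 : ∀ x, factorG P δ (0, v) (0, x) * factorF P δ u (0, x) (1, w) =
          -(1 - u⁻¹) * ((kD P δ v x * kA P δ x w : ℝ) : ℂ) := fun x => by
        simp only [factorF, factorG, if_true, one_ne_zero, if_false, Matrix.cons_val_zero]
        push_cast
        ring
      have e1 : ∀ x, factorG P δ (0, v) (1, x) * factorF P δ u (1, x) (1, w) =
          (1 - u) * ((kD P δ v x * kA P δ x w : ℝ) : ℂ) := fun x => by
        simp only [factorF, factorG, if_true, one_ne_zero, if_false, Matrix.cons_val_one]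
        push_cast
        linear_combination (-(kD P δ v x : ℂ) * kA P δ x w) * uq
      have z1 : ∫ x in Set.Iio (0 : ℝ), kD P δ v x * kA P δ x w = k₃ P δ v w :=
        integral_volNeg_kD_mul_kA v w
      simp only [Fin.zero_eta, Fin.mk_one]
      simp_rw [e0, e1]
      rw [integral_const_mul, integral_const_mul, integral_complex_ofReal,
        integral_complex_ofReal, integral_Ioi_eq_sub i4, z1, integral_kD_mul_kA hP,
        integral_volNeg_kD_mul_kA]
      simp only [blockKernel, Q, Q₁₂, Matrix.of_apply, Matrix.cons_val_zero, Matrix.cons_val_one]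
      push_cast
      ring
  · have i1 := h.expBound_kBneg.integrable_mul (h.expBound_kABC le_rfl) hε hv hw
    have i2 := h.expBound_kBneg.integrable_mul (h.expBound_kABC volNeg_le) hε hv hw
    have z0 : ∀ j : Fin 2, ∫ x in Set.Ioi (0 : ℝ),
        factorG P δ (1, v) (1, x) * factorF P δ u (1, x) (j, w) = 0 := fun j => by
      rw [setIntegral_congr_fun measurableSet_Ioi (g := fun _ => (0 : ℂ)) fun x hx => by
        simp [factorG, bpos x hx]]
      simp
    have zB : ∀ L : ℝ → ℝ, ∫ x in Set.Iio (0 : ℝ), kBneg P δ v x * L x =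
        ∫ x, kB P δ v x * L x ∂volNeg := fun L =>
      setIntegral_congr_fun measurableSet_Iio fun x hx => by simp only [bneg x hx]
    simp only [Fin.mk_one]
    rw [z0, add_zero]
    fin_cases j
    · have e0 : Set.EqOn (fun x => factorG P δ (1, v) (0, x) * factorF P δ u (0, x) (0, w))
          (fun x => -1 * ((kBneg P δ v x * kABC P δ volume x w : ℝ) : ℂ) +
          (1 - u⁻¹) * ((kBneg P δ v x * kABC P δ volNeg x w : ℝ) : ℂ) +
          0 * ((kBneg P δ v x * kABC P δ volNeg x w : ℝ) : ℂ)) (Set.Iio 0) := fun x hx => by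
        simp only [factorF, factorG, if_true, one_ne_zero, if_false, Matrix.cons_val_zero,
          cneg x hx]
        push_cast
        ring
      simp only [Fin.zero_eta]
      rw [setIntegral_congr_fun measurableSet_Iio e0,
        integral_ofReal_lincomb i1.integrableOn i2.integrableOn i2.integrableOn,
        zB (fun x => kABC P δ volume x w), zB (fun x => kABC P δ volNeg x w),
        integral_volNeg_kB_mul_kABC_volume hP, integral_volNeg_kB_mul_kABC_volNeg]
      simp only [blockKernel, Q, Q₂₁, Matrix.of_apply, Matrix.cons_val_zero, Matrix.cons_val_one]
      ring
    · have e0 : ∀ x, factorG P δ (1, v) (0, x) * factorF P δ u (0, x) (1, w) =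
          -(1 - u⁻¹) * ((kBneg P δ v x * kA P δ x w : ℝ) : ℂ) := fun x => by
        simp only [factorF, factorG, one_ne_zero, if_false, Matrix.cons_val_zero]
        push_cast
        ring
      simp only [Fin.mk_one]
      simp_rw [e0]
      rw [integral_const_mul, integral_complex_ofReal, zB (fun x => kA P δ x w),
        integral_volNeg_kB_mul_kA]
      change _ = Q₂₂ P δ u v w
      rw [Q₂₂]
      ring

end Identification

/-! ### The Fredholm determinants as functions of `u` and `δ` -/

section Determinants

variable {P : Params} {δ ε M C : ℝ}

theorem fredholmConverges_K (h : KernelBounds P δ ε M C) (u : ℂ) :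
    FredholmConverges measureX (blockKernel (K P δ u)) :=
  have hpair := dominatedPair_factor_self h u
  hpair.dominated.fredholmConverges.congr hpair.ae_mem_X fun _ hp _ hq =>
    kernelComp_factor_eq_K h hp hq

theorem fredholmConverges_Q (h : KernelBounds P δ ε M C) (hP : P.Relations) {u : ℂ} (hu : u ≠ 0) :
    FredholmConverges measureY (blockKernel (Q P δ u)) :=
  have hpair := dominatedPair_factor_self h u
  hpair.symm.dominated.fredholmConverges.congr hpair.ae_mem_Y fun _ hp _ hq =>
    kernelComp_factor_eq_Q h hP hu hp hq

theorem detK_eq_fredholmDet (h : KernelBounds P δ ε M C) (u : ℂ) :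
    detK P δ u = fredholmDet measureX (kernelComp measureY (factorF P δ u) (factorG P δ)) :=
  tsum_congr fun n => (fredholmTerm_congr (dominatedPair_factor_self h u).ae_mem_X
    (fun _ hp _ hq => kernelComp_factor_eq_K h hp hq) n).symm

theorem detK_eq_detQ (h : KernelBounds P δ ε M C) (hP : P.Relations) {u : ℂ} (hu : u ≠ 0) :
    detK P δ u = detQ P δ u := by
  have hpair := dominatedPair_factor_self h u
  rw [detK_eq_fredholmDet h]
  exact tsum_congr fun n => (hpair.fredholmTerm_comm n).trans
    (fredholmTerm_congr hpair.ae_mem_Y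
      (fun _ hp _ hq => kernelComp_factor_eq_Q h hP hu hp hq) n)

theorem differentiableOn_detK (h : KernelBounds P δ ε M C) :
    DifferentiableOn ℂ (detK P δ) {0}ᶜ := by
  intro u₀ hu₀
  have hu₀' : 0 < ‖u₀‖ := norm_pos_iff.2 hu₀
  -- an annulus around `u₀` on which the kernels are uniformly dominated
  set ρ := 1 + ‖u₀‖ + ‖u₀‖⁻¹ with hρ
  have hinv : 0 < ‖u₀‖⁻¹ := inv_pos.2 hu₀'
  set U : Set ℂ := {u | ‖u‖ < ρ} ∩ {u | 1 < ρ * ‖u‖} with hU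
  have hUo : IsOpen U := (isOpen_lt continuous_norm continuous_const).inter
    (isOpen_lt continuous_const (by fun_prop))
  have hmem : u₀ ∈ U := by
    refine ⟨by simp only [Set.mem_ofPred_eq, hρ]; linarith, ?_⟩
    have : ‖u₀‖⁻¹ * ‖u₀‖ = 1 := inv_mul_cancel₀ hu₀'.ne'
    simp only [Set.mem_ofPred_eq, hρ]
    nlinarith
  have hU0 : ∀ u ∈ U, u ≠ 0 := by
    rintro u ⟨-, hu⟩ rfl
    simp only [Set.mem_ofPred_eq, norm_zero, mul_zero] at hu
    linarith
  have hdom : ∀ u ∈ U, DominatedPair measureX measureY supportX supportY _ _ _ _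
      (factorF P δ u) (factorG P δ) := fun u hu =>
    dominatedPair_factor h (ρ := ρ) (by linarith) (le_of_lt hu.1) (by
      rw [norm_inv]
      exact inv_le_of_inv_le₀ (by linarith) (by
        rw [inv_le_iff_one_le_mul₀ (by linarith), mul_comm]
        exact le_of_lt hu.2))
  have hdiff : DifferentiableOn ℂ (fun u => fredholmDet measureX
      (kernelComp measureY (factorF P δ u) (factorG P δ))) U := by
    refine differentiableOn_fredholmDet hUo (fun u hu => (hdom u hu).dominated) fun p hp q hq => ?_
    refine DifferentiableOn.congr (f := fun u => (![1, u] : Fin 2 → ℂ) p.1 *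
      ((S P δ p.2 q.2 : ℂ) + u⁻¹ * (T P δ p.2 q.2 : ℂ))) ?_ fun u hu => ?_
    · have h1 : DifferentiableOn ℂ (fun u : ℂ => (![1, u] : Fin 2 → ℂ) p.1) U := by
        obtain ⟨i, x⟩ := p
        fin_cases i
        · exact differentiableOn_const 1
        · exact differentiableOn_id
      have h2 : DifferentiableOn ℂ (fun u : ℂ => u⁻¹) U :=
        differentiableOn_id.inv fun u hu => hU0 u hu
      exact h1.mul ((h2.mul_const _).const_add _)
    · rw [kernelComp_factor_eq_K h hp hq]
      obtain ⟨i, x⟩ := p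
      obtain ⟨j, y⟩ := q
      fin_cases i <;> fin_cases j <;> simp [blockKernel, K, R]
  have hdet : DifferentiableOn ℂ (detK P δ) U :=
    hdiff.congr fun u _ => detK_eq_fredholmDet h u
  exact ((hdet u₀ hmem).differentiableAt (hUo.mem_nhds hmem)).differentiableWithinAt

theorem R_eq_exp_mul (u : ℂ) (x y : ℝ) : R P δ u x y =
    Complex.exp (-δ * x) * R P 0 u x y * Complex.exp (δ * y) := by
  have h1 : ∀ x y, S₁ P δ x y = Real.exp (δ * (y - x)) * S₁ P 0 x y := fun x y => by
    have e : Real.exp ((P.η₁ - δ) * x + (δ - P.α * P.Δη) * y) = Real.exp (δ * (y - x)) *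
        Real.exp ((P.η₁ - 0) * x + (0 - P.α * P.Δη) * y) := by
      rw [← Real.exp_add]; congr 1; ring
    rw [S₁, S₁, e]; ring
  have h2 : ∀ x y, T₁ P δ x y = Real.exp (δ * (y - x)) * T₁ P 0 x y := fun x y => by
    have e : Real.exp ((P.η₁ - δ) * x + (δ - P.α * P.Δη) * y) = Real.exp (δ * (y - x)) *
        Real.exp ((P.η₁ - 0) * x + (0 - P.α * P.Δη) * y) := by
      rw [← Real.exp_add]; congr 1; ring
    rw [T₁, T₁, e]; ring
  have h3 : ∀ x y, S₂ P δ x y = Real.exp (δ * (y - x)) * S₂ P 0 x y := fun x y => by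
    have e : Real.exp ((δ - P.α * P.Δη) * (y - x)) = Real.exp (δ * (y - x)) *
        Real.exp ((0 - P.α * P.Δη) * (y - x)) := by
      rw [← Real.exp_add]; congr 1; ring
    rw [S₂, S₂, e]; ring
  have h4 : ∀ x y, S₃ P δ x y = Real.exp (δ * (y - x)) * S₃ P 0 x y := fun x y => by
    have e : Real.exp ((δ - P.η₁) * (y - x)) = Real.exp (δ * (y - x)) *
        Real.exp ((0 - P.η₁) * (y - x)) := by
      rw [← Real.exp_add]; congr 1; ring
    rw [S₃, S₃, e]; ring
  have hS : S P δ x y = Real.exp (δ * (y - x)) * S P 0 x y := by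
    rw [S, S, h1, h3, h4]
    split_ifs <;> ring
  have hT : T P δ x y = Real.exp (δ * (y - x)) * T P 0 x y := by
    rw [T, T, h2, h3, h4]
    split_ifs <;> ring
  have he : Complex.exp (-δ * x) * Complex.exp (δ * y) = (Real.exp (δ * (y - x)) : ℂ) := by
    rw [← Complex.exp_add, Complex.ofReal_exp]
    congr 1
    push_cast
    ring
  rw [R, R, hS, hT, mul_right_comm, he]
  push_cast
  ring

/-- Changing `δ` conjugates `K(u)` by a multiplication operator, so the determinant does not
depend on `δ`. -/
theorem detK_eq_detK_zero (δ : ℝ) (u : ℂ) : detK P δ u = detK P 0 u := by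
  have hK : ∀ p q, blockKernel (K P δ u) p q = Complex.exp (-δ * p.2) *
      blockKernel (K P 0 u) p q * Complex.exp (δ * q.2) := by
    rintro ⟨i, x⟩ ⟨j, y⟩
    have := R_eq_exp_mul (P := P) (δ := δ) u x y
    fin_cases i <;> fin_cases j <;> simp [blockKernel, K, this] <;> ring
  have hint : ∀ n, fredholmIntegrand (blockKernel (K P δ u)) n =
      fredholmIntegrand (blockKernel (K P 0 u)) n := fun n => by
    ext l
    have e1 : (Matrix.of fun p q : Fin n => blockKernel (K P δ u) (l p) (l q)) =
        Matrix.of fun p q : Fin n => Complex.exp (δ * (l q).2) *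
          (Matrix.of fun p q : Fin n => Complex.exp (-δ * (l p).2) *
            (Matrix.of fun p q : Fin n => blockKernel (K P 0 u) (l p) (l q)) p q) p q := by
      ext p q
      simp only [Matrix.of_apply, hK (l p) (l q)]
      ring
    have e2 : (∏ i, Complex.exp (δ * (l i).2)) * ∏ i, Complex.exp (-δ * (l i).2) = 1 := by
      rw [← Finset.prod_mul_distrib]
      refine Finset.prod_eq_one fun i _ => ?_
      rw [← Complex.exp_add]
      simp
    simp only [fredholmIntegrand]
    rw [e1, Matrix.det_mul_row, Matrix.det_mul_column, ← mul_assoc, e2, one_mul]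
  simp only [detK, fredholmDet, fredholmTerm, hint]

end Determinants

/-- If `f` is holomorphic on the punctured plane, the integral of `f(u) / (u - 1)` over the circle
of radius `r > 1` does not depend on `r`. -/
theorem circleIntegral_inv_sub_one_mul_eq {f : ℂ → ℂ} (hf : DifferentiableOn ℂ f {0}ᶜ) {r₁ r₂ : ℝ}
    (h₁ : 1 < r₁) (h₂ : 1 < r₂) : ∮ u in C(0, r₁), (u - 1)⁻¹ * f u =
      ∮ u in C(0, r₂), (u - 1)⁻¹ * f u := by
  wlog h : r₁ ≤ r₂ generalizing r₁ r₂
  · exact (this h₂ h₁ (le_of_not_ge h)).symm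
  have hne : ∀ z : ℂ, 1 < ‖z‖ → z ≠ 0 ∧ z - 1 ≠ 0 := by
    refine fun z hz => ⟨?_, fun h0 => ?_⟩
    · rintro rfl
      rw [norm_zero] at hz
      linarith
    · rw [sub_eq_zero.1 h0, norm_one] at hz
      exact lt_irrefl _ hz
  have hd : ∀ z : ℂ, 1 < ‖z‖ → DifferentiableAt ℂ (fun z => z * (z - 1)⁻¹ * f z) z := fun z hz => by
    have e : DifferentiableAt ℂ (fun z : ℂ => z - 1) z := by fun_prop
    exact (differentiableAt_fun_id.mul (e.fun_inv (hne z hz).2)).fun_mul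
      ((hf z (hne z hz).1).differentiableAt (isOpen_compl_singleton.mem_nhds (hne z hz).1))
  have hint : ∀ r : ℝ, 1 < r → ∮ u in C(0, r), (u - 1)⁻¹ * f u =
      ∮ u in C(0, r), (u - 0)⁻¹ • (u * (u - 1)⁻¹ * f u) := fun r hr => by
    refine circleIntegral.integral_congr (by linarith) fun z hz => ?_
    have hz' : ‖z‖ = r := by simpa using hz
    have := (hne z (by rw [hz']; exact hr)).1
    simp only [sub_zero, smul_eq_mul]
    field_simp
  rw [hint r₁ h₁, hint r₂ h₂]
  refine (Complex.circleIntegral_sub_center_inv_smul_eq_of_differentiable_on_annulus_off_countable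
    (by linarith) h Set.countable_empty ?_ ?_).symm
  · intro z hz
    refine (hd z ?_).continuousAt.continuousWithinAt
    have : r₁ ≤ ‖z‖ := by simpa using hz.2
    linarith
  · intro z hz
    refine hd z ?_
    have : r₁ < ‖z‖ := by simpa using hz.1.2
    linarith

theorem circleIntegrable_inv_sub_one_mul {f : ℂ → ℂ} (hf : DifferentiableOn ℂ f {0}ᶜ) {r : ℝ}
    (hr : 1 < r) : CircleIntegrable (fun u => (u - 1)⁻¹ * f u) 0 r := by
  refine ContinuousOn.circleIntegrable (by linarith) ?_
  have hz' : ∀ z ∈ Metric.sphere (0 : ℂ) r, ‖z‖ = r := fun z hz => by simpa using hz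
  refine ContinuousOn.mul (ContinuousOn.inv₀ (by fun_prop) fun z hz h0 => ?_)
    (hf.continuousOn.mono fun z hz h0 => ?_)
  · have := hz' z hz
    rw [sub_eq_zero.1 h0, norm_one] at this
    linarith
  · have := hz' z hz
    rw [Set.mem_singleton_iff.1 h0, norm_zero] at this
    linarith

end TwoTime

open TwoTime in
theorem proposition6p1 (P : Params) (ht₁ : 0 < P.t₁) (ht₂ : P.t₁ < P.t₂)
    (δ₀ : ℝ) (hδ₀ : max P.η₁ (P.α * P.Δη) < δ₀) (r₀ : ℝ) (hr₀ : 1 < r₀)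
    (δ : ℝ) (hδ : max P.η₁ (P.α * P.Δη) < δ) (r : ℝ) (hr : 1 < r) :
    (∀ u : ℂ, u ≠ 0 → FredholmConverges measureX (blockKernel (K P δ₀ u))) ∧
    CircleIntegrable (fun u : ℂ => (u - 1)⁻¹ * detK P δ₀ u) 0 r₀ ∧
    (∀ u : ℂ, u ≠ 0 → FredholmConverges measureY (blockKernel (Q P δ u))) ∧
    CircleIntegrable (fun u : ℂ => (u - 1)⁻¹ * detQ P δ u) 0 r ∧
    twoTimeF P δ₀ r₀ =
      (2 * Real.pi * Complex.I : ℂ)⁻¹ * ∮ u in C(0, r), (u - 1)⁻¹ * detQ P δ u := by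
  have hP := Params.relations ht₁ ht₂
  obtain ⟨ε₀, M₀, C₀, h₀⟩ := exists_kernelBounds hP.α_pos hδ₀
  obtain ⟨ε, M, C, h⟩ := exists_kernelBounds hP.α_pos hδ
  have hdiff := differentiableOn_detK h₀
  have hdet : ∀ u ≠ 0, detK P δ₀ u = detQ P δ u := fun u hu => by
    rw [detK_eq_detK_zero, ← detK_eq_detK_zero δ, detK_eq_detQ h hP hu]
  have hdiffQ : DifferentiableOn ℂ (detQ P δ) {0}ᶜ := hdiff.congr fun u hu => (hdet u hu).symm
  refine ⟨fun u _ => fredholmConverges_K h₀ u, circleIntegrable_inv_sub_one_mul hdiff hr₀,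
    fun u hu => fredholmConverges_Q h hP hu, circleIntegrable_inv_sub_one_mul hdiffQ hr, ?_⟩
  rw [twoTimeF, circleIntegral_inv_sub_one_mul_eq hdiff hr₀ hr]
  congr 1
  refine circleIntegral.integral_congr (by linarith) fun u hu => ?_
  have hu0 : u ≠ 0 := by
    rintro rfl
    simp only [mem_sphere_iff_norm, sub_zero, norm_zero] at hu
    linarith
  simp only [hdet u hu0]
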